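/- **Theorem.** Let $R=\mathbb{C}[z]$ and $\sigma^{\pm 1/2}(z)=z\mp\frac12$. For $t\in R\setminus\{0\}$ let $A(t)$ be the twisted generalized Weyl algebra of rank one, that is, the $\mathbb{C}$-algebra generated by $R$ and $X^{+},X^{-}$ with relations $X^{\pm}r=\sigma^{\pm1}(r)X^{\pm}$ $(r\in R)$ and $X^{\pm}X^{\mp}=\sigma^{\pm1/2}(t)$. Let $\mathcal{O}=\{(z-n)\mid n\in\mathbb{Z}\}\subset\mathrm{MaxSpec}(R)$ and let $A(t)\text{-wmod}_{\mathcal O}$ be the category of $A(t)$-modules $M$ that are the direct sum of their weight spaces $M_\lambda=\{v\mid zv=\lambda v\}$, have all $M_\lambda$ finite-dimensional, and have $M_\lambda\ne 0$ only for $\lambda\in\mathbb{Z}$. Let $K_0^{\mathrm{split}}(A(t)\text{-wmod}_{\mathcal O})$ be its split Grothendieck group (generators $[M]$, relations $[M\oplus M']=[M]+[M']$). For a multiplicative monoid $\Gamma\subset R\setminus\{0\}$ put $$\mathscr{A}^{\mathrm{split}}(\Gamma,\mathcal{O})=\bigoplus_{t\in\Gamma}\mathbb{C}\otimes_{\mathbb{Z}}K_0^{\mathrm{split}}(A(t)\text{-wmod}_{\mathcal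 O}),$$ with product $[M]\cdot[M']=[M\otimes_R M']$, where for $M\in A(t)\text{-wmod}_{\mathcal O}$ and $M'\in A(t')\text{-wmod}_{\mathcal O}$ the space $M\otimes_R M'$ is an $A(tt')$-module through $X^{\pm}(m\otimes m')=X^{\pm}m\otimes X^{\pm}m'$; this is a commutative unital $\mathbb{C}$-algebra. Let $Z\subseteq\mathbb{Z}+\frac12$ and let $\Gamma$ be the monoid of all monic polynomials in $\mathbb{C}[z]$ whose zero set is contained in $Z$. Then there is an isomorphism of $\mathbb{C}$-algebras $$\mathbb{C}[x_k^{+},x_k^{-},y_k^{+},y_k^{-}\mid k\in Z]/(\mathrm{Rels})\;\cong\;\mathscr{A}^{\mathrm{split}}(\Gamma,\mathcal{O}),$$ where the relations are, for all $j,k\in Z$, $$y_j^{+}x_k^{+}=y_j^{-}x_k^{+}=x_j^{+}x_k^{+}\quad (j\le k),\qquad x_j^{-}y_k^{+}=x_j^{-}y_k^{-}=x_j^{-}x_k^{-}\quad (j\le k),$$ $$x_j^{-}x_k^{+}=0\quad (j\le k),\qquad y_k^{+}y_k^{-}=(x_k^{+})^2+(x_k^{-})^2.$$ For every $k\in Z$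 the category $A(z-k)\text{-wmod}_{\mathcal O}$ has, up to isomorphism, exactly two simple objects and exactly two non-simple indecomposable objects. The isomorphism maps $x_k^{+}$ and $x_k^{-}$ to the classes of the simple objects with support $\{n\in\mathbb{Z}\mid n>k\}$ and $\{n\in\mathbb{Z}\mid n<k\}$ respectively. It maps $y_k^{+}$ and $y_k^{-}$ to the classes of the two non-simple indecomposable objects; both have support $\mathbb{Z}$. On the one for $y_k^{+}$, $X^{+}$ is nonzero on nonzero vectors of weight $k-\frac12$ and $X^{-}$ kills the vectors of weight $k+\frac12$. On the one for $y_k^{-}$, $X^{-}$ is nonzero on nonzero vectors of weight $k+\frac12$ and $X^{+}$ kills the vectors of weight $k-\frac12$. -/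

import Mathlib

open Polynomial TensorProduct

noncomputable section

namespace SplitTGWA

/-- The automorphism `z ↦ z - c` of `R = ℂ[z]`. Thus `σ^{1/2} = shift (1/2)`, `σ = shift 1`. -/
def shift (c : ℂ) : ℂ[X] →+* ℂ[X] := Polynomial.compRingHom (X - C c)

/-- The generators `z, X⁺, X⁻`. -/
inductive Gen | z | xp | xm

/-- The relations `X^± r = σ^{±1}(r) X^±` for `r ∈ R`, and `X^± X^∓ = σ^{±1/2}(t)`. -/
inductive Rel (t : ℂ[X]) : FreeAlgebra ℂ Gen → FreeAlgebra ℂ Gen → Prop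
  | xp_mul (r : ℂ[X]) : Rel t
      (FreeAlgebra.ι ℂ Gen.xp * aeval (FreeAlgebra.ι ℂ Gen.z) r)
      (aeval (FreeAlgebra.ι ℂ Gen.z) (shift 1 r) * FreeAlgebra.ι ℂ Gen.xp)
  | xm_mul (r : ℂ[X]) : Rel t
      (FreeAlgebra.ι ℂ Gen.xm * aeval (FreeAlgebra.ι ℂ Gen.z) r)
      (aeval (FreeAlgebra.ι ℂ Gen.z) (shift (-1) r) * FreeAlgebra.ι ℂ Gen.xm)
  | xp_mul_xm : Rel t
      (FreeAlgebra.ι ℂ Gen.xp * FreeAlgebra.ι ℂ Gen.xm)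
      (aeval (FreeAlgebra.ι ℂ Gen.z) (shift (1 / 2) t))
  | xm_mul_xp : Rel t
      (FreeAlgebra.ι ℂ Gen.xm * FreeAlgebra.ι ℂ Gen.xp)
      (aeval (FreeAlgebra.ι ℂ Gen.z) (shift (-(1 / 2)) t))

/-- The twisted generalized Weyl algebra `A(t)` of rank one over `R = ℂ[z]` with
`σ^{1/2}(z) = z - 1/2`, generated by `R` and `X^±`. -/
def A (t : ℂ[X]) : Type := RingQuot (Rel t)

instance (t : ℂ[X]) : Ring (A t) := inferInstanceAs (Ring (RingQuot (Rel t)))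
instance (t : ℂ[X]) : Algebra ℂ (A t) := RingQuot.instAlgebra (S := ℂ) (Rel t)

/-- The quotient map from the free algebra. -/
def A.mk (t : ℂ[X]) : FreeAlgebra ℂ Gen →ₐ[ℂ] A t := RingQuot.mkAlgHom ℂ (Rel t)

/-- The image in `A(t)` of a generator. -/
def A.gen (t : ℂ[X]) (g : Gen) : A t := A.mk t (FreeAlgebra.ι ℂ g)

/-- The generator `X⁺` of `A(t)`. -/
abbrev A.Xp (t : ℂ[X]) : A t := A.gen t Gen.xp

/-- The generator `X⁻` of `A(t)`. -/
abbrev A.Xm (t : ℂ[X]) : A t := A.gen t Gen.xm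

/-- The canonical map `R = ℂ[z] → A(t)`. -/
def A.ofPoly (t : ℂ[X]) : ℂ[X] →ₐ[ℂ] A t := aeval (A.gen t Gen.z)

lemma A.mk_aeval (t r : ℂ[X]) :
    A.mk t (aeval (FreeAlgebra.ι ℂ Gen.z) r) = A.ofPoly t r :=
  (Polynomial.aeval_algHom_apply _ _ _).symm

lemma A.Xp_mul (t r : ℂ[X]) : A.Xp t * A.ofPoly t r = A.ofPoly t (shift 1 r) * A.Xp t := by
  have := RingQuot.mkAlgHom_rel ℂ (Rel.xp_mul (t := t) r)
  change A.mk t _ = A.mk t _ at this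
  rw [map_mul, map_mul, A.mk_aeval, A.mk_aeval] at this
  exact this

lemma A.Xm_mul (t r : ℂ[X]) : A.Xm t * A.ofPoly t r = A.ofPoly t (shift (-1) r) * A.Xm t := by
  have := RingQuot.mkAlgHom_rel ℂ (Rel.xm_mul (t := t) r)
  change A.mk t _ = A.mk t _ at this
  rw [map_mul, map_mul, A.mk_aeval, A.mk_aeval] at this
  exact this

lemma A.Xp_mul_Xm (t : ℂ[X]) : A.Xp t * A.Xm t = A.ofPoly t (shift (1 / 2) t) := by
  have := RingQuot.mkAlgHom_rel ℂ (Rel.xp_mul_xm (t := t))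
  change A.mk t _ = A.mk t _ at this
  rw [map_mul, A.mk_aeval] at this
  exact this

lemma A.Xm_mul_Xp (t : ℂ[X]) : A.Xm t * A.Xp t = A.ofPoly t (shift (-(1 / 2)) t) := by
  have := RingQuot.mkAlgHom_rel ℂ (Rel.xm_mul_xp (t := t))
  change A.mk t _ = A.mk t _ at this
  rw [map_mul, A.mk_aeval] at this
  exact this

/-- An element of `A(t)` is a noncommutative polynomial in `z, X⁺, X⁻`. -/
lemma A.induction (t : ℂ[X]) {P : A t → Prop} (hc : ∀ c : ℂ, P (algebraMap ℂ (A t) c))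
    (hg : ∀ g, P (A.gen t g)) (ha : ∀ a b, P a → P b → P (a + b))
    (hm : ∀ a b, P a → P b → P (a * b)) (a : A t) : P a := by
  obtain ⟨a, rfl⟩ : ∃ b, A.mk t b = a := RingQuot.mkAlgHom_surjective ℂ (Rel t) a
  induction a using FreeAlgebra.induction with
  | grade0 c => rw [AlgHom.commutes]; exact hc c
  | grade1 g => exact hg g
  | mul a b h1 h2 => rw [map_mul]; exact hm _ _ h1 h2
  | add a b h1 h2 => rw [map_add]; exact ha _ _ h1 h2

section Weights

variable (M : Type) [AddCommGroup M] [Module ℂ M] [Module ℂ[X] M] [IsScalarTower ℂ ℂ[X] M]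

/-- The weight space `M_𝔪 = {v ∣ 𝔪 v = 0}` for the maximal ideal `𝔪 = (z - l)` of `ℂ[z]`. -/
def weightSpace (l : ℂ) : Submodule ℂ M :=
  Module.End.eigenspace (Algebra.lsmul ℂ ℂ M (X : ℂ[X])) l

variable {M}

lemma mem_weightSpace {l : ℂ} {v : M} : v ∈ weightSpace M l ↔ (X : ℂ[X]) • v = l • v := by
  simp [weightSpace]

lemma poly_smul_of_mem {l : ℂ} {v : M} (hv : v ∈ weightSpace M l) (p : ℂ[X]) :
    p • v = p.eval l • v := by
  rw [mem_weightSpace] at hv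
  induction p using Polynomial.induction_on' with
  | add p q hp hq => rw [add_smul, hp, hq, eval_add, add_smul]
  | monomial n a =>
    have : ∀ n : ℕ, (X ^ n : ℂ[X]) • v = l ^ n • v := by
      intro n
      induction n with
      | zero => simp
      | succ n ih => rw [pow_succ', mul_smul, ih, smul_comm, hv, smul_smul, pow_succ]
    rw [← smul_X_eq_monomial, smul_assoc, this, smul_smul]
    simp

end Weights

/-- Objects of the category `A(t)-wmod_𝒪` for the integral orbit `𝒪 = {(z - n) ∣ n ∈ ℤ}`. The
actions of `ℂ` and of `R = ℂ[z]` are the ones that are induced by the action of `A(t)`. Such a module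
is the direct sum of its weight spaces, which are finite-dimensional, and its support lies in `𝒪`. -/
structure WMod (t : ℂ[X]) where
  carrier : Type
  [grp : AddCommGroup carrier]
  [modC : Module ℂ carrier]
  [modR : Module ℂ[X] carrier]
  [tower : IsScalarTower ℂ ℂ[X] carrier]
  [modA : Module (A t) carrier]
  [towerA : IsScalarTower ℂ (A t) carrier]
  ofPoly_smul : ∀ (r : ℂ[X]) (v : carrier), A.ofPoly t r • v = r • v
  isInternal : DirectSum.IsInternal (fun l : ℂ => weightSpace carrier l)
  finite : ∀ l : ℂ, FiniteDimensional ℂ (weightSpace carrier l)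
  support : ∀ l : ℂ, weightSpace carrier l ≠ ⊥ → ∃ n : ℤ, l = n

namespace WMod

instance (t : ℂ[X]) : CoeSort (WMod t) Type := ⟨carrier⟩

attribute [instance] grp modC modR tower modA towerA

variable {t : ℂ[X]}

/-- `X⁺` acting on a module, as a `σ`-semilinear map over `ℂ[z]`. -/
def opP (M : WMod t) : M →ₛₗ[shift 1] M where
  toFun v := A.Xp t • v
  map_add' := smul_add _
  map_smul' r v := by
    rw [← M.ofPoly_smul, ← M.ofPoly_smul, ← mul_smul, A.Xp_mul, mul_smul]

/-- `X⁻` acting on a module, as a `σ⁻¹`-semilinear map over `ℂ[z]`. -/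
def opM (M : WMod t) : M →ₛₗ[shift (-1)] M where
  toFun v := A.Xm t • v
  map_add' := smul_add _
  map_smul' r v := by
    rw [← M.ofPoly_smul, ← M.ofPoly_smul, ← mul_smul, A.Xm_mul, mul_smul]

lemma opP_opM (M : WMod t) (v : M) : M.opP (M.opM v) = shift (1 / 2) t • v := by
  change A.Xp t • A.Xm t • v = _
  rw [← mul_smul, A.Xp_mul_Xm, M.ofPoly_smul]

lemma opM_opP (M : WMod t) (v : M) : M.opM (M.opP v) = shift (-(1 / 2)) t • v := by
  change A.Xm t • A.Xp t • v = _
  rw [← mul_smul, A.Xm_mul_Xp, M.ofPoly_smul]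

lemma iSup_weightSpace (M : WMod t) : ⨆ l, weightSpace M l = ⊤ :=
  M.isInternal.submodule_iSup_eq_top

end WMod

section Action

variable {V : Type} [AddCommGroup V] [Module ℂ V] [Module ℂ[X] V] [IsScalarTower ℂ ℂ[X] V]

/-- A semilinear map over a substitution `z ↦ z - c` is linear over `ℂ`. -/
def toLin {c : ℂ} (f : V →ₛₗ[shift c] V) : V →ₗ[ℂ] V where
  toFun := f
  map_add' := map_add f
  map_smul' a v := by
    have h : ∀ w : V, a • w = (C a : ℂ[X]) • w := fun w => by
      rw [← mul_one (C a), ← smul_eq_C_mul, smul_assoc, one_smul]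
    rw [h v, map_smulₛₗ, RingHom.id_apply, h]
    simp [shift]

/-- Operators `P = X⁺` and `Q = X⁻` on an `R`-module which satisfy the relations of `A(t)` make it
a module over `A(t)`. -/
def actHom (t : ℂ[X]) (P : V →ₛₗ[shift 1] V) (Q : V →ₛₗ[shift (-1)] V)
    (hPQ : ∀ v, P (Q v) = shift (1 / 2) t • v) (hQP : ∀ v, Q (P v) = shift (-(1 / 2)) t • v) :
    A t →ₐ[ℂ] Module.End ℂ V :=
  RingQuot.liftAlgHom ℂ ⟨FreeAlgebra.lift ℂ (fun g => match g with
    | .z => Algebra.lsmul ℂ ℂ V (X : ℂ[X])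
    | .xp => toLin P
    | .xm => toLin Q), by
      have key : ∀ r : ℂ[X], aeval (Algebra.lsmul ℂ ℂ V (X : ℂ[X])) r = Algebra.lsmul ℂ ℂ V r :=
        fun r => by rw [aeval_algHom_apply, aeval_X_left_apply]
      intro a b h
      induction h with
      | xp_mul r =>
        simp only [map_mul, ← aeval_algHom_apply, FreeAlgebra.lift_ι_apply, key]
        ext v
        exact P.map_smulₛₗ r v
      | xm_mul r =>
        simp only [map_mul, ← aeval_algHom_apply, FreeAlgebra.lift_ι_apply, key]
        ext v
        exact Q.map_smulₛₗ r v
      | xp_mul_xm =>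
        simp only [map_mul, ← aeval_algHom_apply, FreeAlgebra.lift_ι_apply, key]
        ext v
        exact hPQ v
      | xm_mul_xp =>
        simp only [map_mul, ← aeval_algHom_apply, FreeAlgebra.lift_ι_apply, key]
        ext v
        exact hQP v⟩

variable {t : ℂ[X]} {P : V →ₛₗ[shift 1] V} {Q : V →ₛₗ[shift (-1)] V}
    {hPQ : ∀ v, P (Q v) = shift (1 / 2) t • v} {hQP : ∀ v, Q (P v) = shift (-(1 / 2)) t • v}

lemma actHom_xp (v : V) : actHom t P Q hPQ hQP (A.Xp t) v = P v := by
  simp only [actHom, A.gen]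
  erw [RingQuot.liftAlgHom_mkAlgHom_apply]
  rw [FreeAlgebra.lift_ι_apply]
  rfl

lemma actHom_xm (v : V) : actHom t P Q hPQ hQP (A.Xm t) v = Q v := by
  simp only [actHom, A.gen]
  erw [RingQuot.liftAlgHom_mkAlgHom_apply]
  rw [FreeAlgebra.lift_ι_apply]
  rfl

lemma actHom_z (v : V) : actHom t P Q hPQ hQP (A.gen t Gen.z) v = (X : ℂ[X]) • v := by
  simp only [actHom, A.gen]
  erw [RingQuot.liftAlgHom_mkAlgHom_apply]
  rw [FreeAlgebra.lift_ι_apply]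
  rfl

lemma actHom_ofPoly (r : ℂ[X]) (v : V) :
    actHom t P Q hPQ hQP (A.ofPoly t r) v = r • v := by
  have h : actHom t P Q hPQ hQP (A.gen t Gen.z) = Algebra.lsmul ℂ ℂ V (X : ℂ[X]) :=
    LinearMap.ext actHom_z
  rw [A.ofPoly, ← aeval_algHom_apply, h, aeval_algHom_apply, aeval_X_left_apply]
  rfl

/-- If subspaces of the weight spaces span the module, then they are the weight spaces. -/
lemma weightSpace_eq_of_le {W : ℂ → Submodule ℂ V} (hW : ∀ l, W l ≤ weightSpace V l)
    (htop : ⨆ l, W l = ⊤) (l : ℂ) : weightSpace V l = W l := by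
  refine le_antisymm (fun v hv => ?_) (hW l)
  have hind : iSupIndep (weightSpace V) := Module.End.eigenspaces_iSupIndep _
  have h1 : W l ⊔ ⨆ m, ⨆ _ : m ≠ l, W m = ⊤ := by
    rw [eq_top_iff, ← htop]
    refine iSup_le fun m => ?_
    by_cases h : m = l
    · subst h; exact le_sup_left
    · exact le_sup_of_le_right (le_iSup₂_of_le m h le_rfl)
  obtain ⟨a, ha, b, hb, hab⟩ := Submodule.mem_sup.1 (h1 ▸ Submodule.mem_top : v ∈ _)
  have hb' : b ∈ ⨆ m, ⨆ _ : m ≠ l, weightSpace V m :=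
    (iSup₂_mono fun m _ => hW m) hb
  have hb2 : b ∈ weightSpace V l := by
    rw [← hab] at hv
    exact (Submodule.add_mem_iff_right _ (hW l ha)).1 hv
  have : b = 0 := (Submodule.disjoint_def.1 (hind l)) b hb2 hb'
  rw [← hab, this, add_zero]
  exact ha

lemma isInternal_of_iSup (h : ⨆ l, weightSpace V l = ⊤) :
    DirectSum.IsInternal (fun l : ℂ => weightSpace V l) :=
  (DirectSum.isInternal_submodule_iff_iSupIndep_and_iSup_eq_top _).2
    ⟨Module.End.eigenspaces_iSupIndep _, h⟩

/-- The object of `A(t)-wmod_𝒪` defined by operators `P = X⁺`, `Q = X⁻` on an `R`-module that is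
the sum of finite-dimensional spaces `W l` of weights `l ∈ ℤ`. -/
def WMod.ofOps (t : ℂ[X]) (P : V →ₛₗ[shift 1] V) (Q : V →ₛₗ[shift (-1)] V)
    (hPQ : ∀ v, P (Q v) = shift (1 / 2) t • v) (hQP : ∀ v, Q (P v) = shift (-(1 / 2)) t • v)
    (W : ℂ → Submodule ℂ V) (hW : ∀ l, W l ≤ weightSpace V l) (htop : ⨆ l, W l = ⊤)
    (hfin : ∀ l, FiniteDimensional ℂ (W l)) (hsupp : ∀ l, W l ≠ ⊥ → ∃ n : ℤ, l = n) :
    WMod t :=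
  letI : Module (A t) V := Module.compHom V (actHom t P Q hPQ hQP).toRingHom
  haveI : IsScalarTower ℂ (A t) V := ⟨fun c a v => by
    change actHom t P Q hPQ hQP (c • a) v = c • actHom t P Q hPQ hQP a v
    rw [map_smul]; rfl⟩
  { carrier := V
    ofPoly_smul := actHom_ofPoly
    isInternal := isInternal_of_iSup (by simp only [weightSpace_eq_of_le hW htop, htop])
    finite := fun l => by rw [weightSpace_eq_of_le hW htop]; exact hfin l
    support := fun l => by rw [weightSpace_eq_of_le hW htop]; exact hsupp l }

end Action

section Tensor

variable {t t' : ℂ[X]} (M : WMod t) (N : WMod t')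

/-- The image of `M_l ⊗ N_l` in `M ⊗_R N`. -/
def tensorWeight (l : ℂ) : Submodule ℂ (M ⊗[ℂ[X]] N) :=
  Submodule.map₂ ((TensorProduct.mk ℂ[X] M N).restrictScalars₁₂ ℂ ℂ)
    (weightSpace M l) (weightSpace N l)

lemma tensorWeight_le (l : ℂ) : tensorWeight M N l ≤ weightSpace (M ⊗[ℂ[X]] N) l := by
  refine Submodule.map₂_le.2 fun m hm n _ => ?_
  rw [mem_weightSpace] at hm ⊢
  change (X : ℂ[X]) • (m ⊗ₜ[ℂ[X]] n) = l • (m ⊗ₜ[ℂ[X]] n)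
  rw [TensorProduct.smul_tmul', hm, TensorProduct.smul_tmul']

lemma tmul_eq_zero_of_ne {l l' : ℂ} (h : l ≠ l') {m : M} {n : N} (hm : m ∈ weightSpace M l)
    (hn : n ∈ weightSpace N l') : m ⊗ₜ[ℂ[X]] n = 0 := by
  rw [mem_weightSpace] at hm hn
  have h1 : l • (m ⊗ₜ[ℂ[X]] n) = l' • (m ⊗ₜ[ℂ[X]] n) := by
    rw [TensorProduct.smul_tmul', ← hm, TensorProduct.smul_tmul, hn, TensorProduct.tmul_smul]
  have h2 : (l - l') • (m ⊗ₜ[ℂ[X]] n) = 0 := by rw [sub_smul, h1, sub_self]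
  exact (smul_eq_zero.1 h2).resolve_left (sub_ne_zero.2 h)

lemma iSup_tensorWeight : ⨆ l, tensorWeight M N l = ⊤ := by
  have hm : ∀ m : M, m ∈ ⨆ l, weightSpace M l := fun m => by rw [M.iSup_weightSpace]; trivial
  have hn : ∀ n : N, n ∈ ⨆ l, weightSpace N l := fun n => by rw [N.iSup_weightSpace]; trivial
  rw [eq_top_iff]
  rintro x -
  induction x using TensorProduct.induction_on with
  | zero => exact zero_mem _
  | add x y hx hy => exact add_mem hx hy
  | tmul m n =>
    induction hm m using Submodule.iSup_induction' with
    | zero => rw [TensorProduct.zero_tmul]; exact zero_mem _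
    | add x y _ _ hx hy => rw [TensorProduct.add_tmul]; exact add_mem hx hy
    | mem l m hm =>
      induction hn n using Submodule.iSup_induction' with
      | zero => rw [TensorProduct.tmul_zero]; exact zero_mem _
      | add x y _ _ hx hy => rw [TensorProduct.tmul_add]; exact add_mem hx hy
      | mem l' n hn =>
        by_cases h : l = l'
        · subst h
          exact Submodule.mem_iSup_of_mem l
            (Submodule.apply_mem_map₂ ((TensorProduct.mk ℂ[X] M N).restrictScalars₁₂ ℂ ℂ) hm hn)
        · rw [tmul_eq_zero_of_ne M N h hm hn]
          exact zero_mem _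

/-- The tensor product `M ⊗_R N` as an `A(tt')`-module, on which `X^±` acts by
`X^± (m ⊗ n) = X^± m ⊗ X^± n`. -/
def WMod.tensor : WMod (t * t') :=
  WMod.ofOps (V := M ⊗[ℂ[X]] N) (t * t') (TensorProduct.map M.opP N.opP)
    (TensorProduct.map M.opM N.opM)
    (fun v => by
      induction v using TensorProduct.induction_on with
      | zero => simp
      | add x y hx hy => simp only [map_add, smul_add, hx, hy]
      | tmul m n =>
        rw [TensorProduct.map_tmul, TensorProduct.map_tmul, M.opP_opM, N.opP_opM, map_mul,
          mul_smul, TensorProduct.tmul_smul, TensorProduct.smul_tmul', TensorProduct.smul_tmul',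
          TensorProduct.smul_tmul', smul_smul, smul_smul, mul_comm])
    (fun v => by
      induction v using TensorProduct.induction_on with
      | zero => simp
      | add x y hx hy => simp only [map_add, smul_add, hx, hy]
      | tmul m n =>
        rw [TensorProduct.map_tmul, TensorProduct.map_tmul, M.opM_opP, N.opM_opP, map_mul,
          mul_smul, TensorProduct.tmul_smul, TensorProduct.smul_tmul', TensorProduct.smul_tmul',
          TensorProduct.smul_tmul', smul_smul, smul_smul, mul_comm])
    (tensorWeight M N) (tensorWeight_le M N) (iSup_tensorWeight M N)
    (fun l => by
      have := M.finite l
      have := N.finite l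
      exact Module.Finite.iff_fg.2 (Submodule.FG.map₂ _
        (Module.Finite.iff_fg.1 (M.finite l)) (Module.Finite.iff_fg.1 (N.finite l))))
    (fun l h => M.support l fun h0 => h (by
      rw [tensorWeight, h0, Submodule.map₂_bot_left]))

end Tensor

section Iso

variable {t t' : ℂ[X]}

/-- Linearity over `A(t)` can be checked on `R` and `X^±`. -/
def equivOfGens {V V' : Type} [AddCommGroup V] [Module (A t) V] [AddCommGroup V'] [Module (A t) V']
    (e : V ≃+ V') (hr : ∀ (r : ℂ[X]) (v : V), e (A.ofPoly t r • v) = A.ofPoly t r • e v)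
    (hP : ∀ v, e (A.Xp t • v) = A.Xp t • e v) (hM : ∀ v, e (A.Xm t • v) = A.Xm t • e v) :
    V ≃ₗ[A t] V' where
  __ := e
  map_smul' a v := by
    change e (a • v) = a • e v
    induction a using A.induction generalizing v with
    | hc c => simpa [A.ofPoly] using hr (C c) v
    | hg g =>
      match g with
      | .z => simpa [A.ofPoly] using hr X v
      | .xp => exact hP v
      | .xm => exact hM v
    | ha a b h1 h2 => rw [add_smul, map_add, h1, h2, add_smul]
    | hm a b h1 h2 => rw [mul_smul, h1, h2, mul_smul]

/-- Isomorphisms can be checked on the generators of `A(t)`. -/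
def isoOfOps {M N : WMod t} (e : M ≃ₗ[ℂ[X]] N) (hP : ∀ v, e (M.opP v) = N.opP (e v))
    (hM : ∀ v, e (M.opM v) = N.opM (e v)) : M ≃ₗ[A t] N :=
  equivOfGens e.toAddEquiv (fun r v => by
    rw [M.ofPoly_smul, N.ofPoly_smul]; exact e.map_smul r v) hP hM

/-- A decomposition `P ≅ M ⊕ N` on the level of `R`-modules. -/
def isoPolyProd {M N P : WMod t} (e : P ≃ₗ[A t] M × N) : P ≃ₗ[ℂ[X]] M × N where
  __ := e.toAddEquiv
  map_smul' r v := by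
    change e (r • v) = r • e v
    rw [← P.ofPoly_smul, map_smul]
    ext
    · exact M.ofPoly_smul _ _
    · exact N.ofPoly_smul _ _

lemma tensor_opP (M : WMod t) (N : WMod t') (v : M ⊗[ℂ[X]] N) :
    (M.tensor N).opP v = TensorProduct.map M.opP N.opP v :=
  actHom_xp v

lemma tensor_opM (M : WMod t) (N : WMod t') (v : M ⊗[ℂ[X]] N) :
    (M.tensor N).opM v = TensorProduct.map M.opM N.opM v :=
  actHom_xm v

/-- `P ⊗ N ≅ (M ⊗ N) ⊕ (M' ⊗ N)` if `P ≅ M ⊕ M'`. -/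
def tensorProdLeft {M M' P : WMod t} (e : P ≃ₗ[A t] M × M') (N : WMod t') :
    P.tensor N ≃ₗ[A (t * t')] M.tensor N × M'.tensor N :=
  let f : P ⊗[ℂ[X]] N ≃ₗ[ℂ[X]] (M ⊗[ℂ[X]] N) × (M' ⊗[ℂ[X]] N) :=
    (TensorProduct.congr (isoPolyProd e) (LinearEquiv.refl ℂ[X] N)).trans
      (TensorProduct.prodLeft ℂ[X] ℂ[X] M M' N)
  have hf : ∀ p n, f (p ⊗ₜ n) = ((e p).1 ⊗ₜ n, (e p).2 ⊗ₜ n) := fun _ _ => rfl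
  equivOfGens (V := P.tensor N) (V' := M.tensor N × M'.tensor N) f.toAddEquiv
    (fun r v => by
      rw [(P.tensor N).ofPoly_smul]
      refine (f.map_smul r v).trans ?_
      ext
      · exact ((M.tensor N).ofPoly_smul _ _).symm
      · exact ((M'.tensor N).ofPoly_smul _ _).symm)
    (fun v => by
      refine (congrArg f (tensor_opP P N v)).trans (Eq.trans ?_ (congrArg₂ Prod.mk
        (tensor_opP M N (f v).1) (tensor_opP M' N (f v).2)).symm)
      induction v using TensorProduct.induction_on with
      | zero => simp only [map_zero, Prod.fst_zero, Prod.snd_zero]; rfl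
      | add x y hx hy =>
        simp only [map_add, hx, hy, Prod.fst_add, Prod.snd_add]; rfl
      | tmul p n =>
        have h : e (P.opP p) = (M.opP (e p).1, M'.opP (e p).2) := e.map_smul _ _
        rw [TensorProduct.map_tmul, hf, hf, h, TensorProduct.map_tmul, TensorProduct.map_tmul]; rfl)
    (fun v => by
      refine (congrArg f (tensor_opM P N v)).trans (Eq.trans ?_ (congrArg₂ Prod.mk
        (tensor_opM M N (f v).1) (tensor_opM M' N (f v).2)).symm)
      induction v using TensorProduct.induction_on with
      | zero => simp only [map_zero, Prod.fst_zero, Prod.snd_zero]; rfl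
      | add x y hx hy =>
        simp only [map_add, hx, hy, Prod.fst_add, Prod.snd_add]; rfl
      | tmul p n =>
        have h : e (P.opM p) = (M.opM (e p).1, M'.opM (e p).2) := e.map_smul _ _
        rw [TensorProduct.map_tmul, hf, hf, h, TensorProduct.map_tmul, TensorProduct.map_tmul]; rfl)

/-- `N ⊗ P ≅ (N ⊗ M) ⊕ (N ⊗ M')` if `P ≅ M ⊕ M'`. -/
def tensorProdRight (N : WMod t) {M M' P : WMod t'} (e : P ≃ₗ[A t'] M × M') :
    N.tensor P ≃ₗ[A (t * t')] N.tensor M × N.tensor M' :=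
  let f : N ⊗[ℂ[X]] P ≃ₗ[ℂ[X]] (N ⊗[ℂ[X]] M) × (N ⊗[ℂ[X]] M') :=
    (TensorProduct.congr (LinearEquiv.refl ℂ[X] N) (isoPolyProd e)).trans
      (TensorProduct.prodRight ℂ[X] ℂ[X] N M M')
  have hf : ∀ n p, f (n ⊗ₜ p) = (n ⊗ₜ (e p).1, n ⊗ₜ (e p).2) := fun _ _ => rfl
  equivOfGens (V := N.tensor P) (V' := N.tensor M × N.tensor M') f.toAddEquiv
    (fun r v => by
      rw [(N.tensor P).ofPoly_smul]
      refine (f.map_smul r v).trans ?_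
      ext
      · exact ((N.tensor M).ofPoly_smul _ _).symm
      · exact ((N.tensor M').ofPoly_smul _ _).symm)
    (fun v => by
      refine (congrArg f (tensor_opP N P v)).trans (Eq.trans ?_ (congrArg₂ Prod.mk
        (tensor_opP N M (f v).1) (tensor_opP N M' (f v).2)).symm)
      induction v using TensorProduct.induction_on with
      | zero => simp only [map_zero, Prod.fst_zero, Prod.snd_zero]; rfl
      | add x y hx hy =>
        simp only [map_add, hx, hy, Prod.fst_add, Prod.snd_add]; rfl
      | tmul n p =>
        have h : e (P.opP p) = (M.opP (e p).1, M'.opP (e p).2) := e.map_smul _ _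
        rw [TensorProduct.map_tmul, hf, hf, h, TensorProduct.map_tmul, TensorProduct.map_tmul]; rfl)
    (fun v => by
      refine (congrArg f (tensor_opM N P v)).trans (Eq.trans ?_ (congrArg₂ Prod.mk
        (tensor_opM N M (f v).1) (tensor_opM N M' (f v).2)).symm)
      induction v using TensorProduct.induction_on with
      | zero => simp only [map_zero, Prod.fst_zero, Prod.snd_zero]; rfl
      | add x y hx hy =>
        simp only [map_add, hx, hy, Prod.fst_add, Prod.snd_add]; rfl
      | tmul n p =>
        have h : e (P.opM p) = (M.opM (e p).1, M'.opM (e p).2) := e.map_smul _ _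
        rw [TensorProduct.map_tmul, hf, hf, h, TensorProduct.map_tmul, TensorProduct.map_tmul]; rfl)

/-- `M ⊗ N ≅ N ⊗ M` over `R`. -/
def tensorComm (M : WMod t) (N : WMod t') : M.tensor N ≃ₗ[ℂ[X]] N.tensor M :=
  TensorProduct.comm ℂ[X] M N

lemma tensorComm_opP (M : WMod t) (N : WMod t') (v : M.tensor N) :
    tensorComm M N ((M.tensor N).opP v) = (N.tensor M).opP (tensorComm M N v) :=
  (congrArg (tensorComm M N) (tensor_opP M N v)).trans
    ((TensorProduct.map_comm N.opP M.opP v).symm.trans (tensor_opP N M _).symm)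

lemma tensorComm_opM (M : WMod t) (N : WMod t') (v : M.tensor N) :
    tensorComm M N ((M.tensor N).opM v) = (N.tensor M).opM (tensorComm M N v) :=
  (congrArg (tensorComm M N) (tensor_opM M N v)).trans
    ((TensorProduct.map_comm N.opM M.opM v).symm.trans (tensor_opM N M _).symm)

variable {t'' : ℂ[X]}

/-- `(M ⊗ N) ⊗ L ≅ M ⊗ (N ⊗ L)` over `R`. -/
def tensorAssoc (M : WMod t) (N : WMod t') (L : WMod t'') :
    (M.tensor N).tensor L ≃ₗ[ℂ[X]] M.tensor (N.tensor L) :=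
  TensorProduct.assoc ℂ[X] M N L

lemma assoc_hom_ext (M : WMod t) (N : WMod t') (L : WMod t'') {G : Type*} [AddCommMonoid G]
    (f g : (M.tensor N).tensor L →+ G)
    (h : ∀ (m : M) (n : N) (l : L), f ((show M.tensor N from m ⊗ₜ n) ⊗ₜ l) =
      g ((show M.tensor N from m ⊗ₜ n) ⊗ₜ l)) : (f : _ → G) = g := by
  let f' : (M ⊗[ℂ[X]] N) ⊗[ℂ[X]] L →+ G := f
  let g' : (M ⊗[ℂ[X]] N) ⊗[ℂ[X]] L →+ G := g
  suffices ∀ v, f' v = g' v from funext this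
  intro v
  induction v using TensorProduct.induction_on with
  | zero => rw [map_zero, map_zero]
  | add x y hx hy => rw [map_add, map_add, hx, hy]
  | tmul x l =>
    induction x using TensorProduct.induction_on with
    | zero => rw [TensorProduct.zero_tmul, map_zero, map_zero]
    | add x y hx hy => rw [TensorProduct.add_tmul, map_add, map_add, hx, hy]
    | tmul m n => exact h m n l

lemma tensorAssoc_opP (M : WMod t) (N : WMod t') (L : WMod t'') (v : (M.tensor N).tensor L) :
    tensorAssoc M N L (((M.tensor N).tensor L).opP v) =
      (M.tensor (N.tensor L)).opP (tensorAssoc M N L v) := by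
  let F : (M.tensor N).tensor L →+ M.tensor (N.tensor L) :=
    (tensorAssoc M N L).toLinearMap.toAddMonoidHom.comp ((M.tensor N).tensor L).opP.toAddMonoidHom
  let G : (M.tensor N).tensor L →+ M.tensor (N.tensor L) :=
    (M.tensor (N.tensor L)).opP.toAddMonoidHom.comp (tensorAssoc M N L).toLinearMap.toAddMonoidHom
  refine congrFun (assoc_hom_ext M N L F G fun m n l => ?_) v
  refine (congrArg (tensorAssoc M N L) ((tensor_opP (M.tensor N) L _).trans
      (congrArg (· ⊗ₜ[ℂ[X]] L.opP l) (tensor_opP M N (m ⊗ₜ n))))).trans ?_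
  exact ((tensor_opP M (N.tensor L) _).trans
      (congrArg (M.opP m ⊗ₜ[ℂ[X]] ·) (tensor_opP N L (n ⊗ₜ l)))).symm

lemma tensorAssoc_opM (M : WMod t) (N : WMod t') (L : WMod t'') (v : (M.tensor N).tensor L) :
    tensorAssoc M N L (((M.tensor N).tensor L).opM v) =
      (M.tensor (N.tensor L)).opM (tensorAssoc M N L v) := by
  let F : (M.tensor N).tensor L →+ M.tensor (N.tensor L) :=
    (tensorAssoc M N L).toLinearMap.toAddMonoidHom.comp ((M.tensor N).tensor L).opM.toAddMonoidHom
  let G : (M.tensor N).tensor L →+ M.tensor (N.tensor L) :=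
    (M.tensor (N.tensor L)).opM.toAddMonoidHom.comp (tensorAssoc M N L).toLinearMap.toAddMonoidHom
  refine congrFun (assoc_hom_ext M N L F G fun m n l => ?_) v
  refine (congrArg (tensorAssoc M N L) ((tensor_opM (M.tensor N) L _).trans
      (congrArg (· ⊗ₜ[ℂ[X]] L.opM l) (tensor_opM M N (m ⊗ₜ n))))).trans ?_
  exact ((tensor_opM M (N.tensor L) _).trans
      (congrArg (M.opM m ⊗ₜ[ℂ[X]] ·) (tensor_opM N L (n ⊗ₜ l)))).symm

end Iso

/-! ### The split Grothendieck group -/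

/-- The relations `[P] = [M] + [N]` for `P ≅ M ⊕ N`. (With `N = 0` they identify isomorphic
objects.) -/
def splitRel (t : ℂ[X]) : AddSubgroup (FreeAbelianGroup (WMod t)) :=
  AddSubgroup.closure {x | ∃ M N P : WMod t, Nonempty (P ≃ₗ[A t] M × N) ∧
    x = FreeAbelianGroup.of P - FreeAbelianGroup.of M - FreeAbelianGroup.of N}

/-- The split Grothendieck group of `A(t)-wmod_𝒪`. -/
def K0split (t : ℂ[X]) : Type 1 := FreeAbelianGroup (WMod t) ⧸ splitRel t

instance (t : ℂ[X]) : AddCommGroup (K0split t) :=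
  inferInstanceAs (AddCommGroup (FreeAbelianGroup (WMod t) ⧸ splitRel t))

/-- The class `[M]`. -/
def K0split.mk {t : ℂ[X]} (M : WMod t) : K0split t :=
  QuotientAddGroup.mk' (splitRel t) (FreeAbelianGroup.of M)

lemma K0split.mk_eq_add {t : ℂ[X]} {M N P : WMod t} (e : P ≃ₗ[A t] M × N) :
    K0split.mk P = K0split.mk M + K0split.mk N := by
  rw [← sub_eq_zero, ← sub_sub]
  exact (QuotientAddGroup.eq_zero_iff _).2 (AddSubgroup.subset_closure ⟨M, N, P, ⟨e⟩, rfl⟩)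

/-- Functions on objects that are additive on direct sums are defined on `K0split`. -/
def K0split.lift {t : ℂ[X]} {G : Type*} [AddCommGroup G] (f : WMod t → G)
    (hf : ∀ M N P : WMod t, (P ≃ₗ[A t] M × N) → f P = f M + f N) : K0split t →+ G :=
  QuotientAddGroup.lift (splitRel t) (FreeAbelianGroup.lift f) (by
    rw [splitRel, AddSubgroup.closure_le]
    rintro x ⟨M, N, P, ⟨e⟩, rfl⟩
    simp [hf M N P e])

lemma K0split.lift_mk {t : ℂ[X]} {G : Type*} [AddCommGroup G] (f : WMod t → G)
    (hf : ∀ M N P : WMod t, (P ≃ₗ[A t] M × N) → f P = f M + f N) (M : WMod t) :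
    K0split.lift f hf (K0split.mk M) = f M :=
  FreeAbelianGroup.lift_apply_of _ _

lemma K0split.hom_ext {t : ℂ[X]} {G : Type*} [AddCommGroup G] {f g : K0split t →+ G}
    (h : ∀ M, f (K0split.mk M) = g (K0split.mk M)) : f = g :=
  QuotientAddGroup.addMonoidHom_ext _ (FreeAbelianGroup.lift_ext _ _ fun M => h M)

/-- The zero module. -/
def WMod.zero (t : ℂ[X]) : WMod t :=
  WMod.ofOps (V := PUnit) t 0 0 (fun _ => rfl) (fun _ => rfl) (fun _ => ⊥) (fun _ => bot_le)
    (Subsingleton.elim _ _) (fun _ => inferInstance) (fun _ h => absurd rfl h)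

lemma K0split.mk_eq_of_iso {t : ℂ[X]} {M N : WMod t} (e : M ≃ₗ[A t] N) :
    K0split.mk M = K0split.mk N := by
  have : Unique (WMod.zero t) := inferInstanceAs (Unique PUnit)
  have h : ∀ N : WMod t, N ≃ₗ[A t] N × WMod.zero t := fun N =>
    (LinearEquiv.prodUnique (R := A t) (M := N) (M₂ := WMod.zero t)).symm
  rw [K0split.mk_eq_add (e.trans (h N)), ← K0split.mk_eq_add (h N)]

/-- The product `[M] ⊗ [N] ↦ [M ⊗_R N]`. -/
def K0split.mulHom (t t' : ℂ[X]) : K0split t →+ K0split t' →+ K0split (t * t') :=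
  K0split.lift
    (fun M => K0split.lift (fun N => K0split.mk (M.tensor N))
      (fun _ _ _ e => K0split.mk_eq_add (tensorProdRight M e)))
    (fun M M' P e => K0split.hom_ext fun N => by
      rw [AddMonoidHom.add_apply, K0split.lift_mk, K0split.lift_mk, K0split.lift_mk]
      exact K0split.mk_eq_add (tensorProdLeft e N))

lemma K0split.mulHom_mk {t t' : ℂ[X]} (M : WMod t) (N : WMod t') :
    K0split.mulHom t t' (K0split.mk M) (K0split.mk N) = K0split.mk (M.tensor N) := by
  rw [K0split.mulHom, K0split.lift_mk, K0split.lift_mk]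

/-- Extension of scalars of additive maps. -/
def complexify (G H : Type*) [AddCommGroup G] [AddCommGroup H] :
    (G →+ H) →+ (ℂ ⊗[ℤ] G →ₗ[ℂ] ℂ ⊗[ℤ] H) where
  toFun f := f.toIntLinearMap.baseChange ℂ
  map_zero' := LinearMap.baseChange_zero
  map_add' f g := LinearMap.baseChange_add f.toIntLinearMap g.toIntLinearMap

/-- The complexified product `(ℂ ⊗ K(t)) × (ℂ ⊗ K(t')) → ℂ ⊗ K(tt')`. -/
def K0split.mulC (t t' : ℂ[X]) :
    (ℂ ⊗[ℤ] K0split t) →ₗ[ℂ] (ℂ ⊗[ℤ] K0split t') →ₗ[ℂ] (ℂ ⊗[ℤ] K0split (t * t')) :=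
  LinearMap.liftBaseChange ℂ
    ((complexify _ _).comp (K0split.mulHom t t')).toIntLinearMap

lemma K0split.mulC_tmul {t t' : ℂ[X]} (M : WMod t) (N : WMod t') :
    K0split.mulC t t' (1 ⊗ₜ K0split.mk M) (1 ⊗ₜ K0split.mk N) = 1 ⊗ₜ K0split.mk (M.tensor N) := by
  rw [K0split.mulC, LinearMap.liftBaseChange_tmul, one_smul]
  change (1 : ℂ) ⊗ₜ[ℤ] (K0split.mulHom t t' (K0split.mk M) (K0split.mk N)) = _
  rw [K0split.mulHom_mk]

/-- The algebra `𝒜^split(Γ, 𝒪) = ⨁_{t ∈ Γ} ℂ ⊗ K(t)`. -/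
def SplitAlg (Γ : Submonoid ℂ[X]) : Type 1 := DirectSum Γ fun t => ℂ ⊗[ℤ] K0split (t : ℂ[X])

namespace SplitAlg

variable {Γ : Submonoid ℂ[X]}

instance : AddCommGroup (SplitAlg Γ) :=
  inferInstanceAs (AddCommGroup (DirectSum Γ fun t => ℂ ⊗[ℤ] K0split (t : ℂ[X])))

instance : Module ℂ (SplitAlg Γ) :=
  inferInstanceAs (Module ℂ (DirectSum Γ fun t => ℂ ⊗[ℤ] K0split (t : ℂ[X])))

/-- The inclusion of the component of degree `t`. -/
def of (t : Γ) : (ℂ ⊗[ℤ] K0split (t : ℂ[X])) →ₗ[ℂ] SplitAlg Γ :=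
  letI := Classical.decEq Γ
  DirectSum.lof ℂ Γ (fun t => ℂ ⊗[ℤ] K0split (t : ℂ[X])) t

/-- The class `[M]` of an object of `A(t)-wmod_𝒪`. -/
def cls (t : Γ) (M : WMod (t : ℂ[X])) : SplitAlg Γ := of t (1 ⊗ₜ K0split.mk M)

/-- Linear maps on the algebra are defined on the components. -/
def lift {V : Type*} [AddCommGroup V] [Module ℂ V]
    (f : ∀ t : Γ, (ℂ ⊗[ℤ] K0split (t : ℂ[X])) →ₗ[ℂ] V) : SplitAlg Γ →ₗ[ℂ] V :=
  letI := Classical.decEq Γ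
  DirectSum.toModule ℂ Γ V f

lemma lift_of {V : Type*} [AddCommGroup V] [Module ℂ V]
    (f : ∀ t : Γ, (ℂ ⊗[ℤ] K0split (t : ℂ[X])) →ₗ[ℂ] V) (t : Γ) (x : ℂ ⊗[ℤ] K0split (t : ℂ[X])) :
    lift f (of t x) = f t x := by
  let := Classical.decEq Γ
  exact DirectSum.toModule_lof (M := fun t : Γ => ℂ ⊗[ℤ] K0split (t : ℂ[X])) (φ := f) ℂ t x

lemma hom_ext {V : Type*} [AddCommGroup V] [Module ℂ V] {f g : SplitAlg Γ →ₗ[ℂ] V}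
    (h : ∀ (t : Γ) (M : WMod (t : ℂ[X])), f (cls t M) = g (cls t M)) : f = g := by
  let := Classical.decEq Γ
  refine DirectSum.linearMap_ext ℂ fun t => ?_
  refine TensorProduct.AlgebraTensorModule.curry_injective ?_
  refine LinearMap.ext_ring (LinearMap.toAddMonoidHom_injective (K0split.hom_ext fun M => h t M))

/-- The multiplication of the algebra. -/
def mulL (Γ : Submonoid ℂ[X]) : SplitAlg Γ →ₗ[ℂ] SplitAlg Γ →ₗ[ℂ] SplitAlg Γ :=
  lift fun t => LinearMap.flip (lift fun t' => LinearMap.flip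
    ((K0split.mulC (t : ℂ[X]) (t' : ℂ[X])).compr₂ (of (t * t'))))

instance : Mul (SplitAlg Γ) := ⟨fun a b => mulL Γ a b⟩

lemma cls_mul_cls (t t' : Γ) (M : WMod (t : ℂ[X])) (N : WMod (t' : ℂ[X])) :
    cls t M * cls t' N = cls (t * t') (M.tensor N) := by
  change mulL Γ (cls t M) (cls t' N) = _
  simp only [mulL, cls, lift_of, LinearMap.flip_apply, LinearMap.compr₂_apply, K0split.mulC_tmul]

/-- Isomorphisms give equal classes, where the degrees may be equal only propositionally. -/
lemma cls_congr {t t' : Γ} (h : (t : ℂ[X]) = t') {M : WMod (t : ℂ[X])} {N : WMod (t' : ℂ[X])}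
    (e : M ≃ₗ[ℂ[X]] N) (hP : ∀ v, e (M.opP v) = N.opP (e v))
    (hM : ∀ v, e (M.opM v) = N.opM (e v)) : cls t M = cls t' N := by
  obtain rfl : t = t' := Subtype.ext h
  rw [cls, cls, K0split.mk_eq_of_iso (isoOfOps e hP hM)]

lemma cls_comm (t t' : Γ) (M : WMod (t : ℂ[X])) (N : WMod (t' : ℂ[X])) :
    cls (t * t') (M.tensor N) = cls (t' * t) (N.tensor M) :=
  cls_congr (t := t * t') (t' := t' * t) (M := M.tensor N) (N := N.tensor M)
    (mul_comm (t : ℂ[X]) t') (tensorComm M N) (tensorComm_opP M N) (tensorComm_opM M N)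

lemma cls_assoc (t t' t'' : Γ) (M : WMod (t : ℂ[X])) (N : WMod (t' : ℂ[X]))
    (L : WMod (t'' : ℂ[X])) :
    cls (t * t' * t'') ((M.tensor N).tensor L) = cls (t * (t' * t'')) (M.tensor (N.tensor L)) :=
  cls_congr (t := t * t' * t'') (t' := t * (t' * t'')) (M := (M.tensor N).tensor L)
    (N := M.tensor (N.tensor L)) (mul_assoc (t : ℂ[X]) t' t'') (tensorAssoc M N L)
    (tensorAssoc_opP M N L) (tensorAssoc_opM M N L)

end SplitAlg

/-! ### The unit -/

/-- The space with basis `v_n`, `n ∈ ℤ`. -/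
def Line : Type := ℤ →₀ ℂ

namespace Line

instance : AddCommGroup Line := inferInstanceAs (AddCommGroup (ℤ →₀ ℂ))
instance : Module ℂ Line := inferInstanceAs (Module ℂ (ℤ →₀ ℂ))

/-- The vector `a v_n`. -/
def single (n : ℤ) : ℂ →ₗ[ℂ] Line := Finsupp.lsingle n

lemma hom_ext {V : Type*} [AddCommMonoid V] {f g : Line →+ V}
    (h : ∀ n a, f (single n a) = g (single n a)) : f = g :=
  Finsupp.addHom_ext h

/-- `z v_n = n v_n`. -/
def diag : Module.End ℂ Line := Finsupp.lsum ℂ fun n : ℤ => (n : ℂ) • single n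

/-- `v_n ↦ v_{n+d}`. -/
def shiftBy (d : ℤ) : Line →ₗ[ℂ] Line := Finsupp.lsum ℂ fun n : ℤ => single (n + d)

lemma diag_single (n : ℤ) (a : ℂ) : diag (single n a) = (n : ℂ) • single n a :=
  Finsupp.lsum_single _ _ _ _

lemma shiftBy_single (d n : ℤ) (a : ℂ) : shiftBy d (single n a) = single (n + d) a :=
  Finsupp.lsum_single _ _ _ _

instance : Module ℂ[X] Line := Module.compHom Line (aeval diag : ℂ[X] →ₐ[ℂ] _).toRingHom

instance : IsScalarTower ℂ ℂ[X] Line := ⟨fun c p v => by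
  change aeval diag (c • p) v = c • aeval diag p v
  rw [map_smul]; rfl⟩

lemma single_mem (n : ℤ) (a : ℂ) : single n a ∈ weightSpace Line (n : ℂ) := by
  rw [mem_weightSpace]
  change aeval diag X (single n a) = _
  rw [aeval_X, diag_single]

lemma smul_single (p : ℂ[X]) (n : ℤ) (a : ℂ) :
    p • single n a = p.eval (n : ℂ) • single n a :=
  poly_smul_of_mem (single_mem n a) p

/-- The shift by `d` is semilinear. -/
def shiftS (d : ℤ) (c : ℂ) (h : c = d) : Line →ₛₗ[shift c] Line where
  toFun := shiftBy d
  map_add' := map_add _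
  map_smul' p v := by
    let f : Line →+ Line := (shiftBy d).toAddMonoidHom.comp (DistribSMul.toAddMonoidHom Line p)
    let g : Line →+ Line :=
      (DistribSMul.toAddMonoidHom Line (shift c p)).comp (shiftBy d).toAddMonoidHom
    have : f = g := hom_ext fun n a => by
      change shiftBy d (p • single n a) = shift c p • shiftBy d (single n a)
      rw [smul_single, map_smul, shiftBy_single, smul_single]
      simp [shift, h]
    exact DFunLike.congr_fun this v

lemma shiftS_single (d : ℤ) (c : ℂ) (h : c = d) (n : ℤ) (a : ℂ) :
    shiftS d c h (single n a) = single (n + d) a :=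
  shiftBy_single d n a

lemma shiftBy_shiftBy {d e : ℤ} (h : d + e = 0) (v : Line) : shiftBy d (shiftBy e v) = v := by
  have : ((shiftBy d).comp (shiftBy e)).toAddMonoidHom = AddMonoidHom.id Line :=
    hom_ext fun n a => by
      change shiftBy d (shiftBy e (single n a)) = single n a
      rw [shiftBy_single, shiftBy_single, add_assoc, add_comm e, h, add_zero]
  exact DFunLike.congr_fun this v

/-- The line spanned by `v_n` if `l = n`. -/
def wt (l : ℂ) : Submodule ℂ Line := Submodule.span ℂ {v | ∃ n : ℤ, l = n ∧ v = single n 1}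

lemma wt_le (l : ℂ) : wt l ≤ weightSpace Line l := by
  refine Submodule.span_le.2 ?_
  rintro _ ⟨n, rfl, rfl⟩
  exact single_mem n 1

lemma single_mem_wt (n : ℤ) (a : ℂ) : single n a ∈ wt n := by
  have : single n a = a • single n 1 := by rw [← map_smul, smul_eq_mul, mul_one]
  rw [this]
  exact Submodule.smul_mem _ _ (Submodule.subset_span ⟨n, rfl, rfl⟩)

lemma iSup_wt : ⨆ l, wt l = ⊤ := by
  rw [eq_top_iff]
  rintro v -
  induction v using Finsupp.induction_linear with
  | zero => exact zero_mem _
  | add x y hx hy => exact add_mem hx hy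
  | single n a => exact Submodule.mem_iSup_of_mem (n : ℂ) (single_mem_wt n a)

lemma wt_finite (l : ℂ) : FiniteDimensional ℂ (wt l) := by
  refine FiniteDimensional.span_of_finite ℂ (Set.Subsingleton.finite ?_)
  rintro _ ⟨n, hn, rfl⟩ _ ⟨m, hm, rfl⟩
  rw [hn] at hm
  rw [Int.cast_injective hm]

lemma wt_supp (l : ℂ) (h : wt l ≠ ⊥) : ∃ n : ℤ, l = n := by
  by_contra hn
  push Not at hn
  refine h (Submodule.span_eq_bot.2 ?_)
  rintro _ ⟨n, h, rfl⟩
  exact absurd h (hn n)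

end Line

/-- The unique simple object `M¹` of `A(1)-wmod_𝒪`: it has basis `v_n`, `n ∈ ℤ`, with
`z v_n = n v_n` and `X^± v_n = v_{n ± 1}`. -/
def unitObj {u : ℂ[X]} (hu : u = 1) : WMod u :=
  WMod.ofOps (V := Line) u (Line.shiftS 1 1 (by simp)) (Line.shiftS (-1) (-1) (by simp))
    (fun v => by rw [hu, map_one, one_smul]; exact Line.shiftBy_shiftBy (by simp) v)
    (fun v => by rw [hu, map_one, one_smul]; exact Line.shiftBy_shiftBy (by simp) v)
    Line.wt Line.wt_le Line.iSup_wt Line.wt_finite Line.wt_supp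

lemma unitObj_opP {u : ℂ[X]} (hu : u = 1) (v : Line) :
    (unitObj hu).opP v = Line.shiftBy 1 v := actHom_xp v

lemma unitObj_opM {u : ℂ[X]} (hu : u = 1) (v : Line) :
    (unitObj hu).opM v = Line.shiftBy (-1) v := actHom_xm v

namespace WMod

variable {t : ℂ[X]} (M : WMod t)

lemma weight_induction {P : M → Prop} (h : ∀ l, ∀ m ∈ weightSpace M l, P m)
    (ha : ∀ a b, P a → P b → P (a + b)) (m : M) : P m := by
  have hm : m ∈ ⨆ l, weightSpace M l := by rw [M.iSup_weightSpace]; trivial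
  induction hm using Submodule.iSup_induction' with
  | zero => exact h 0 0 (zero_mem _)
  | add x y _ _ hx hy => exact ha x y hx hy
  | mem l m hm => exact h l m hm

/-- The projection to a weight space. -/
def proj (l : ℂ) : M →ₗ[ℂ] M :=
  (weightSpace M l).subtype ∘ₗ DirectSum.component ℂ ℂ (fun l => weightSpace M l) l ∘ₗ
    (LinearEquiv.ofBijective (DirectSum.coeLinearMap (fun l => weightSpace M l))
      M.isInternal).symm.toLinearMap

lemma proj_of_mem {l l' : ℂ} {m : M} (hm : m ∈ weightSpace M l') :
    M.proj l m = if l' = l then m else 0 := by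
  have : (LinearEquiv.ofBijective (DirectSum.coeLinearMap (fun l => weightSpace M l))
      M.isInternal).symm m = DirectSum.lof ℂ ℂ (fun l => weightSpace M l) l' ⟨m, hm⟩ := by
    rw [LinearEquiv.symm_apply_eq]
    exact (DirectSum.coeLinearMap_lof (A := fun l => weightSpace M l) l' ⟨m, hm⟩).symm
  rw [proj, LinearMap.comp_apply, LinearMap.comp_apply, LinearEquiv.coe_coe, this]
  by_cases h : l' = l
  · subst h; rw [DirectSum.component.lof_self, if_pos rfl]; rfl
  · rw [if_neg h, DirectSum.component.of, dif_neg h, map_zero]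

lemma proj_mem (l : ℂ) (m : M) : M.proj l m ∈ weightSpace M l := Subtype.prop _

lemma proj_smul (l : ℂ) (r : ℂ[X]) (m : M) : M.proj l (r • m) = r • M.proj l m := by
  induction m using M.weight_induction with
  | h l' m hm =>
    rw [poly_smul_of_mem hm, map_smul, M.proj_of_mem hm]
    split_ifs with h
    · rw [poly_smul_of_mem hm]
    · simp
  | ha a b h1 h2 => rw [smul_add, map_add, h1, h2, map_add, smul_add]

/-- The projection to a weight space is linear over `R`. -/
def projR (l : ℂ) : M →ₗ[ℂ[X]] M where
  toFun := M.proj l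
  map_add' := map_add _
  map_smul' := M.proj_smul l

/-- `v_n ↦ (m ↦ m_n)`. -/
def unitBilin : Line →ₗ[ℂ[X]] M →ₗ[ℂ[X]] M where
  toFun := Finsupp.lsum ℂ fun n : ℤ => LinearMap.toSpanSingleton ℂ (M →ₗ[ℂ[X]] M) (M.projR n)
  map_add' := map_add _
  map_smul' p v := by
    let B : Line →ₗ[ℂ] M →ₗ[ℂ[X]] M :=
      Finsupp.lsum ℂ fun n : ℤ => LinearMap.toSpanSingleton ℂ (M →ₗ[ℂ[X]] M) (M.projR n)
    have hB : ∀ (n : ℤ) (a : ℂ), B (Line.single n a) = a • M.projR n := fun n a =>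
      Finsupp.lsum_single _ _ _ _
    change B (p • v) = p • B v
    let f : Line →+ (M →ₗ[ℂ[X]] M) := B.toAddMonoidHom.comp (DistribSMul.toAddMonoidHom Line p)
    let g : Line →+ (M →ₗ[ℂ[X]] M) := (DistribSMul.toAddMonoidHom _ p).comp B.toAddMonoidHom
    have : f = g := Line.hom_ext fun n a => by
      change B (p • Line.single n a) = p • B (Line.single n a)
      rw [Line.smul_single, map_smul, hB]
      ext m
      change p.eval (n : ℂ) • a • M.proj n m = p • a • M.proj n m
      rw [poly_smul_of_mem (Submodule.smul_mem _ a (M.proj_mem n m))]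
    exact DFunLike.congr_fun this v

/-- The map `M ⊗ M¹ → M`, `m ⊗ v_n ↦ m_n`. -/
def unitMap : M ⊗[ℂ[X]] Line →ₗ[ℂ[X]] M := TensorProduct.lift M.unitBilin.flip

lemma unitMap_tmul (m : M) (n : ℤ) (a : ℂ) : M.unitMap (m ⊗ₜ Line.single n a) = a • M.proj n m := by
  change (Finsupp.lsum ℂ fun n : ℤ => LinearMap.toSpanSingleton ℂ (M →ₗ[ℂ[X]] M) (M.projR n))
    (Finsupp.single n a) m = _
  rw [Finsupp.lsum_single]
  rfl

open Classical in
/-- The inverse map, `m ↦ m ⊗ v_n` for `m` of weight `n`. -/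
def unitInv : M →ₗ[ℂ] M ⊗[ℂ[X]] Line :=
  (DirectSum.toModule ℂ ℂ _ fun l =>
    if h : ∃ n : ℤ, l = n then
      (((TensorProduct.mk ℂ[X] M Line).flip (Line.single h.choose 1)).restrictScalars ℂ).comp
        (weightSpace M l).subtype
    else 0) ∘ₗ
    (LinearEquiv.ofBijective (DirectSum.coeLinearMap (fun l => weightSpace M l))
      M.isInternal).symm.toLinearMap

lemma unitInv_of_mem {n : ℤ} {m : M} (hm : m ∈ weightSpace M (n : ℂ)) :
    M.unitInv m = m ⊗ₜ Line.single n 1 := by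
  have : (LinearEquiv.ofBijective (DirectSum.coeLinearMap (fun l => weightSpace M l))
      M.isInternal).symm m = DirectSum.lof ℂ ℂ (fun l => weightSpace M l) n ⟨m, hm⟩ := by
    rw [LinearEquiv.symm_apply_eq]
    exact (DirectSum.coeLinearMap_lof (A := fun l => weightSpace M l) (n : ℂ) ⟨m, hm⟩).symm
  have h : ∃ k : ℤ, (n : ℂ) = k := ⟨n, rfl⟩
  have h2 : h.choose = n := (Int.cast_injective h.choose_spec).symm
  rw [unitInv, LinearMap.comp_apply, LinearEquiv.coe_coe, this, DirectSum.toModule_lof, dif_pos h]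
  change m ⊗ₜ Line.single h.choose 1 = _
  rw [h2]

lemma int_weight {l : ℂ} {m : M} (hm : m ∈ weightSpace M l) (h0 : m ≠ 0) : ∃ n : ℤ, l = n :=
  M.support l fun h => h0 (by rw [h] at hm; exact hm)

lemma unitMap_unitInv (m : M) : M.unitMap (M.unitInv m) = m := by
  induction m using M.weight_induction with
  | h l m hm =>
    by_cases h0 : m = 0
    · simp [h0]
    obtain ⟨n, rfl⟩ := M.int_weight hm h0
    rw [M.unitInv_of_mem hm, unitMap_tmul, M.proj_of_mem hm, if_pos rfl, one_smul]
  | ha a b h1 h2 => rw [map_add, map_add, h1, h2]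

lemma unitInv_unitMap (x : M ⊗[ℂ[X]] Line) : M.unitInv (M.unitMap x) = x := by
  induction x using TensorProduct.induction_on with
  | zero => simp
  | add x y hx hy => rw [map_add, map_add, hx, hy]
  | tmul m v =>
    let f : Line →+ M ⊗[ℂ[X]] Line := M.unitInv.toAddMonoidHom.comp
      (M.unitMap.toAddMonoidHom.comp (TensorProduct.mk ℂ[X] M Line m).toAddMonoidHom)
    let g : Line →+ M ⊗[ℂ[X]] Line := (TensorProduct.mk ℂ[X] M Line m).toAddMonoidHom
    have : f = g := Line.hom_ext fun n a => by
      change M.unitInv (M.unitMap (m ⊗ₜ Line.single n a)) = m ⊗ₜ Line.single n a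
      induction m using M.weight_induction with
      | h l m hm =>
        rw [unitMap_tmul, M.proj_of_mem hm]
        split_ifs with h
        · subst h
          rw [map_smul, M.unitInv_of_mem hm, ← TensorProduct.tmul_smul, ← map_smul, smul_eq_mul,
            mul_one]
        · rw [smul_zero, map_zero]
          exact (tmul_eq_zero_of_ne M (unitObj rfl) h hm (Line.single_mem n a)).symm
      | ha b c h1 h2 => rw [TensorProduct.add_tmul, map_add, map_add, h1, h2]
    exact DFunLike.congr_fun this v

/-- `M ⊗ M¹ ≅ M` over `R`. -/
def tensorUnit {u : ℂ[X]} (hu : u = 1) : M.tensor (unitObj hu) ≃ₗ[ℂ[X]] M :=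
  { M.unitMap with
    invFun := M.unitInv
    left_inv := M.unitInv_unitMap
    right_inv := M.unitMap_unitInv }

lemma tensorLine_ext (f g : M ⊗[ℂ[X]] Line →+ M)
    (h : ∀ l, ∀ m ∈ weightSpace M l, ∀ (n : ℤ) (a : ℂ),
      f (m ⊗ₜ Line.single n a) = g (m ⊗ₜ Line.single n a)) : (f : _ → M) = g := by
  ext v
  induction v using TensorProduct.induction_on with
  | zero => rw [map_zero, map_zero]
  | add x y hx hy => rw [map_add, map_add, hx, hy]
  | tmul m v =>
    have : f.comp (TensorProduct.mk ℂ[X] M Line m).toAddMonoidHom =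
        g.comp (TensorProduct.mk ℂ[X] M Line m).toAddMonoidHom := Line.hom_ext fun n a => by
      change f (m ⊗ₜ Line.single n a) = g (m ⊗ₜ Line.single n a)
      induction m using M.weight_induction with
      | h l m hm => exact h l m hm n a
      | ha b c h1 h2 => rw [TensorProduct.add_tmul, map_add, map_add, h1, h2]
    exact DFunLike.congr_fun this v

/-- `X⁺` raises weights by `1`. -/
lemma opP_mem {l : ℂ} {m : M} (hm : m ∈ weightSpace M l) : M.opP m ∈ weightSpace M (l + 1) := by
  have h1 : (X : ℂ[X]) = shift 1 (X + C 1) := by simp [shift]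
  rw [mem_weightSpace, h1, ← map_smulₛₗ, poly_smul_of_mem hm]
  rw [eval_add, eval_X, eval_C]
  exact (toLin M.opP).map_smul (l + 1) m

lemma tensorUnit_opP {u : ℂ[X]} (hu : u = 1) (v : M.tensor (unitObj hu)) :
    M.tensorUnit hu ((M.tensor (unitObj hu)).opP v) = M.opP (M.tensorUnit hu v) := by
  refine (congrArg M.unitMap (tensor_opP M (unitObj hu) v)).trans ?_
  change M.unitMap (TensorProduct.map M.opP (unitObj hu).opP v) = M.opP (M.unitMap v)
  let f : M ⊗[ℂ[X]] Line →+ M := M.unitMap.toAddMonoidHom.comp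
    (TensorProduct.map M.opP (unitObj hu).opP).toAddMonoidHom
  let g : M ⊗[ℂ[X]] Line →+ M := M.opP.toAddMonoidHom.comp M.unitMap.toAddMonoidHom
  refine congrFun (M.tensorLine_ext f g fun l m hm n a => ?_) v
  change M.unitMap (M.opP m ⊗ₜ (unitObj hu).opP (Line.single n a)) =
    M.opP (M.unitMap (m ⊗ₜ Line.single n a))
  have h : (unitObj hu).opP (Line.single n a) = Line.single (n + 1) a :=
    (unitObj_opP hu _).trans (Line.shiftBy_single _ _ _)
  rw [unitMap_tmul, M.proj_of_mem hm]
  refine (congrArg (fun w => M.unitMap (M.opP m ⊗ₜ w)) h).trans ?_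
  rw [unitMap_tmul, M.proj_of_mem (M.opP_mem hm)]
  push_cast
  by_cases hl : l = n
  · subst hl
    rw [if_pos rfl, if_pos rfl]
    exact ((toLin M.opP).map_smul a m).symm
  · rw [if_neg hl, if_neg (fun h => hl (add_right_cancel h)), smul_zero]
    exact (map_zero M.opP).symm

/-- `X⁻` lowers weights by `1`. -/
lemma opM_mem {l : ℂ} {m : M} (hm : m ∈ weightSpace M l) : M.opM m ∈ weightSpace M (l - 1) := by
  have h1 : (X : ℂ[X]) = shift (-1) (X - C 1) := by simp [shift]
  rw [mem_weightSpace, h1, ← map_smulₛₗ, poly_smul_of_mem hm]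
  rw [eval_sub, eval_X, eval_C]
  exact (toLin M.opM).map_smul (l - 1) m

lemma tensorUnit_opM {u : ℂ[X]} (hu : u = 1) (v : M.tensor (unitObj hu)) :
    M.tensorUnit hu ((M.tensor (unitObj hu)).opM v) = M.opM (M.tensorUnit hu v) := by
  refine (congrArg M.unitMap (tensor_opM M (unitObj hu) v)).trans ?_
  change M.unitMap (TensorProduct.map M.opM (unitObj hu).opM v) = M.opM (M.unitMap v)
  let f : M ⊗[ℂ[X]] Line →+ M := M.unitMap.toAddMonoidHom.comp
    (TensorProduct.map M.opM (unitObj hu).opM).toAddMonoidHom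
  let g : M ⊗[ℂ[X]] Line →+ M := M.opM.toAddMonoidHom.comp M.unitMap.toAddMonoidHom
  refine congrFun (M.tensorLine_ext f g fun l m hm n a => ?_) v
  change M.unitMap (M.opM m ⊗ₜ (unitObj hu).opM (Line.single n a)) =
    M.opM (M.unitMap (m ⊗ₜ Line.single n a))
  have h : (unitObj hu).opM (Line.single n a) = Line.single (n + -1) a :=
    (unitObj_opM hu _).trans (Line.shiftBy_single _ _ _)
  rw [unitMap_tmul, M.proj_of_mem hm]
  refine (congrArg (fun w => M.unitMap (M.opM m ⊗ₜ w)) h).trans ?_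
  rw [unitMap_tmul, M.proj_of_mem (M.opM_mem hm)]
  rw [Int.cast_add, Int.cast_neg, Int.cast_one, ← sub_eq_add_neg]
  by_cases hl : l = n
  · subst hl
    rw [if_pos rfl, if_pos rfl]
    exact ((toLin M.opM).map_smul a m).symm
  · rw [if_neg hl, if_neg (fun h => hl (sub_left_injective h)), smul_zero]
    exact (map_zero M.opM).symm

end WMod

namespace SplitAlg

variable {Γ : Submonoid ℂ[X]}

lemma coe_one : ((1 : Γ) : ℂ[X]) = 1 := rfl

instance : One (SplitAlg Γ) := ⟨cls 1 (unitObj coe_one)⟩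

lemma cls_mul_unit (t e : Γ) (he : (e : ℂ[X]) = 1) (M : WMod (t : ℂ[X])) :
    cls t M * cls e (unitObj he) = cls t M := by
  rw [cls_mul_cls]
  have h : ((t * e : Γ) : ℂ[X]) = t := by rw [Submonoid.coe_mul, he, mul_one]
  exact cls_congr (t := t * e) (t' := t) (M := M.tensor (unitObj he)) (N := M) h
    (M.tensorUnit he) (M.tensorUnit_opP he) (M.tensorUnit_opM he)

lemma cls_mul_one (t : Γ) (M : WMod (t : ℂ[X])) : cls t M * 1 = cls t M :=
  cls_mul_unit t 1 coe_one M

lemma mul_comm' (a b : SplitAlg Γ) : a * b = b * a := by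
  have : mulL Γ = (mulL Γ).flip := hom_ext fun t M => hom_ext fun t' N =>
    (cls_mul_cls t t' M N).trans ((cls_comm t t' M N).trans (cls_mul_cls t' t N M).symm)
  exact LinearMap.congr_fun₂ this a b

lemma mul_one' (a : SplitAlg Γ) : a * 1 = a := by
  have : (mulL Γ).flip 1 = LinearMap.id := hom_ext fun t M => cls_mul_one t M
  exact LinearMap.congr_fun this a

lemma mul_assoc' (a b c : SplitAlg Γ) : a * b * c = a * (b * c) := by
  have h3 : ∀ (t : Γ) (M : WMod (t : ℂ[X])) (t' : Γ) (N : WMod (t' : ℂ[X])) (c : SplitAlg Γ),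
      cls t M * cls t' N * c = cls t M * (cls t' N * c) := fun t M t' N c => by
    have : mulL Γ (cls t M * cls t' N) = (mulL Γ (cls t M)).comp (mulL Γ (cls t' N)) :=
      hom_ext fun t'' L => by
        change cls t M * cls t' N * cls t'' L = cls t M * (cls t' N * cls t'' L)
        rw [cls_mul_cls, cls_mul_cls, cls_mul_cls, cls_mul_cls, cls_assoc]
    exact LinearMap.congr_fun this c
  have h2 : ∀ (t : Γ) (M : WMod (t : ℂ[X])) (b c : SplitAlg Γ),
      cls t M * b * c = cls t M * (b * c) := fun t M b c => by
    have : ((mulL Γ).flip c).comp (mulL Γ (cls t M)) = (mulL Γ (cls t M)).comp ((mulL Γ).flip c) :=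
      hom_ext fun t' N => h3 t M t' N c
    exact LinearMap.congr_fun this b
  have : ((mulL Γ).flip c).comp ((mulL Γ).flip b) = (mulL Γ).flip (b * c) :=
    hom_ext fun t M => h2 t M b c
  exact LinearMap.congr_fun this a

instance : CommRing (SplitAlg Γ) where
  __ := (inferInstance : AddCommGroup (SplitAlg Γ))
  left_distrib a b c := (mulL Γ a).map_add b c
  right_distrib a b c := LinearMap.map_add₂ (mulL Γ) a b c
  zero_mul a := LinearMap.map_zero₂ (mulL Γ) a
  mul_zero a := (mulL Γ a).map_zero
  mul_assoc := mul_assoc'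
  one_mul a := (mul_comm' 1 a).trans (mul_one' a)
  mul_one := mul_one'
  mul_comm := mul_comm'

instance : Algebra ℂ (SplitAlg Γ) :=
  Algebra.ofModule (fun c a b => LinearMap.map_smul₂ (mulL Γ) c a b)
    (fun c a b => (mulL Γ a).map_smul c b)

end SplitAlg

/-! ### The objects of the presentation -/

/-- The monoid of monic polynomials whose zero set is contained in `Z`. -/
def polyMonoid (Z : Set ℝ) : Submonoid ℂ[X] where
  carrier := {t | t.Monic ∧ ∀ c : ℂ, t.IsRoot c → ∃ k ∈ Z, (k : ℂ) = c}
  one_mem' := ⟨monic_one, fun c h => by simp [IsRoot] at h⟩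
  mul_mem' {s t} hs ht := ⟨hs.1.mul ht.1, fun c h => by
    rcases root_mul.1 h with h | h
    · exact hs.2 c h
    · exact ht.2 c h⟩

/-- The element `z - k` of the monoid. -/
def linear {Z : Set ℝ} (k : Z) : polyMonoid Z :=
  ⟨X - C ((k : ℝ) : ℂ), monic_X_sub_C _, fun _ h => ⟨k, k.2, root_X_sub_C.1 h⟩⟩

/-- Kinds of membership in a directed subset of `ℝ`; `right` is `→` and `left` is `←`. -/
inductive Dir | out | undirected | right | left

/-- A directed subset of `ℝ`. -/
abbrev DirSet : Type := ℝ → Dir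

open Classical in
/-- The interval `(k, ∞)`. -/
def DirSet.above (k : ℝ) : DirSet := fun x => if k < x then .undirected else .out

open Classical in
/-- The interval `(-∞, k)`. -/
def DirSet.below (k : ℝ) : DirSet := fun x => if x < k then .undirected else .out

open Classical in
/-- The real line, in which `k` is directed to the right. -/
def DirSet.lineRight (k : ℝ) : DirSet := fun x => if x = k then .right else .undirected

open Classical in
/-- The real line, in which `k` is directed to the left. -/
def DirSet.lineLeft (k : ℝ) : DirSet := fun x => if x = k then .left else .undirected

/-- `M` is nonzero and not a direct sum of two nonzero submodules. (Submodules of objects of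
`A(t)-wmod_𝒪` are objects of this category.) -/
def WMod.Indecomposable {t : ℂ[X]} (M : WMod t) : Prop :=
  Nontrivial M ∧ ∀ P Q : Submodule (A t) M, IsCompl P Q → P = ⊥ ∨ Q = ⊥

/-- `M` is the indecomposable module `M_S^t` that corresponds to a directed subset `S` with
connected underlying set: its support is `S ∩ ℤ`, and at a root `k` of `t` the operator `X⁺`
(resp. `X⁻`) does not kill weight vectors of weight `k - 1/2` (resp. `k + 1/2`) iff `S k` is `→`
(resp. `←`). -/
structure WMod.IsModuleOf {t : ℂ[X]} (S : DirSet) (M : WMod t) : Prop where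
  indecomposable : M.Indecomposable
  support : ∀ l : ℂ, weightSpace M l ≠ ⊥ ↔ ∃ n : ℤ, l = n ∧ S n ≠ .out
  right : ∀ k : ℝ, t.IsRoot (k : ℂ) → ∀ v ∈ weightSpace M ((k : ℂ) - 1 / 2), v ≠ 0 →
    (A.Xp t • v ≠ 0 ↔ S k = .right)
  left : ∀ k : ℝ, t.IsRoot (k : ℂ) → ∀ v ∈ weightSpace M ((k : ℂ) + 1 / 2), v ≠ 0 →
    (A.Xm t • v ≠ 0 ↔ S k = .left)

/-- The symbols `x_k^+, x_k^-, y_k^+, y_k^-` for `k ∈ Z`. -/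
inductive SplitGen (Z : Set ℝ)
  | xp (k : Z)
  | xm (k : Z)
  | yp (k : Z)
  | ym (k : Z)

section Presentation

variable {Z : Set ℝ}

/-- The variable `x_k^+`. -/
abbrev xp (k : Z) : MvPolynomial (SplitGen Z) ℂ := MvPolynomial.X (.xp k)
/-- The variable `x_k^-`. -/
abbrev xm (k : Z) : MvPolynomial (SplitGen Z) ℂ := MvPolynomial.X (.xm k)
/-- The variable `y_k^+`. -/
abbrev yp (k : Z) : MvPolynomial (SplitGen Z) ℂ := MvPolynomial.X (.yp k)
/-- The variable `y_k^-`. -/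
abbrev ym (k : Z) : MvPolynomial (SplitGen Z) ℂ := MvPolynomial.X (.ym k)

/-- The defining relations `f = 0`. -/
inductive SplitRel : MvPolynomial (SplitGen Z) ℂ → Prop
  | yp_xp (j k : Z) (h : j ≤ k) : SplitRel (yp j * xp k - xp j * xp k)
  | ym_xp (j k : Z) (h : j ≤ k) : SplitRel (ym j * xp k - xp j * xp k)
  | xm_yp (j k : Z) (h : j ≤ k) : SplitRel (xm j * yp k - xm j * xm k)
  | xm_ym (j k : Z) (h : j ≤ k) : SplitRel (xm j * ym k - xm j * xm k)
  | xm_xp (j k : Z) (h : j ≤ k) : SplitRel (xm j * xp k)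
  | yp_ym (k : Z) : SplitRel (yp k * ym k - (xp k ^ 2 + xm k ^ 2))

end Presentation

/-- The ideal of relations. -/
def relIdeal (Z : Set ℝ) : Ideal (MvPolynomial (SplitGen Z) ℂ) := Ideal.span {f | SplitRel f}

/-- The algebra `ℂ[x_k^±, y_k^± ∣ k ∈ Z]/(Rels)`. -/
abbrev Presented (Z : Set ℝ) : Type := MvPolynomial (SplitGen Z) ℂ ⧸ relIdeal Z

end SplitTGWA
end

noncomputable section

namespace SplitTGWA

/-! ### Homomorphisms of weight modules -/

namespace WMod

variable {t : ℂ[X]} {M N : WMod t}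

/-! On a weight module with integral weights, the relations say that `X⁻X⁺` and `X⁺X⁻` across the
edge from `n` to `n + 1` are the same scalar `t(n + 1/2)`. An object is therefore a representation
of an infinite line with two opposite arrows on each edge, both composites being that scalar, which
is nonzero on all but finitely many edges. The indecomposable objects are the strings: weight spaces
that are lines over an interval `J`, with constants `p n`, `q n` on each inner edge such that `p n *
q n = t(n + 1/2)` and not both vanish. Rescaling the basis shows that `J` and the zero pattern of
the constants determine a string (`Chain.Similar.iso`, `Chain.similar_of_iso`).

Two facts replace an appeal to a Krull–Schmidt theorem. First, every nonzero object has a string as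
a direct summand (`WMod.exists_string_summand`). Splitting it off lowers the dimension of a finite
window of weights, so the classes of strings generate the split Grothendieck group
(`K0split.mk_mem_closure`). Secondly, endomorphisms of a string are scalars (`Chain.IsString.endo`),
so the rank of the pairing of `Hom(D, M)` with `Hom(M, D)` is additive in `M`, is 1 at the string
`D` itself and is 0 at any other string (`Chain.mult_eq_add`, `Chain.IsString.mult_self`,
`Chain.IsString.mult_eq_zero`). Hence the classes of nonisomorphic strings are linearly independent.

Tensor products over `R` intersect supports and multiply structure constants (`Chain.mul_iso`). This
gives the relations. A factor matters only through its support and through the edge at its root, so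
it can be exchanged when that edge is not inside the common support. Disjoint supports give zero.
For `y_k⁺ y_k⁻` both constants vanish at the root, and the module falls apart into a right and a
left half.

So there is a homomorphism `phi` from the presented algebra. The relations reduce every monomial to
a combination of normal words, in which each root carries letters of one kind, everything below an
`x⁺` is `x⁺` and everything above an `x⁻` is `x⁻` (`normalSpan_eq_top`). Normal words go to strings,
the word can be read off from its string (`Admissible.state_eq`), and every string arises from such
a word (`Chain.IsString.similar_wordChain`). Thus `phi` carries a spanning set bijectively to a
basis. In degree `z - k` the strings are those of the four generators, which gives the description
of the simple and the non-simple indecomposable objects. -/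

lemma hom_poly_smul (f : M →ₗ[A t] N) (r : ℂ[X]) (v : M) : f (r • v) = r • f v := by
  rw [← M.ofPoly_smul, map_smul, N.ofPoly_smul]

lemma hom_smul (f : M →ₗ[A t] N) (c : ℂ) (v : M) : f (c • v) = c • f v :=
  f.map_smul_of_tower c v

lemma hom_mem_weightSpace (f : M →ₗ[A t] N) {l : ℂ} {v : M} (hv : v ∈ weightSpace M l) :
    f v ∈ weightSpace N l := by
  rw [mem_weightSpace] at hv ⊢
  rw [← hom_poly_smul, hv, hom_smul]

lemma hom_opP (f : M →ₗ[A t] N) (v : M) : f (M.opP v) = N.opP (f v) := f.map_smul _ _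

lemma hom_opM (f : M →ₗ[A t] N) (v : M) : f (M.opM v) = N.opM (f v) := f.map_smul _ _

lemma opP_smul (c : ℂ) (v : M) : M.opP (c • v) = c • M.opP v := (toLin M.opP).map_smul c v

lemma opM_smul (c : ℂ) (v : M) : M.opM (c • v) = c • M.opM v := (toLin M.opM).map_smul c v

lemma opP_mem_int {n : ℤ} {m : M} (hm : m ∈ weightSpace M (n : ℂ)) :
    M.opP m ∈ weightSpace M ((n + 1 : ℤ) : ℂ) := by
  rw [Int.cast_add, Int.cast_one]
  exact M.opP_mem hm

lemma opM_mem_int {n : ℤ} {m : M} (hm : m ∈ weightSpace M ((n + 1 : ℤ) : ℂ)) :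
    M.opM m ∈ weightSpace M (n : ℂ) := by
  have := M.opM_mem hm
  rwa [Int.cast_add, Int.cast_one, add_sub_cancel_right] at this

/-- The half shifts in the relations are what makes this scalar belong to the edge: `σ^{-1/2}(t)` at
the lower end `n` and `σ^{1/2}(t)` at the upper end `n + 1` both evaluate to `t(n + 1/2)`, so this
lemma and the next one yield the same number. -/
lemma opM_opP_of_mem {n : ℤ} {m : M} (hm : m ∈ weightSpace M (n : ℂ)) :
    M.opM (M.opP m) = t.eval ((n : ℂ) + 1 / 2) • m := by
  rw [M.opM_opP, poly_smul_of_mem hm]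
  simp [shift]

lemma opP_opM_of_mem {n : ℤ} {m : M} (hm : m ∈ weightSpace M ((n + 1 : ℤ) : ℂ)) :
    M.opP (M.opM m) = t.eval ((n : ℂ) + 1 / 2) • m := by
  rw [M.opP_opM, poly_smul_of_mem hm]
  congr 1
  simp only [shift, coe_compRingHom, eval_comp, eval_sub, eval_X, eval_C, Int.cast_add,
    Int.cast_one]
  congr 1
  ring

/-- A linear map that preserves weights and commutes with `X^±` on weight vectors is
`A(t)`-linear. -/
def homOfWeights (f : M →ₗ[ℂ] N)
    (hw : ∀ l, ∀ v ∈ weightSpace M l, f v ∈ weightSpace N l)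
    (hP : ∀ l, ∀ v ∈ weightSpace M l, f (M.opP v) = N.opP (f v))
    (hM : ∀ l, ∀ v ∈ weightSpace M l, f (M.opM v) = N.opM (f v)) : M →ₗ[A t] N where
  toFun := f
  map_add' := map_add f
  map_smul' a v := by
    rw [RingHom.id_apply]
    induction a using A.induction generalizing v with
    | hc c => rw [algebraMap_smul, algebraMap_smul, map_smul]
    | hg g =>
      induction v using M.weight_induction with
      | ha a b h1 h2 => rw [smul_add, map_add, h1, h2, map_add, smul_add]
      | h l m hm =>
        match g with
        | .z =>
          have h : ∀ (K : WMod t) (v : K), A.gen t Gen.z • v = (X : ℂ[X]) • v := fun K v => by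
            rw [← K.ofPoly_smul, A.ofPoly, aeval_X]
          rw [h, h, mem_weightSpace.1 hm, mem_weightSpace.1 (hw l m hm), map_smul]
        | .xp => exact hP l m hm
        | .xm => exact hM l m hm
    | ha a b h1 h2 => rw [add_smul, map_add, h1, h2, add_smul]
    | hm a b h1 h2 => rw [mul_smul, h1, h2, mul_smul]

lemma exists_weight_ne_zero (M : WMod t) [Nontrivial M] :
    ∃ n : ℤ, ∃ v ∈ weightSpace M (n : ℂ), v ≠ 0 := by
  by_contra! h
  obtain ⟨x, hx⟩ := exists_ne (0 : M)
  refine hx ?_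
  induction x using M.weight_induction with
  | h l m hm =>
    by_contra h0
    obtain ⟨n, rfl⟩ := M.int_weight hm h0
    exact h0 (h n m hm)
  | ha a b h1 h2 =>
    by_cases ha : a = 0
    · by_cases hb : b = 0
      · rw [ha, hb, add_zero]
      · exact absurd (h2 hb) hb
    · exact absurd (h1 ha) ha

end WMod

/-! ### Modules with basis indexed by a set of integers -/

/-- The space with basis `v_n`, `n ∈ J`. -/
def LineOn (J : Set ℤ) : Type := Finsupp.supported ℂ ℂ J

namespace LineOn

variable {J : Set ℤ}

instance : AddCommGroup (LineOn J) := inferInstanceAs (AddCommGroup (Finsupp.supported ℂ ℂ J))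
instance : Module ℂ (LineOn J) := inferInstanceAs (Module ℂ (Finsupp.supported ℂ ℂ J))

/-- The coefficient of `v_n`. -/
def coef (n : ℤ) : LineOn J →ₗ[ℂ] ℂ :=
  (Finsupp.lapply n).comp (Finsupp.supported ℂ ℂ J).subtype

@[ext]
lemma ext {v w : LineOn J} (h : ∀ n, coef n v = coef n w) : v = w :=
  Subtype.ext (Finsupp.ext h)

lemma coef_of_notMem {n : ℤ} (hn : n ∉ J) (v : LineOn J) : coef n v = 0 :=
  (Finsupp.mem_supported' ℂ v.1).1 v.2 n hn

/-- The set of `n` for which the coefficient of `v_n` is nonzero. -/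
def supp (v : LineOn J) : Finset ℤ := v.1.support

lemma mem_supp {n : ℤ} {v : LineOn J} : n ∈ supp v ↔ coef n v ≠ 0 := Finsupp.mem_support_iff

/-- The vector with given coefficients. -/
def mk (s : Finset ℤ) (f : ℤ → ℂ) (hs : ∀ n, f n ≠ 0 → n ∈ s) (hJ : ∀ n, n ∉ J → f n = 0) :
    LineOn J :=
  ⟨Finsupp.onFinset s f hs, (Finsupp.mem_supported' ℂ _).2 hJ⟩

lemma coef_mk {s : Finset ℤ} {f : ℤ → ℂ} (hs : ∀ n, f n ≠ 0 → n ∈ s)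
    (hJ : ∀ n, n ∉ J → f n = 0) (n : ℤ) : coef n (mk s f hs hJ) = f n := rfl

open Classical in
/-- The basis vector `v_n` for `n ∈ J`, and `0` for `n ∉ J`. -/
def vec (n : ℤ) : LineOn J :=
  mk {n} (fun m => if m = n ∧ n ∈ J then 1 else 0) (fun m h => by
    by_contra h'
    exact h (if_neg fun h'' => h' (Finset.mem_singleton.2 h''.1)))
    (fun m hm => if_neg fun h : m = n ∧ n ∈ J => hm (h.1 ▸ h.2))

lemma coef_vec_self {n : ℤ} (hn : n ∈ J) : coef n (vec n : LineOn J) = 1 := if_pos ⟨rfl, hn⟩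

lemma coef_vec_ne {m n : ℤ} (h : m ≠ n) : coef m (vec n : LineOn J) = 0 :=
  if_neg fun h' : m = n ∧ n ∈ J => h h'.1

lemma vec_of_notMem {n : ℤ} (hn : n ∉ J) : (vec n : LineOn J) = 0 := by
  ext m
  rw [map_zero]
  exact if_neg fun h : m = n ∧ n ∈ J => hn h.2

lemma vec_ne_zero {n : ℤ} (hn : n ∈ J) : (vec n : LineOn J) ≠ 0 := fun h => by
  have := coef_vec_self hn
  rw [h, map_zero] at this
  exact zero_ne_one this

lemma eq_sum (v : LineOn J) {s : Finset ℤ} (hs : supp v ⊆ s) :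
    v = ∑ n ∈ s, coef n v • vec n := by
  ext m
  rw [map_sum, Finset.sum_eq_single m]
  · rw [map_smul, smul_eq_mul]
    by_cases hm : m ∈ J
    · rw [coef_vec_self hm, mul_one]
    · rw [coef_of_notMem hm, zero_mul]
  · intro n _ hn
    rw [map_smul, coef_vec_ne hn.symm, smul_zero]
  · intro hm
    rw [map_smul, not_not.1 fun h => hm (hs (mem_supp.2 h)), zero_smul]

/-- Since `z` acts on `v_n` as `n`, a polynomial acts through its value at `n`. Defining the action
on coefficients for all polynomials at once makes `coef_smul` hold by definition. -/
instance : SMul ℂ[X] (LineOn J) :=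
  ⟨fun r v => mk (supp v) (fun n => r.eval (n : ℂ) * coef n v)
    (fun _ h => mem_supp.2 (right_ne_zero_of_mul h))
    (fun _ h => by rw [coef_of_notMem h, mul_zero])⟩

lemma coef_smul (r : ℂ[X]) (v : LineOn J) (n : ℤ) :
    coef n (r • v) = r.eval (n : ℂ) * coef n v := rfl

instance : Module ℂ[X] (LineOn J) where
  one_smul v := by ext n; rw [coef_smul, eval_one, one_mul]
  mul_smul r s v := by ext n; rw [coef_smul, coef_smul, coef_smul, eval_mul, mul_assoc]
  smul_zero r := by ext n; rw [coef_smul, map_zero, mul_zero]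
  smul_add r v w := by ext n; rw [coef_smul, map_add, map_add, coef_smul, coef_smul, mul_add]
  add_smul r s v := by ext n; rw [map_add, coef_smul, coef_smul, coef_smul, eval_add, add_mul]
  zero_smul v := by ext n; rw [coef_smul, eval_zero, zero_mul, map_zero]

instance : IsScalarTower ℂ ℂ[X] (LineOn J) := ⟨fun c r v => by
  ext n
  rw [coef_smul, map_smul, coef_smul, eval_smul, smul_eq_mul, smul_eq_mul, mul_assoc]⟩

lemma mem_weightSpace_int {n : ℤ} {v : LineOn J} :
    v ∈ weightSpace (LineOn J) (n : ℂ) ↔ ∀ m, m ≠ n → coef m v = 0 := by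
  rw [mem_weightSpace]
  constructor
  · intro h m hm
    have h1 := congrArg (coef m) h
    rw [coef_smul, map_smul, eval_X, smul_eq_mul, ← sub_eq_zero, ← sub_mul] at h1
    exact (mul_eq_zero.1 h1).resolve_left (sub_ne_zero.2 fun h => hm (Int.cast_injective h))
  · intro h
    ext m
    rw [coef_smul, map_smul, eval_X, smul_eq_mul]
    by_cases hm : m = n
    · rw [hm]
    · rw [h m hm, mul_zero, mul_zero]

lemma eq_smul_vec {n : ℤ} {v : LineOn J} (hv : v ∈ weightSpace (LineOn J) (n : ℂ)) :
    v = coef n v • vec n := by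
  have : supp v ⊆ {n} := fun m hm => by
    by_contra h
    exact mem_supp.1 hm (mem_weightSpace_int.1 hv m fun h' => h (Finset.mem_singleton.2 h'))
  conv_lhs => rw [eq_sum v this, Finset.sum_singleton]

lemma vec_mem (n : ℤ) : (vec n : LineOn J) ∈ weightSpace (LineOn J) (n : ℂ) :=
  mem_weightSpace_int.2 fun _ h => coef_vec_ne h

lemma iSup_weightSpace : ⨆ l, weightSpace (LineOn J) l = ⊤ := by
  refine eq_top_iff.2 fun v _ => ?_
  rw [eq_sum v le_rfl]
  exact sum_mem fun n _ => Submodule.smul_mem _ _ (Submodule.mem_iSup_of_mem (n : ℂ) (vec_mem n))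

lemma weight_int {l : ℂ} {v : LineOn J} (hv : v ∈ weightSpace (LineOn J) l) (h0 : v ≠ 0) :
    ∃ n ∈ J, l = (n : ℤ) := by
  obtain ⟨n, hn⟩ : ∃ n, coef n v ≠ 0 := by
    by_contra! h
    exact h0 (ext fun n => by rw [h, map_zero])
  refine ⟨n, by_contra fun h => hn (coef_of_notMem h v), ?_⟩
  have h1 := congrArg (coef n) (mem_weightSpace.1 hv)
  rw [coef_smul, map_smul, eval_X, smul_eq_mul] at h1
  exact (mul_right_cancel₀ hn h1).symm

lemma finite_weightSpace (l : ℂ) : FiniteDimensional ℂ (weightSpace (LineOn J) l) := by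
  by_cases h : ∃ n : ℤ, l = n
  · obtain ⟨n, rfl⟩ := h
    refine FiniteDimensional.of_injective ((coef n).comp (Submodule.subtype _) :
      weightSpace (LineOn J) (n : ℂ) →ₗ[ℂ] ℂ) ?_
    rintro ⟨v, hv⟩ ⟨w, hw⟩ h
    refine Subtype.ext ?_
    change coef n v = coef n w at h
    change v = w
    rw [eq_smul_vec hv, eq_smul_vec hw, h]
  · have : weightSpace (LineOn J) l = ⊥ := by
      refine (Submodule.eq_bot_iff _).2 fun v hv => by_contra fun h0 => ?_
      obtain ⟨n, -, hn⟩ := weight_int hv h0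
      exact h ⟨n, hn⟩
    rw [this]
    infer_instance

open Classical in
/-- The weighted shift `v_n ↦ a_{n+d} v_{n+d}`. -/
def wshift (d : ℤ) (a : ℤ → ℂ) (c : ℂ) (hc : c = d) : LineOn J →ₛₗ[shift c] LineOn J where
  toFun v := mk ((supp v).map (Equiv.addRight d).toEmbedding)
    (fun n => if n ∈ J then a n * coef (n - d) v else 0)
    (fun n h => by
      rw [Finset.mem_map_equiv]
      refine mem_supp.2 fun h' => h ?_
      have h' : coef (n - d) v = 0 := h'
      rw [h', mul_zero, ite_self])
    (fun n h => if_neg h)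
  map_add' v w := by
    ext n
    rw [map_add, coef_mk, coef_mk, coef_mk]
    split_ifs
    · rw [map_add, mul_add]
    · rw [add_zero]
  map_smul' r v := by
    ext n
    rw [coef_smul, coef_mk, coef_mk, coef_smul]
    split_ifs
    · simp [shift, hc]
      ring
    · rw [mul_zero]

open Classical in
lemma coef_wshift (d : ℤ) (a : ℤ → ℂ) (c : ℂ) (hc : c = d) (v : LineOn J) (n : ℤ) :
    coef n (wshift d a c hc v) = if n ∈ J then a n * coef (n - d) v else 0 := rfl

/-- Pointwise multiplication. -/
def mulR (J K : Set ℤ) : LineOn J →ₗ[ℂ[X]] LineOn K →ₗ[ℂ[X]] LineOn (J ∩ K) :=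
  LinearMap.mk₂ ℂ[X]
    (fun v w => mk (supp v) (fun n => coef n v * coef n w)
      (fun _ h => mem_supp.2 (left_ne_zero_of_mul h))
      (fun n h => by
        by_cases hn : n ∈ J
        · rw [coef_of_notMem (fun h' => h ⟨hn, h'⟩) w, mul_zero]
        · rw [coef_of_notMem hn, zero_mul]))
    (fun v w u => by ext n; rw [map_add, coef_mk, coef_mk, coef_mk, map_add, add_mul])
    (fun r v w => by ext n; rw [coef_smul, coef_mk, coef_mk, coef_smul, mul_assoc])
    (fun v w u => by ext n; rw [map_add, coef_mk, coef_mk, coef_mk, map_add, mul_add])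
    (fun r v w => by ext n; rw [coef_smul, coef_mk, coef_mk, coef_smul, mul_left_comm])

end LineOn

/-! ### Weight modules given by structure constants -/

open LineOn

/-- Structure constants of a weight module with basis `v_n`, `n ∈ J`, on which
`X⁺ v_n = p_n v_{n+1}` and `X⁻ v_{n+1} = q_n v_n`. -/
structure Chain (t : ℂ[X]) where
  J : Set ℤ
  p : ℤ → ℂ
  q : ℤ → ℂ
  rel : ∀ n, n ∈ J → n + 1 ∈ J → p n * q n = t.eval ((n : ℂ) + 1 / 2)
  -- Across an edge that leaves `J` the composites pass through zero, so a root is forced there. The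
  -- values of `p` and `q` on edges that are not inside `J` have no effect on the module.
  edge : ∀ n, ¬(n ∈ J ↔ n + 1 ∈ J) → t.eval ((n : ℂ) + 1 / 2) = 0

namespace Chain

variable {t t' : ℂ[X]} (D : Chain t)

/-- The weight module with given structure constants. -/
def lin : WMod t :=
  WMod.ofOps (V := LineOn D.J) t
    -- `wshift` indexes its coefficients by the target, while `p` is indexed by the lower end of the
    -- edge. Going up, this is one less than the target; going down, it is the target itself, so `q`
    -- needs no shift.
    (wshift 1 (fun n => D.p (n - 1)) 1 (by simp)) (wshift (-1) D.q (-1) (by simp))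
    (fun v => by
      ext n
      rw [coef_wshift, coef_wshift, coef_smul, sub_neg_eq_add, sub_add_cancel]
      have he : eval (n : ℂ) (shift (1 / 2) t) = t.eval (((n - 1 : ℤ) : ℂ) + 1 / 2) := by
        simp only [shift, coe_compRingHom, eval_comp, eval_sub, eval_X, eval_C, Int.cast_sub,
          Int.cast_one]
        congr 1
        ring
      rw [he]
      by_cases hn : n ∈ D.J
      · rw [if_pos hn]
        by_cases hm : n - 1 ∈ D.J
        · rw [if_pos hm, ← mul_assoc, D.rel (n - 1) hm (by rwa [sub_add_cancel])]
        · rw [if_neg hm, mul_zero, D.edge (n - 1) (by rw [sub_add_cancel]; tauto), zero_mul]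
      · rw [if_neg hn, coef_of_notMem hn, mul_zero])
    (fun v => by
      ext n
      rw [coef_wshift, coef_wshift, coef_smul, sub_neg_eq_add, add_sub_cancel_right]
      have he : eval (n : ℂ) (shift (-(1 / 2)) t) = t.eval ((n : ℂ) + 1 / 2) := by
        simp [shift]
      rw [he]
      by_cases hn : n ∈ D.J
      · rw [if_pos hn]
        by_cases hm : n + 1 ∈ D.J
        · rw [if_pos hm, ← D.rel n hn hm]
          ring
        · rw [if_neg hm, mul_zero, D.edge n (by tauto), zero_mul]
      · rw [if_neg hn, coef_of_notMem hn, mul_zero])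
    (weightSpace (LineOn D.J)) (fun _ => le_rfl) LineOn.iSup_weightSpace
    LineOn.finite_weightSpace
    (fun l h => by
      obtain ⟨v, hv, h0⟩ := Submodule.exists_mem_ne_zero_of_ne_bot h
      obtain ⟨n, -, hn⟩ := weight_int hv h0
      exact ⟨n, hn⟩)

/-- The basis vector `v_n` (zero for `n ∉ J`). -/
def vec (n : ℤ) : D.lin := (LineOn.vec n : LineOn D.J)

/-- The coefficient of `v_n`. -/
def coef (n : ℤ) : D.lin →ₗ[ℂ] ℂ := (LineOn.coef n : LineOn D.J →ₗ[ℂ] ℂ)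

lemma vec_mem (n : ℤ) : D.vec n ∈ weightSpace D.lin (n : ℂ) := LineOn.vec_mem n

lemma coef_vec_self {n : ℤ} (hn : n ∈ D.J) : D.coef n (D.vec n) = 1 := LineOn.coef_vec_self hn

lemma vec_of_notMem {n : ℤ} (hn : n ∉ D.J) : D.vec n = 0 := LineOn.vec_of_notMem hn

lemma vec_ne_zero {n : ℤ} (hn : n ∈ D.J) : D.vec n ≠ 0 := LineOn.vec_ne_zero hn

lemma eq_smul_vec {n : ℤ} {v : D.lin} (hv : v ∈ weightSpace D.lin (n : ℂ)) :
    v = D.coef n v • D.vec n := LineOn.eq_smul_vec hv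

lemma weight_int {l : ℂ} {v : D.lin} (hv : v ∈ weightSpace D.lin l) (h0 : v ≠ 0) :
    ∃ n ∈ D.J, l = (n : ℤ) := LineOn.weight_int hv h0

lemma opP_apply (v : LineOn D.J) :
    D.lin.opP v = wshift 1 (fun n => D.p (n - 1)) 1 (by simp) v := actHom_xp v

lemma opM_apply (v : LineOn D.J) : D.lin.opM v = wshift (-1) D.q (-1) (by simp) v := actHom_xm v

/-- Nothing is required of `n + 1`: if it lies outside `J`, then `v_{n+1} = 0` and the formula still
holds, whatever `p n` is. -/
lemma opP_vec {n : ℤ} (hn : n ∈ D.J) : D.lin.opP (D.vec n) = D.p n • D.vec (n + 1) := by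
  refine (D.opP_apply (LineOn.vec n)).trans (?_ : _ = D.p n • (LineOn.vec (n + 1) : LineOn D.J))
  ext m
  rw [coef_wshift, map_smul, smul_eq_mul]
  by_cases hm : m = n + 1
  · subst hm
    rw [add_sub_cancel_right, LineOn.coef_vec_self hn, mul_one]
    split_ifs with hJ
    · rw [LineOn.coef_vec_self hJ, mul_one]
    · rw [LineOn.coef_of_notMem hJ, mul_zero]
  · rw [LineOn.coef_vec_ne hm, LineOn.coef_vec_ne fun h => hm (by omega), mul_zero, mul_zero,
      ite_self]

lemma opM_vec {n : ℤ} (hn : n + 1 ∈ D.J) : D.lin.opM (D.vec (n + 1)) = D.q n • D.vec n := by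
  refine (D.opM_apply (LineOn.vec (n + 1))).trans (?_ : _ = D.q n • (LineOn.vec n : LineOn D.J))
  ext m
  rw [coef_wshift, map_smul, smul_eq_mul, sub_neg_eq_add]
  by_cases hm : m = n
  · subst hm
    rw [LineOn.coef_vec_self hn, mul_one]
    split_ifs with hJ
    · rw [LineOn.coef_vec_self hJ, mul_one]
    · rw [LineOn.coef_of_notMem hJ, mul_zero]
  · rw [LineOn.coef_vec_ne hm, LineOn.coef_vec_ne fun h => hm (by omega), mul_zero, mul_zero,
      ite_self]

lemma hom_ext {V : Type*} [AddCommMonoid V] [Module ℂ V] {f g : D.lin →ₗ[ℂ] V}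
    (h : ∀ n ∈ D.J, f (D.vec n) = g (D.vec n)) : f = g := by
  refine LinearMap.ext fun v => ?_
  have hv : v = ∑ n ∈ supp (v : LineOn D.J), D.coef n v • D.vec n := LineOn.eq_sum v le_rfl
  rw [hv, map_sum, map_sum]
  refine Finset.sum_congr rfl fun n _ => ?_
  rw [map_smul, map_smul]
  by_cases hn : n ∈ D.J
  · rw [h n hn]
  · rw [D.vec_of_notMem hn, map_zero, map_zero]

lemma hom_extA {V : Type*} [AddCommGroup V] [Module ℂ V] [Module (A t) V] [IsScalarTower ℂ (A t) V]
    {f g : D.lin →ₗ[A t] V} (h : ∀ n ∈ D.J, f (D.vec n) = g (D.vec n)) : f = g := by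
  have : f.restrictScalars ℂ = g.restrictScalars ℂ := D.hom_ext h
  exact LinearMap.ext fun v => LinearMap.congr_fun this v

variable {M : WMod t}

/-- A homomorphism from `lin D` is given by the images of the basis vectors. -/
def homFrom (x : ℤ → M) (hw : ∀ n : ℤ, x n ∈ weightSpace M (n : ℂ)) (h0 : ∀ n, n ∉ D.J → x n = 0)
    (hP : ∀ n ∈ D.J, M.opP (x n) = D.p n • x (n + 1))
    (hM : ∀ n, n + 1 ∈ D.J → M.opM (x (n + 1)) = D.q n • x n) :
    D.lin →ₗ[A t] M :=
  let f : D.lin →ₗ[ℂ] M := (Finsupp.linearCombination ℂ x).comp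
    ((Finsupp.supported ℂ ℂ D.J).subtype : LineOn D.J →ₗ[ℂ] (ℤ →₀ ℂ))
  have hf : ∀ n, f (D.vec n) = x n := fun n => by
    by_cases hn : n ∈ D.J
    · have : (LineOn.vec n : LineOn D.J).1 = Finsupp.single n 1 := by
        ext m
        change LineOn.coef m (LineOn.vec n) = _
        by_cases h : m = n
        · subst h
          rw [LineOn.coef_vec_self hn, Finsupp.single_eq_same]
        · rw [LineOn.coef_vec_ne h, Finsupp.single_eq_of_ne h]
      refine (congrArg (Finsupp.linearCombination ℂ x) this).trans ?_
      rw [Finsupp.linearCombination_single, one_smul]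
    · rw [D.vec_of_notMem hn, h0 n hn, map_zero]
  have key : ∀ {Q : D.lin → Prop}, (∀ n ∈ D.J, ∀ c : ℂ, Q (c • D.vec n)) → Q 0 →
      ∀ l, ∀ v ∈ weightSpace D.lin l, Q v := fun {Q} h h0 l v hv => by
    by_cases hv0 : v = 0
    · rw [hv0]; exact h0
    · obtain ⟨n, hn, rfl⟩ := D.weight_int hv hv0
      rw [D.eq_smul_vec hv]
      exact h n hn _
  WMod.homOfWeights f
    (fun l v hv => by
      by_cases hv0 : v = 0
      · rw [hv0, map_zero]; exact zero_mem _
      · obtain ⟨n, hn, rfl⟩ := D.weight_int hv hv0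
        rw [D.eq_smul_vec hv, map_smul, hf]
        exact Submodule.smul_mem _ _ (hw n))
    (key (fun n hn c => by
      rw [WMod.opP_smul, D.opP_vec hn, map_smul, map_smul, hf, map_smul, hf, WMod.opP_smul,
        hP n hn]) (by simp only [map_zero]))
    (key (fun n hn c => by
      obtain ⟨n, rfl⟩ : ∃ m, n = m + 1 := ⟨n - 1, by ring⟩
      rw [WMod.opM_smul, D.opM_vec hn, map_smul, map_smul, hf, map_smul, hf, WMod.opM_smul,
        hM n hn]) (by simp only [map_zero]))

lemma homFrom_vec {x : ℤ → M} {hw : ∀ n : ℤ, x n ∈ weightSpace M (n : ℂ)}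
    {h0 : ∀ n, n ∉ D.J → x n = 0} {hP : ∀ n ∈ D.J, M.opP (x n) = D.p n • x (n + 1)}
    {hM : ∀ n, n + 1 ∈ D.J → M.opM (x (n + 1)) = D.q n • x n} (n : ℤ) :
    D.homFrom x hw h0 hP hM (D.vec n) = x n := by
  by_cases hn : n ∈ D.J
  · have : (LineOn.vec n : LineOn D.J).1 = Finsupp.single n 1 := by
      ext m
      change LineOn.coef m (LineOn.vec n) = _
      by_cases h : m = n
      · subst h
        rw [LineOn.coef_vec_self hn, Finsupp.single_eq_same]
      · rw [LineOn.coef_vec_ne h, Finsupp.single_eq_of_ne h]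
    refine (congrArg (Finsupp.linearCombination ℂ x) this).trans ?_
    rw [Finsupp.linearCombination_single, one_smul]
  · rw [D.vec_of_notMem hn, h0 n hn, map_zero]

open Classical in
/-- The map `m ↦ F_n(m) v_n` for `m` of weight `n`. -/
def funMap (F : ℤ → M →ₗ[ℂ] ℂ) : M →ₗ[ℂ] D.lin :=
  (DirectSum.toModule ℂ ℂ _ fun l =>
    if h : ∃ n : ℤ, l = n then
      (LinearMap.toSpanSingleton ℂ D.lin (D.vec h.choose) ∘ₗ F h.choose) ∘ₗ
        (weightSpace M l).subtype
    else 0) ∘ₗ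
    (LinearEquiv.ofBijective (DirectSum.coeLinearMap (fun l => weightSpace M l))
      M.isInternal).symm.toLinearMap

lemma funMap_of_mem (F : ℤ → M →ₗ[ℂ] ℂ) {n : ℤ} {m : M} (hm : m ∈ weightSpace M (n : ℂ)) :
    D.funMap F m = F n m • D.vec n := by
  have : (LinearEquiv.ofBijective (DirectSum.coeLinearMap (fun l => weightSpace M l))
      M.isInternal).symm m = DirectSum.lof ℂ ℂ (fun l => weightSpace M l) n ⟨m, hm⟩ := by
    rw [LinearEquiv.symm_apply_eq]
    exact (DirectSum.coeLinearMap_lof (A := fun l => weightSpace M l) (n : ℂ) ⟨m, hm⟩).symm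
  have h : ∃ k : ℤ, (n : ℂ) = k := ⟨n, rfl⟩
  have h2 : h.choose = n := (Int.cast_injective h.choose_spec).symm
  rw [funMap, LinearMap.comp_apply, LinearEquiv.coe_coe, this, DirectSum.toModule_lof, dif_pos h]
  change F h.choose m • D.vec h.choose = _
  rw [h2]

/-- A homomorphism to `lin D` is given by functionals on the weight spaces. -/
def homTo (F : ℤ → M →ₗ[ℂ] ℂ)
    (h0 : ∀ n : ℤ, n ∉ D.J → ∀ m ∈ weightSpace M (n : ℂ), F n m = 0)
    (hP : ∀ n : ℤ, n + 1 ∈ D.J → ∀ m ∈ weightSpace M (n : ℂ),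
      F (n + 1) (M.opP m) = D.p n * F n m)
    (hM : ∀ n : ℤ, n ∈ D.J → ∀ m ∈ weightSpace M ((n + 1 : ℤ) : ℂ),
      F n (M.opM m) = D.q n * F (n + 1) m) :
    M →ₗ[A t] D.lin :=
  have key : ∀ {Q : M → Prop}, (∀ n : ℤ, ∀ m ∈ weightSpace M (n : ℂ), Q m) →
      ∀ l, ∀ v ∈ weightSpace M l, Q v := fun {Q} h l v hv => by
    by_cases hv0 : v = 0
    · rw [hv0]; exact h 0 0 (zero_mem _)
    · obtain ⟨n, rfl⟩ := M.int_weight hv hv0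
      exact h n v hv
  WMod.homOfWeights (D.funMap F)
    (fun l v hv => by
      by_cases hv0 : v = 0
      · rw [hv0, map_zero]; exact zero_mem _
      · obtain ⟨n, rfl⟩ := M.int_weight hv hv0
        rw [D.funMap_of_mem F hv]
        exact Submodule.smul_mem _ _ (D.vec_mem n))
    (key fun n m hm => by
      rw [D.funMap_of_mem F hm, D.funMap_of_mem F (M.opP_mem_int hm), WMod.opP_smul]
      by_cases h1 : n ∈ D.J
      · rw [D.opP_vec h1, smul_smul]
        by_cases h2 : n + 1 ∈ D.J
        · rw [hP n h2 m hm, mul_comm]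
        · rw [D.vec_of_notMem h2, smul_zero, smul_zero]
      · rw [D.vec_of_notMem h1, map_zero, smul_zero]
        by_cases h2 : n + 1 ∈ D.J
        · rw [hP n h2 m hm, h0 n h1 m hm, mul_zero, zero_smul]
        · rw [D.vec_of_notMem h2, smul_zero])
    (key fun n m hm => by
      obtain ⟨n, rfl⟩ : ∃ k, n = k + 1 := ⟨n - 1, by ring⟩
      rw [D.funMap_of_mem F hm, D.funMap_of_mem F (M.opM_mem_int hm), WMod.opM_smul]
      by_cases h1 : n + 1 ∈ D.J
      · rw [D.opM_vec h1, smul_smul]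
        by_cases h2 : n ∈ D.J
        · rw [hM n h2 m hm, mul_comm]
        · rw [D.vec_of_notMem h2, smul_zero, smul_zero]
      · rw [D.vec_of_notMem h1, map_zero, smul_zero]
        by_cases h2 : n ∈ D.J
        · rw [hM n h2 m hm, h0 _ h1 m hm, mul_zero, zero_smul]
        · rw [D.vec_of_notMem h2, smul_zero])

lemma homTo_of_mem {F : ℤ → M →ₗ[ℂ] ℂ}
    {h0 : ∀ n : ℤ, n ∉ D.J → ∀ m ∈ weightSpace M (n : ℂ), F n m = 0}
    {hP : ∀ n : ℤ, n + 1 ∈ D.J → ∀ m ∈ weightSpace M (n : ℂ),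
      F (n + 1) (M.opP m) = D.p n * F n m}
    {hM : ∀ n : ℤ, n ∈ D.J → ∀ m ∈ weightSpace M ((n + 1 : ℤ) : ℂ),
      F n (M.opM m) = D.q n * F (n + 1) m} {n : ℤ} {m : M} (hm : m ∈ weightSpace M (n : ℂ)) :
    D.homTo F h0 hP hM m = F n m • D.vec n := D.funMap_of_mem F hm

end Chain

/-! ### Rescaling, splitting and multiplying structure constants -/

/-- Prescribed nonzero ratios of neighbours are always realised on a line: multiply ratios going up
from 0 and divide by them going down. This supplies the diagonal change of basis between two chains.
-/
lemma exists_int_cocycle (r : ℤ → ℂ) (hr : ∀ n, r n ≠ 0) :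
    ∃ u : ℤ → ℂ, (∀ n, u n ≠ 0) ∧ ∀ n, u (n + 1) = r n * u n := by
  let u : ℤ → ℂ := fun n => match n with
    | .ofNat m => ∏ j ∈ Finset.range m, r j
    | .negSucc m => ∏ j ∈ Finset.range (m + 1), (r (-(j : ℤ) - 1))⁻¹
  refine ⟨u, fun n => ?_, fun n => ?_⟩
  · match n with
    | .ofNat m => exact Finset.prod_ne_zero_iff.2 fun j _ => hr _
    | .negSucc m => exact Finset.prod_ne_zero_iff.2 fun j _ => inv_ne_zero (hr _)
  · match n with
    | .ofNat m => exact (Finset.prod_range_succ _ _).trans (mul_comm _ _)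
    | .negSucc 0 =>
      change ∏ j ∈ Finset.range 0, r j = r (-1) * ∏ j ∈ Finset.range 1, (r (-(j : ℤ) - 1))⁻¹
      simp [hr]
    | .negSucc (m + 1) =>
      have h : Int.negSucc (m + 1) = -((m + 1 : ℕ) : ℤ) - 1 := by
        rw [Int.negSucc_eq]; push_cast; ring
      -- One step further down the product gains exactly one inverse factor, which the ratio
      -- cancels.
      have h2 : u (Int.negSucc (m + 1)) = u (Int.negSucc m) * (r (Int.negSucc (m + 1)))⁻¹ := by
        rw [h]
        exact Finset.prod_range_succ _ _
      rw [h2, mul_comm, mul_assoc, inv_mul_cancel₀ (hr _), mul_one]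
      rfl

namespace Chain

variable {t t' : ℂ[X]}

/-- Equality of supports and of zero patterns of the structure constants. -/
structure Similar (D : Chain t) (D' : Chain t') : Prop where
  J_eq : D.J = D'.J
  p_iff : ∀ n, n ∈ D.J → n + 1 ∈ D.J → (D.p n = 0 ↔ D'.p n = 0)
  q_iff : ∀ n, n ∈ D.J → n + 1 ∈ D.J → (D.q n = 0 ↔ D'.q n = 0)

/-- The diagonal map `v_n ↦ u_n v_n`. -/
def diagHom (D D' : Chain t) (hJ : D.J = D'.J) (u : ℤ → ℂ)
    (hp : ∀ n, n ∈ D.J → n + 1 ∈ D.J → u n * D'.p n = D.p n * u (n + 1))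
    (hq : ∀ n, n ∈ D.J → n + 1 ∈ D.J → u (n + 1) * D'.q n = D.q n * u n) :
    D.lin →ₗ[A t] D'.lin :=
  D.homFrom (fun n => u n • D'.vec n) (fun n => Submodule.smul_mem _ _ (D'.vec_mem n))
    (fun n hn => by rw [D'.vec_of_notMem (hJ ▸ hn), smul_zero])
    (fun n hn => by
      rw [WMod.opP_smul, D'.opP_vec (hJ ▸ hn), smul_smul, smul_smul]
      by_cases h : n + 1 ∈ D.J
      · rw [hp n hn h]
      · rw [D'.vec_of_notMem (hJ ▸ h), smul_zero, smul_zero])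
    (fun n hn => by
      rw [WMod.opM_smul, D'.opM_vec (hJ ▸ hn), smul_smul, smul_smul]
      by_cases h : n ∈ D.J
      · rw [hq n h hn]
      · rw [D'.vec_of_notMem (hJ ▸ h), smul_zero, smul_zero])

/-- Each edge prescribes one ratio `u (n + 1) / u n`. When both constants are nonzero, the
conditions from `p` and from `q` agree because `p n * q n` and `D'.p n * D'.q n` are the same value
of `t`. -/
lemma Similar.exists_diag {D D' : Chain t} (h : D.Similar D') :
    ∃ u : ℤ → ℂ, (∀ n, u n ≠ 0) ∧
      (∀ n, n ∈ D.J → n + 1 ∈ D.J → u n * D'.p n = D.p n * u (n + 1)) ∧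
      (∀ n, n ∈ D.J → n + 1 ∈ D.J → u (n + 1) * D'.q n = D.q n * u n) := by
  classical
  -- The ratio demanded by `X⁺` if `p n ≠ 0`, otherwise the one demanded by `X⁻`. The value 1 is
  -- used where neither imposes a condition.
  let r : ℤ → ℂ := fun n => if n ∈ D.J ∧ n + 1 ∈ D.J then
    (if D.p n ≠ 0 then D'.p n / D.p n else if D.q n ≠ 0 then D.q n / D'.q n else 1) else 1
  have hr : ∀ n, r n ≠ 0 := fun n => by
    simp only [r]
    split_ifs with h1 h2 h3
    · exact div_ne_zero (fun h' => h2 ((h.p_iff n h1.1 h1.2).2 h')) h2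
    · exact div_ne_zero h3 (fun h' => h3 ((h.q_iff n h1.1 h1.2).2 h'))
    · exact one_ne_zero
    · exact one_ne_zero
  obtain ⟨u, hu, hur⟩ := exists_int_cocycle r hr
  have key : ∀ n, n ∈ D.J → n + 1 ∈ D.J → D'.p n = D.p n * r n ∧ r n * D'.q n = D.q n := by
    intro n h1 h2
    have e1 := D.rel n h1 h2
    have e2 := D'.rel n (h.J_eq ▸ h1) (h.J_eq ▸ h2)
    have hp := h.p_iff n h1 h2
    have hq := h.q_iff n h1 h2
    simp only [r]
    rw [if_pos ⟨h1, h2⟩]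
    split_ifs with h3 h4
    · refine ⟨by field_simp, ?_⟩
      rw [div_mul_eq_mul_div, e2, ← e1, mul_div_cancel_left₀ _ h3]
    · rw [not_not] at h3
      rw [h3, hp.1 h3, zero_mul]
      exact ⟨rfl, div_mul_cancel₀ _ fun h' => h4 (hq.2 h')⟩
    · rw [not_not] at h3 h4
      rw [h3, hp.1 h3, h4, hq.1 h4]
      simp
  refine ⟨u, hu, fun n h1 h2 => ?_, fun n h1 h2 => ?_⟩
  · rw [hur, (key n h1 h2).1]; ring
  · rw [hur, ← (key n h1 h2).2]; ring

/-- Modules with similar structure constants are isomorphic. -/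
lemma Similar.iso {D D' : Chain t} (h : D.Similar D') : Nonempty (D.lin ≃ₗ[A t] D'.lin) := by
  obtain ⟨u, hu, hp, hq⟩ := h.exists_diag
  have hp' : ∀ n, n ∈ D'.J → n + 1 ∈ D'.J → (u n)⁻¹ * D.p n = D'.p n * (u (n + 1))⁻¹ :=
    fun n h1 h2 => by
      have := hp n (h.J_eq ▸ h1) (h.J_eq ▸ h2)
      have h3 := hu n
      have h4 := hu (n + 1)
      field_simp
      linear_combination -this
  have hq' : ∀ n, n ∈ D'.J → n + 1 ∈ D'.J → (u (n + 1))⁻¹ * D.q n = D'.q n * (u n)⁻¹ :=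
    fun n h1 h2 => by
      have := hq n (h.J_eq ▸ h1) (h.J_eq ▸ h2)
      have h3 := hu n
      have h4 := hu (n + 1)
      field_simp
      linear_combination -this
  refine ⟨LinearEquiv.ofLinearMap (D.diagHom D' h.J_eq u hp hq)
    (D'.diagHom D h.J_eq.symm (fun n => (u n)⁻¹) hp' hq') (D'.hom_extA fun n hn => ?_)
    (D.hom_extA fun n hn => ?_)⟩
  · rw [LinearMap.comp_apply, diagHom, diagHom, homFrom_vec, WMod.hom_smul, homFrom_vec, smul_smul,
      inv_mul_cancel₀ (hu n), one_smul]; rfl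
  · rw [LinearMap.comp_apply, diagHom, diagHom, homFrom_vec, WMod.hom_smul, homFrom_vec, smul_smul,
      mul_inv_cancel₀ (hu n), one_smul]; rfl

/-- The restriction to a part of the support that is not connected to the rest. -/
def restrict (D : Chain t) (S : Set ℤ)
    (hS : ∀ n, n ∈ D.J → n + 1 ∈ D.J → ¬(n ∈ S ↔ n + 1 ∈ S) → D.p n = 0 ∧ D.q n = 0) :
    Chain t where
  J := D.J ∩ S
  p := D.p
  q := D.q
  rel n h1 h2 := D.rel n h1.1 h2.1
  edge n h := by
    by_cases h1 : n ∈ D.J ↔ n + 1 ∈ D.J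
    · have h2 : n ∈ D.J := by
        by_contra h2
        exact h ⟨fun h' => absurd h'.1 h2, fun h' => absurd (h1.2 h'.1) h2⟩
      have h3 := h1.1 h2
      rw [← D.rel n h2 h3, (hS n h2 h3 fun h4 => h
        ⟨fun h' => ⟨h3, h4.1 h'.2⟩, fun h' => ⟨h2, h4.2 h'.2⟩⟩).1, zero_mul]
    · exact D.edge n h1

section Restrict

variable (D : Chain t) (S : Set ℤ)
    (hS : ∀ n, n ∈ D.J → n + 1 ∈ D.J → ¬(n ∈ S ↔ n + 1 ∈ S) → D.p n = 0 ∧ D.q n = 0)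

/-- The inclusion of a direct summand. -/
def restrictIncl : (D.restrict S hS).lin →ₗ[A t] D.lin :=
  open Classical in
  (D.restrict S hS).homFrom (fun n => if n ∈ S then D.vec n else 0)
    (fun n => by
      split_ifs
      · exact D.vec_mem n
      · exact zero_mem _)
    (fun n hn => by
      by_cases h : n ∈ S
      · rw [if_pos h]
        exact D.vec_of_notMem fun h' => hn ⟨h', h⟩
      · rw [if_neg h])
    (fun n hn => by
      rw [if_pos hn.2, D.opP_vec hn.1]
      by_cases h : n + 1 ∈ S
      · rw [if_pos h]; rfl
      · rw [if_neg h, smul_zero]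
        by_cases h2 : n + 1 ∈ D.J
        · rw [(hS n hn.1 h2 fun h3 => h (h3.1 hn.2)).1, zero_smul]
        · rw [D.vec_of_notMem h2, smul_zero])
    (fun n hn => by
      rw [if_pos hn.2, D.opM_vec hn.1]
      by_cases h : n ∈ S
      · rw [if_pos h]; rfl
      · rw [if_neg h, smul_zero]
        by_cases h2 : n ∈ D.J
        · rw [(hS n h2 hn.1 fun h3 => h (h3.2 hn.2)).2, zero_smul]
        · rw [D.vec_of_notMem h2, smul_zero])

lemma restrictIncl_vec {n : ℤ} (hn : n ∈ (D.restrict S hS).J) :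
    D.restrictIncl S hS ((D.restrict S hS).vec n) = D.vec n := by
  rw [restrictIncl, homFrom_vec, if_pos hn.2]

/-- The projection to a direct summand. -/
def restrictProj : D.lin →ₗ[A t] (D.restrict S hS).lin :=
  D.homFrom (fun n => (D.restrict S hS).vec n) (fun n => (D.restrict S hS).vec_mem n)
    (fun n hn => (D.restrict S hS).vec_of_notMem fun h => hn h.1)
    (fun n hn => by
      by_cases h : n ∈ S
      · exact (D.restrict S hS).opP_vec ⟨hn, h⟩
      · rw [(D.restrict S hS).vec_of_notMem fun h' => h h'.2, map_zero]
        by_cases h2 : n + 1 ∈ (D.restrict S hS).J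
        · rw [(hS n hn h2.1 fun h3 => h (h3.2 h2.2)).1, zero_smul]
        · rw [(D.restrict S hS).vec_of_notMem h2, smul_zero])
    (fun n hn => by
      by_cases h : n + 1 ∈ S
      · exact (D.restrict S hS).opM_vec ⟨hn, h⟩
      · rw [(D.restrict S hS).vec_of_notMem fun h' => h h'.2, map_zero]
        by_cases h2 : n ∈ (D.restrict S hS).J
        · rw [(hS n h2.1 hn fun h3 => h (h3.1 h2.2)).2, zero_smul]
        · rw [(D.restrict S hS).vec_of_notMem h2, smul_zero])

lemma restrictProj_vec (n : ℤ) :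
    D.restrictProj S hS (D.vec n) = (D.restrict S hS).vec n := by
  rw [restrictProj, homFrom_vec]

/-- The decomposition into two disconnected parts. -/
def splitIso
    (hS' : ∀ n, n ∈ D.J → n + 1 ∈ D.J → ¬(n ∈ Sᶜ ↔ n + 1 ∈ Sᶜ) → D.p n = 0 ∧ D.q n = 0) :
    D.lin ≃ₗ[A t] (D.restrict S hS).lin × (D.restrict Sᶜ hS').lin :=
  LinearEquiv.ofLinearMap
    ((D.restrictProj S hS).prod (D.restrictProj Sᶜ hS'))
    ((D.restrictIncl S hS).coprod (D.restrictIncl Sᶜ hS'))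
    (by
      refine LinearMap.prod_ext (hom_extA _ fun n hn => ?_) (hom_extA _ fun n hn => ?_)
      · have h : n ∉ (D.restrict Sᶜ hS').J := fun h => h.2 hn.2
        simp only [LinearMap.comp_apply, LinearMap.prod_apply, Function.prod,
          LinearMap.coe_inl, LinearMap.coprod_apply, map_zero, add_zero,
          restrictIncl_vec _ _ _ hn, restrictProj_vec, LinearMap.id_apply]
        rw [(D.restrict Sᶜ hS').vec_of_notMem h]
      · have h : n ∉ (D.restrict S hS).J := fun h => hn.2 h.2
        simp only [LinearMap.comp_apply, LinearMap.prod_apply, Function.prod,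
          LinearMap.coe_inr, LinearMap.coprod_apply, map_zero, zero_add,
          restrictIncl_vec _ _ _ hn, restrictProj_vec, LinearMap.id_apply]
        rw [(D.restrict S hS).vec_of_notMem h])
    (hom_extA _ fun n hn => by
      simp only [LinearMap.comp_apply, LinearMap.prod_apply, Function.prod, LinearMap.coprod_apply,
        LinearMap.id_apply]
      rw [restrictProj_vec, restrictProj_vec]
      by_cases h : n ∈ S
      · rw [restrictIncl_vec _ _ _ ⟨hn, h⟩, (D.restrict Sᶜ hS').vec_of_notMem fun h' => h'.2 h,
          map_zero, add_zero]
      · rw [restrictIncl_vec _ Sᶜ _ ⟨hn, h⟩, (D.restrict S hS).vec_of_notMem fun h' => h h'.2,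
          map_zero, zero_add])

end Restrict

/-- The pointwise product of structure constants. -/
def mul (D : Chain t) (D' : Chain t') : Chain (t * t') where
  J := D.J ∩ D'.J
  p n := D.p n * D'.p n
  q n := D.q n * D'.q n
  rel n h1 h2 := by
    rw [eval_mul, ← D.rel n h1.1 h2.1, ← D'.rel n h1.2 h2.2]
    ring
  edge n h := by
    rw [eval_mul]
    by_cases h1 : n ∈ D.J ↔ n + 1 ∈ D.J
    · rw [D'.edge n fun h2 => h (and_congr h1 h2), mul_zero]
    · rw [D.edge n h1, zero_mul]

lemma tmul_mem {M : WMod t} {N : WMod t'} {l : ℂ} {m : M} {n : N} (hm : m ∈ weightSpace M l) :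
    (m ⊗ₜ n : M ⊗[ℂ[X]] N) ∈ weightSpace (M ⊗[ℂ[X]] N) l := by
  rw [mem_weightSpace] at hm ⊢
  rw [TensorProduct.smul_tmul', hm, TensorProduct.smul_tmul']

lemma smul_tmul_smul_complex (M : WMod t) (N : WMod t') (a b : ℂ) (m : M) (n : N) :
    (a • m) ⊗ₜ[ℂ[X]] (b • n) = (a * b) • (m ⊗ₜ[ℂ[X]] n) := by
  rw [← TensorProduct.smul_tmul', TensorProduct.tmul_smul, smul_smul]

/-- The vector `v_n ⊗ v_n`. -/
def tensorVec (D : Chain t) (D' : Chain t') (n : ℤ) : D.lin.tensor D'.lin :=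
  (D.vec n ⊗ₜ[ℂ[X]] D'.vec n : D.lin ⊗[ℂ[X]] D'.lin)

/-- The map `v_n ↦ v_n ⊗ v_n`. -/
def mulHom (D : Chain t) (D' : Chain t') : (D.mul D').lin →ₗ[A (t * t')] D.lin.tensor D'.lin :=
  (D.mul D').homFrom (tensorVec D D')
    (fun n => tmul_mem (M := D.lin) (N := D'.lin) (D.vec_mem n))
    (fun n hn => by
      by_cases h : n ∈ D.J
      · have := D'.vec_of_notMem fun h' => hn ⟨h, h'⟩
        exact (congrArg (fun w => D.vec n ⊗ₜ[ℂ[X]] w) this).trans (TensorProduct.tmul_zero _ _)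
      · have := D.vec_of_notMem h
        exact (congrArg (fun w => w ⊗ₜ[ℂ[X]] D'.vec n) this).trans (TensorProduct.zero_tmul _ _))
    (fun n hn => by
      refine (tensor_opP D.lin D'.lin (D.vec n ⊗ₜ[ℂ[X]] D'.vec n)).trans ?_
      refine (TensorProduct.map_tmul _ _ _ _).trans ?_
      rw [D.opP_vec hn.1, D'.opP_vec hn.2]
      exact smul_tmul_smul_complex D.lin D'.lin _ _ _ _)
    (fun n hn => by
      refine (tensor_opM D.lin D'.lin (D.vec (n + 1) ⊗ₜ[ℂ[X]] D'.vec (n + 1))).trans ?_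
      refine (TensorProduct.map_tmul _ _ _ _).trans ?_
      rw [D.opM_vec hn.1, D'.opM_vec hn.2]
      exact smul_tmul_smul_complex D.lin D'.lin _ _ _ _)

lemma mulHom_vec (D : Chain t) (D' : Chain t') (n : ℤ) :
    mulHom D D' ((D.mul D').vec n) = tensorVec D D' n := homFrom_vec _ n

/-- `lin D ⊗ lin D' ≅ lin (D D')`. -/
lemma mul_iso (D : Chain t) (D' : Chain t') :
    Nonempty ((D.mul D').lin ≃ₗ[A (t * t')] D.lin.tensor D'.lin) := by
  refine ⟨LinearEquiv.ofBijective (mulHom D D') ⟨?_, ?_⟩⟩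
  · let h : D.lin ⊗[ℂ[X]] D'.lin →ₗ[ℂ[X]] LineOn (D.J ∩ D'.J) :=
      TensorProduct.lift (LineOn.mulR D.J D'.J)
    -- Pointwise multiplication of coefficients recovers `v_n` from `v_n ⊗ v_n`. Linearity over `ℂ`
    -- is enough for injectivity.
    let H : D.lin.tensor D'.lin →ₗ[ℂ] (D.mul D').lin :=
      (h.restrictScalars ℂ : (D.lin ⊗[ℂ[X]] D'.lin) →ₗ[ℂ] LineOn (D.J ∩ D'.J))
    have key : H.comp ((mulHom D D').restrictScalars ℂ) = LinearMap.id := by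
      refine hom_ext _ fun n hn => ?_
      rw [LinearMap.comp_apply, LinearMap.restrictScalars_apply, mulHom_vec]
      refine LineOn.ext fun m => ?_
      change LineOn.coef m (LineOn.vec n) * LineOn.coef m (LineOn.vec n) =
        LineOn.coef m (LineOn.vec n)
      by_cases hm : m = n
      · subst hm
        rw [LineOn.coef_vec_self hn.1, LineOn.coef_vec_self hn.2, LineOn.coef_vec_self hn, mul_one]
      · rw [LineOn.coef_vec_ne hm, LineOn.coef_vec_ne hm, LineOn.coef_vec_ne hm, mul_zero]
    exact Function.LeftInverse.injective (g := H) fun v => LinearMap.congr_fun key v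
  · intro x
    change x ∈ LinearMap.range (mulHom D D')
    suffices h : ∀ x : D.lin ⊗[ℂ[X]] D'.lin, ∃ y, mulHom D D' y = x from h x
    intro x
    induction x using TensorProduct.induction_on with
    | zero => exact ⟨0, map_zero _⟩
    | add x y hx hy =>
      obtain ⟨a, rfl⟩ := hx
      obtain ⟨b, rfl⟩ := hy
      exact ⟨a + b, map_add _ _ _⟩
    | tmul v w =>
      induction v using D.lin.weight_induction with
      | ha a b h1 h2 =>
        obtain ⟨a', h1⟩ := h1
        obtain ⟨b', h2⟩ := h2
        exact ⟨a' + b', by rw [map_add, h1, h2, TensorProduct.add_tmul]; rfl⟩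
      | h l v hv =>
        induction w using D'.lin.weight_induction with
        | ha a b h1 h2 =>
          obtain ⟨a', h1⟩ := h1
          obtain ⟨b', h2⟩ := h2
          exact ⟨a' + b', by rw [map_add, h1, h2, TensorProduct.tmul_add]; rfl⟩
        | h l' w hw =>
          -- Tensors of vectors of distinct weights vanish, and weight spaces of chains are at most
          -- lines, so only multiples of `v_n ⊗ v_n` remain.
          by_cases hl : l = l'
          · subst hl
            by_cases h0 : v = 0
            · exact ⟨0, by rw [map_zero, h0, TensorProduct.zero_tmul]; rfl⟩
            obtain ⟨n, hn, rfl⟩ := D.weight_int hv h0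
            refine ⟨(D.coef n v * D'.coef n w) • (D.mul D').vec n, ?_⟩
            rw [WMod.hom_smul, mulHom_vec]
            conv_rhs => rw [D.eq_smul_vec hv, D'.eq_smul_vec hw]
            exact (smul_tmul_smul_complex D.lin D'.lin _ _ _ _).symm
          · exact ⟨0, by rw [map_zero, tmul_eq_zero_of_ne _ _ hl hv hw]; rfl⟩

end Chain

/-! ### Splitting off a string -/

section Half

variable {E : Type*} [AddCommGroup E] [Module ℂ E]

/-- Two operators `P : V_d → V_{d+1}` and `Q : V_{d+1} → V_d` on a sequence of subspaces, with
`QP` and `PQ` equal to scalars `c_d`. -/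
structure Ladder (P Q : E →ₗ[ℂ] E) (V : ℕ → Submodule ℂ E) (c : ℕ → ℂ) : Prop where
  P_mem : ∀ d, ∀ x ∈ V d, P x ∈ V (d + 1)
  Q_mem : ∀ d, ∀ x ∈ V (d + 1), Q x ∈ V d
  QP : ∀ d, ∀ x ∈ V d, Q (P x) = c d • x
  PQ : ∀ d, ∀ x ∈ V (d + 1), P (Q x) = c d • x

/-- Structure constants of a connected module supported on an initial segment `J` of `ℕ`. -/
structure HalfChain (c : ℕ → ℂ) (J : Set ℕ) (p q : ℕ → ℂ) : Prop where
  zero_mem : 0 ∈ J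
  step : ∀ d, d + 1 ∈ J → d ∈ J ∧ (p d ≠ 0 ∨ q d ≠ 0)
  rel : ∀ d, d ∈ J → p d * q d = c d
  out : ∀ d, d + 1 ∉ J → p d = 0 ∧ q d = 0

/-- A sequence of vectors on which `P` and `Q` act with given structure constants. -/
structure HalfPath (P Q : E →ₗ[ℂ] E) (V : ℕ → Submodule ℂ E) (J : Set ℕ) (p q : ℕ → ℂ)
    (x : ℕ → E) : Prop where
  mem : ∀ d, x d ∈ V d
  out : ∀ d, d ∉ J → x d = 0
  P_eq : ∀ d, P (x d) = p d • x (d + 1)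
  Q_eq : ∀ d, Q (x (d + 1)) = q d • x d

/-- A sequence of functionals on which `P` and `Q` act with given structure constants. -/
structure HalfCopath (P Q : E →ₗ[ℂ] E) (V : ℕ → Submodule ℂ E) (J : Set ℕ) (p q : ℕ → ℂ)
    (F : ℕ → E →ₗ[ℂ] ℂ) : Prop where
  out : ∀ d, d ∉ J → ∀ x ∈ V d, F d x = 0
  P_eq : ∀ d, ∀ x ∈ V d, F (d + 1) (P x) = p d * F d x
  Q_eq : ∀ d, ∀ x ∈ V (d + 1), F d (Q x) = q d * F (d + 1) x

/-- Prepend a term to a sequence. -/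
def seqCons {α : Type*} (a : α) (x : ℕ → α) : ℕ → α
  | 0 => a
  | d + 1 => x d

/-- Prepend `0` to the shift of a set of natural numbers. -/
def setCons (J : Set ℕ) : Set ℕ := {d | d = 0 ∨ ∃ e ∈ J, d = e + 1}

lemma zero_mem_setCons (J : Set ℕ) : 0 ∈ setCons J := Or.inl rfl

lemma succ_mem_setCons {J : Set ℕ} {d : ℕ} : d + 1 ∈ setCons J ↔ d ∈ J :=
  ⟨fun h => h.elim (fun h => absurd h d.succ_ne_zero) fun ⟨_, he, h⟩ => (Nat.succ.inj h) ▸ he,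
    fun h => Or.inr ⟨d, h, rfl⟩⟩

variable {P Q : E →ₗ[ℂ] E} {V : ℕ → Submodule ℂ E} {c : ℕ → ℂ} {J : Set ℕ} {p q : ℕ → ℂ}

lemma Ladder.tail (h : Ladder P Q V c) : Ladder P Q (fun d => V (d + 1)) (fun d => c (d + 1)) :=
  ⟨fun d => h.P_mem (d + 1), fun d => h.Q_mem (d + 1), fun d => h.QP (d + 1),
    fun d => h.PQ (d + 1)⟩

lemma HalfChain.cons (h : HalfChain (fun d => c (d + 1)) J p q) {a b : ℂ} (hab : a * b = c 0)
    (h0 : a ≠ 0 ∨ b ≠ 0) : HalfChain c (setCons J) (seqCons a p) (seqCons b q) where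
  zero_mem := zero_mem_setCons J
  step d hd := match d with
    | 0 => ⟨zero_mem_setCons J, h0⟩
    | d + 1 => ⟨succ_mem_setCons.2 (h.step d (succ_mem_setCons.1 hd)).1,
        (h.step d (succ_mem_setCons.1 hd)).2⟩
  rel d hd := match d with
    | 0 => hab
    | d + 1 => h.rel d (succ_mem_setCons.1 hd)
  out d hd := match d with
    | 0 => absurd (succ_mem_setCons.2 h.zero_mem) hd
    | d + 1 => h.out d fun h' => hd (succ_mem_setCons.2 h')

lemma HalfPath.cons {x : ℕ → E} (h : HalfPath P Q (fun d => V (d + 1)) J p q x) {a b : ℂ} {y : E}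
    (hy : y ∈ V 0) (hP : P y = a • x 0) (hQ : Q (x 0) = b • y) :
    HalfPath P Q V (setCons J) (seqCons a p) (seqCons b q) (seqCons y x) where
  mem d := match d with
    | 0 => hy
    | d + 1 => h.mem d
  out d hd := match d with
    | 0 => absurd (zero_mem_setCons J) hd
    | d + 1 => h.out d fun h' => hd (succ_mem_setCons.2 h')
  P_eq d := match d with
    | 0 => hP
    | d + 1 => h.P_eq d
  Q_eq d := match d with
    | 0 => hQ
    | d + 1 => h.Q_eq d

lemma HalfCopath.cons {F : ℕ → E →ₗ[ℂ] ℂ} (h : HalfCopath P Q (fun d => V (d + 1)) J p q F)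
    {a b : ℂ} {f : E →ₗ[ℂ] ℂ} (hP : ∀ x ∈ V 0, F 0 (P x) = a * f x)
    (hQ : ∀ x ∈ V 1, f (Q x) = b * F 0 x) :
    HalfCopath P Q V (setCons J) (seqCons a p) (seqCons b q) (seqCons f F) where
  out d hd := match d with
    | 0 => absurd (zero_mem_setCons J) hd
    | d + 1 => h.out d fun h' => hd (succ_mem_setCons.2 h')
  P_eq d := match d with
    | 0 => hP
    | d + 1 => h.P_eq d
  Q_eq d := match d with
    | 0 => hQ
    | d + 1 => h.Q_eq d

/-- The hypothesis says that `f` vanishes on the kernel of the map `V₀ → E / U` induced by `P`, so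
`f` factors through that map, and the factor extends to all of `E / U`. This moves a functional one
step along `P` while keeping it zero on `U`. -/
lemma exists_functional_comp {V₀ U : Submodule ℂ E} {f : E →ₗ[ℂ] ℂ}
    (hf : ∀ x ∈ V₀, P x ∈ U → f x = 0) :
    ∃ g : E →ₗ[ℂ] ℂ, (∀ u ∈ U, g u = 0) ∧ ∀ x ∈ V₀, g (P x) = f x := by
  let T : V₀ →ₗ[ℂ] E ⧸ U := U.mkQ ∘ₗ P ∘ₗ V₀.subtype
  have h : f ∘ₗ V₀.subtype ∈ LinearMap.range T.dualMap := by
    rw [LinearMap.range_dualMap_eq_dualAnnihilator_ker, Submodule.mem_dualAnnihilator]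
    intro x hx
    exact hf x x.2 ((Submodule.Quotient.mk_eq_zero U).1 hx)
  obtain ⟨g, hg⟩ := h
  refine ⟨g ∘ₗ U.mkQ, fun u hu => ?_, fun x hx => LinearMap.congr_fun hg ⟨x, hx⟩⟩
  rw [LinearMap.comp_apply, Submodule.mkQ_apply, (Submodule.Quotient.mk_eq_zero U).2 hu, map_zero]

/-- If all scalars are nonzero, then a vector or functional on `V_0` extends uniquely. -/
lemma Ladder.exists_of_ne_zero (h : Ladder P Q V c) (hc : ∀ d, c d ≠ 0) :
    HalfChain c Set.univ 1 c ∧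
      (∀ x ∈ V 0, ∃ X, HalfPath P Q V Set.univ 1 c X ∧ X 0 = x) ∧
      ∀ f : E →ₗ[ℂ] ℂ, ∃ F, HalfCopath P Q V Set.univ 1 c F ∧ F 0 = f := by
  have hP : ∀ d, ∀ x ∈ V 0, (P ^ d) x ∈ V d := fun d x hx => by
    induction d with
    | zero => exact hx
    | succ d ih => rw [pow_succ', Module.End.mul_apply]; exact h.P_mem d _ ih
  refine ⟨⟨trivial, fun _ _ => ⟨trivial, Or.inl one_ne_zero⟩, fun _ _ => one_mul _,
    fun _ h => absurd trivial h⟩, fun x hx => ⟨fun d => (P ^ d) x, ⟨fun d => hP d x hx,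
    fun _ h => absurd trivial h, fun d => ?_, fun d => ?_⟩, rfl⟩, fun f =>
    -- Vectors are carried by `P`, so functionals are carried by `Q`. Dividing by the product of the
    -- scalars passed so far gives the same constants as for vectors, 1 for `P` and `c` for `Q`.
    ⟨fun d => (∏ i ∈ Finset.range d, c i)⁻¹ • f ∘ₗ (Q ^ d), ⟨fun _ h => absurd trivial h,
      fun d x hx => ?_, fun d x hx => ?_⟩, ?_⟩⟩
  · rw [Pi.one_apply, one_smul, pow_succ', Module.End.mul_apply]
  · rw [pow_succ', Module.End.mul_apply, h.QP d _ (hP d x hx)]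
  · have : ∏ i ∈ Finset.range d, c i ≠ 0 := Finset.prod_ne_zero_iff.2 fun i _ => hc i
    have h2 := hc d
    simp only [LinearMap.smul_apply, LinearMap.comp_apply, pow_succ, Module.End.mul_apply,
      h.QP d x hx, map_smul, smul_eq_mul, Finset.prod_range_succ, Pi.one_apply, one_mul]
    field_simp
  · have : ∏ i ∈ Finset.range d, c i ≠ 0 := Finset.prod_ne_zero_iff.2 fun i _ => hc i
    have h2 := hc d
    simp only [LinearMap.smul_apply, LinearMap.comp_apply, pow_succ, Module.End.mul_apply,
      smul_eq_mul, Finset.prod_range_succ]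
    field_simp
  · ext x
    simp

/-- A functorial filtration argument on a half-line. The half-string is found edge by edge, together
with a vector `x` of `W` outside `W₀` that extends to a path along it, and a subspace `U` such that
functionals vanishing on `U` extend to copaths. Since `W ⊓ U ≤ W₀`, the vector `x` is not in `U`, so
some functional is admissible and nonzero at `x`. The pair `W₀`, `W` makes the statement inductive:
each step replaces it by images under `P` or preimages under `Q`. Once no zero scalars are left,
everything extends. -/
theorem exists_half_string (N : ℕ) : ∀ {V : ℕ → Submodule ℂ E} {c : ℕ → ℂ}, Ladder P Q V c →
    (∀ d, N ≤ d → c d ≠ 0) → ∀ {W₀ W : Submodule ℂ E}, W ≤ V 0 → ¬ W ≤ W₀ →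
    ∃ (J : Set ℕ) (p q : ℕ → ℂ), HalfChain c J p q ∧ ∃ U ≤ V 0, W ⊓ U ≤ W₀ ∧
      (∃ x ∈ W, x ∉ W₀ ∧ ∃ X, HalfPath P Q V J p q X ∧ X 0 = x) ∧
      ∀ f : E →ₗ[ℂ] ℂ, (∀ u ∈ U, f u = 0) → ∃ F, HalfCopath P Q V J p q F ∧ F 0 = f := by
  induction N with
  | zero =>
    intro V c h hc W₀ W hW hlt
    obtain ⟨h1, h2, h3⟩ := h.exists_of_ne_zero fun d => hc d d.zero_le
    obtain ⟨x, hx, hx0⟩ := Set.not_subset.1 hlt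
    exact ⟨_, _, _, h1, ⊥, bot_le, by rw [inf_bot_eq]; exact bot_le,
      ⟨x, hx, hx0, h2 x (hW hx)⟩, fun f _ => h3 f⟩
  | succ N ih =>
    intro V c h hc W₀ W hW hlt
    have hc' : ∀ d, N ≤ d → c (d + 1) ≠ 0 := fun d hd => hc _ (Nat.succ_le_succ hd)
    -- If `P` kills nothing in `W` modulo `W₀`, continue with the images under `P`. The new edge has
    -- constants 1 for `P` and `c 0` for `Q`.
    by_cases hker : ∀ x ∈ W, P x = 0 → x ∈ W₀
    · obtain ⟨J, p, q, hch, U, hU, hWU, ⟨x', hx', hx0', X, hX, hX0⟩, hF⟩ :=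
        ih h.tail hc' (W₀ := (W₀ ⊓ W).map P) (W := W.map P)
        (by rintro _ ⟨x, hx, rfl⟩; exact h.P_mem 0 x (hW hx))
        (fun hle => hlt fun x hx => by
          obtain ⟨y, hy, hxy⟩ := hle ⟨x, hx, rfl⟩
          have := hker (x - y) (sub_mem hx hy.2) (by rw [map_sub, hxy, sub_self])
          exact (sub_add_cancel x y) ▸ add_mem this hy.1)
      obtain ⟨x, hx, rfl⟩ := hx'
      refine ⟨_, _, _, hch.cons (a := 1) (b := c 0) (one_mul _) (Or.inl one_ne_zero),
        V 0 ⊓ U.comap P, inf_le_left, ?_, ⟨x, hx, fun hx0 => hx0' ⟨x, ⟨hx0, hx⟩, rfl⟩, _,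
        hX.cons (hW hx) (by rw [hX0, one_smul]) (by rw [hX0, h.QP 0 x (hW hx)]), rfl⟩,
        fun f hf => ?_⟩
      · rintro x ⟨hx, -, hxU⟩
        obtain ⟨y, hy, hxy⟩ := hWU ⟨⟨x, hx, rfl⟩, hxU⟩
        have := hker (x - y) (sub_mem hx hy.2) (by rw [map_sub, hxy, sub_self])
        exact (sub_add_cancel x y) ▸ add_mem this hy.1
      · obtain ⟨g, hg, hgP⟩ := exists_functional_comp (P := P) (V₀ := V 0) (U := U) (f := f)
          fun x hx hxU => hf x ⟨hx, hxU⟩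
        obtain ⟨F, hF, rfl⟩ := hF g hg
        refine ⟨_, hF.cons (fun x hx => by rw [hgP x hx, one_mul]) (fun x hx => ?_), rfl⟩
        rw [← hgP _ (h.Q_mem 0 x hx), h.PQ 0 x hx, map_smul, smul_eq_mul]
    -- With `c 0 ≠ 0` the map `P` would be injective on `W`, since `Q P = c 0`, and the previous
    -- case would apply.
    have hc0 : c 0 = 0 := by
      by_contra hc0
      refine hker fun x hx hPx => ?_
      have := h.QP 0 x (hW hx)
      rw [hPx, map_zero] at this
      rw [(smul_eq_zero.1 this.symm).resolve_left hc0]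
      exact zero_mem _
    -- A vector killed by `P` is now available outside `W₀`. If `W` meets the image of `Q` only
    -- within `W₀`, the half-string stops at this vertex, and `U` is the image of `Q`: a functional
    -- can be extended by zero exactly when it vanishes there.
    by_cases him : ∀ x ∈ V 1, Q x ∈ W → Q x ∈ W₀
    · push Not at hker
      obtain ⟨x, hx, hPx, hx0⟩ := hker
      refine ⟨{0}, 0, 0, ⟨rfl, fun d hd => absurd hd d.succ_ne_zero, ?_, fun _ _ => ⟨rfl, rfl⟩⟩,
        (V 1).map Q, ?_, ?_, ⟨x, hx, hx0, seqCons x 0, ⟨?_, ?_, ?_, ?_⟩, rfl⟩,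
        fun f hf => ⟨seqCons f 0, ⟨?_, ?_, ?_⟩, rfl⟩⟩
      · rintro d rfl
        rw [hc0, Pi.zero_apply, zero_mul]
      · rintro _ ⟨y, hy, rfl⟩
        exact h.Q_mem 0 y hy
      · rintro _ ⟨hyW, y, hy, rfl⟩
        exact him y hy hyW
      · rintro (_ | d)
        · exact hW hx
        · exact zero_mem _
      · rintro (_ | d) hd
        · exact absurd rfl hd
        · rfl
      · rintro (_ | d)
        · rw [Pi.zero_apply, zero_smul]; exact hPx
        · rw [Pi.zero_apply, zero_smul]; exact map_zero P
      · rintro (_ | d) <;> rw [Pi.zero_apply, zero_smul] <;> exact map_zero Q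
      · rintro (_ | d) hd y hy
        · exact absurd rfl hd
        · rfl
      · rintro (_ | d) y hy <;> rw [Pi.zero_apply, zero_mul] <;> rfl
      · rintro (_ | d) y hy
        · rw [Pi.zero_apply, zero_mul]
          exact hf _ ⟨y, hy, rfl⟩
        · rw [Pi.zero_apply, zero_mul]; rfl
    -- Otherwise continue with preimages under `Q`. The new edge has constant 1 for `Q` and `c 0`,
    -- which is zero here, for `P`; a functional is passed on by composition with `Q`.
    · push Not at him
      obtain ⟨y, hy, hyW, hyW0⟩ := him
      obtain ⟨J, p, q, hch, U, hU, hWU, ⟨x, hx, hx0, X, hX, hX0⟩, hF⟩ :=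
        ih h.tail hc' (W₀ := W₀.comap Q) (W := V 1 ⊓ W.comap Q) inf_le_left
        (fun hle => hyW0 (hle ⟨hy, hyW⟩))
      refine ⟨_, _, _, hch.cons (a := c 0) (b := 1) (mul_one _) (Or.inr one_ne_zero),
        U.map Q, ?_, ?_, ⟨Q x, hx.2, hx0, _, hX.cons (h.Q_mem 0 x hx.1) ?_ ?_, rfl⟩,
        fun f hf => ?_⟩
      · rintro _ ⟨u, hu, rfl⟩
        exact h.Q_mem 0 u (hU hu)
      · rintro _ ⟨huW, u, hu, rfl⟩
        exact hWU ⟨⟨hU hu, huW⟩, hu⟩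
      · rw [h.PQ 0 x hx.1, hX0]
      · rw [hX0, one_smul]
      · obtain ⟨F, hF, hF0⟩ := hF (f ∘ₗ Q) fun u hu => hf _ ⟨u, hu, rfl⟩
        refine ⟨_, hF.cons (fun x hx => ?_) (fun x hx => ?_), rfl⟩
        · rw [hF0, LinearMap.comp_apply, h.QP 0 x hx, map_smul, smul_eq_mul]
        · rw [hF0, LinearMap.comp_apply, one_mul]

end Half

/-! ### Gluing two half-strings at a vertex -/

lemma exists_root_bound {t : ℂ[X]} (ht : t ≠ 0) :
    ∃ B : ℕ, ∀ n : ℤ, B ≤ n.natAbs → t.eval ((n : ℂ) + 1 / 2) ≠ 0 := by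
  have hf : {n : ℤ | t.IsRoot ((n : ℂ) + 1 / 2)}.Finite :=
    (Polynomial.finite_setOfPred_isRoot ht).preimage
      fun a _ b _ h => Int.cast_injective (add_right_cancel h)
  obtain ⟨B, hB⟩ := (hf.image Int.natAbs).bddAbove
  exact ⟨B + 1, fun n hn h => absurd (hB ⟨n, h, rfl⟩) (by omega)⟩

/-- A sequence indexed by `ℤ` that is made from two sequences indexed by `ℕ`, starting at `i` and
going up, and starting at `i - 1` and going down. -/
def glue {α : Type*} (i : ℤ) (r l : ℕ → α) (n : ℤ) : α :=
  if i ≤ n then r (n - i).toNat else l (i - 1 - n).toNat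

section Glue

variable {α : Type*} (i : ℤ) (r l : ℕ → α)

lemma glue_right (d : ℕ) : glue i r l (i + d) = r d := by
  rw [glue, if_pos (by omega), add_sub_cancel_left, Int.toNat_natCast]

lemma glue_left (d : ℕ) : glue i r l (i - 1 - d) = l d := by
  rw [glue, if_neg (by omega), sub_sub_cancel, Int.toNat_natCast]

lemma glue_right_succ (d : ℕ) : glue i r l (i + d + 1) = r (d + 1) := by
  rw [add_assoc]
  exact glue_right i r l (d + 1)

/-- Both half-sequences start at the vertex `i`. The glued sequence takes that term from the right
half and drops it from the left one, so at `d = 0` the two initial terms have to agree. -/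
lemma glue_left_succ (h : r 0 = l 0) (d : ℕ) :
    glue i r (fun e => l (e + 1)) (i - 1 - d + 1) = l d := by
  cases d with
  | zero =>
    rw [← h, ← glue_right i r (fun e => l (e + 1)) 0]
    congr 1
    push_cast
    ring
  | succ d =>
    rw [← glue_left i r (fun e => l (e + 1)) d]
    congr 1
    push_cast
    ring

lemma glue_cases {C : ℤ → Prop} (hr : ∀ d : ℕ, C (i + d)) (hl : ∀ d : ℕ, C (i - 1 - d)) (n : ℤ) :
    C n := by
  by_cases h : i ≤ n
  · have := hr (n - i).toNat
    rwa [Int.toNat_of_nonneg (by omega), add_sub_cancel] at this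
  · have := hl (i - 1 - n).toNat
    rwa [Int.toNat_of_nonneg (by omega), sub_sub_cancel] at this

end Glue

namespace WMod

variable {t : ℂ[X]} (M : WMod t)

lemma ladder_right (i : ℤ) : Ladder (toLin M.opP) (toLin M.opM)
    (fun d => weightSpace M ((i + d : ℤ) : ℂ)) (fun d => t.eval (((i + d : ℤ) : ℂ) + 1 / 2)) where
  P_mem d x hx := by
    rw [Nat.cast_succ, ← add_assoc]
    exact M.opP_mem_int hx
  Q_mem d x hx := by
    rw [Nat.cast_succ, ← add_assoc] at hx
    exact M.opM_mem_int hx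
  QP d x hx := M.opM_opP_of_mem hx
  PQ d x hx := by
    rw [Nat.cast_succ, ← add_assoc] at hx
    exact M.opP_opM_of_mem hx

/-- Going down, `X⁻` plays the role of `P`. The `d`-th edge joins `i - 1 - d` to `i - d` and is
named by its lower end, hence the extra `1` in the scalar. -/
lemma ladder_left (i : ℤ) : Ladder (toLin M.opM) (toLin M.opP)
    (fun d => weightSpace M ((i - d : ℤ) : ℂ))
    (fun d => t.eval (((i - 1 - d : ℤ) : ℂ) + 1 / 2)) where
  P_mem d x hx := by
    have h : i - (d : ℤ) = i - (d + 1 : ℕ) + 1 := by push_cast; ring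
    rw [h] at hx
    exact M.opM_mem_int hx
  Q_mem d x hx := by
    have h : i - (d : ℤ) = i - (d + 1 : ℕ) + 1 := by push_cast; ring
    rw [h]
    exact M.opP_mem_int hx
  QP d x hx := by
    have h : i - (d : ℤ) = i - 1 - d + 1 := by ring
    rw [h] at hx
    exact M.opP_opM_of_mem hx
  PQ d x hx := by
    have h : i - ((d + 1 : ℕ) : ℤ) = i - 1 - d := by push_cast; ring
    rw [h] at hx
    exact M.opM_opP_of_mem hx

end WMod

lemma HalfChain.mem_of_le {c : ℕ → ℂ} {J : Set ℕ} {p q : ℕ → ℂ} (h : HalfChain c J p q) {d e : ℕ}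
    (hd : d ∈ J) (hed : e ≤ d) : e ∈ J := by
  induction d with
  | zero => rwa [Nat.le_zero.1 hed]
  | succ d ih =>
    rcases Nat.le_succ_iff.1 hed with h' | rfl
    · exact ih (h.step d hd).1 h'
    · exact hd

lemma HalfChain.scalar_eq_zero {c : ℕ → ℂ} {J : Set ℕ} {p q : ℕ → ℂ} (h : HalfChain c J p q)
    {d : ℕ} (hd : ¬(d ∈ J ↔ d + 1 ∈ J)) : c d = 0 := by
  have h1 : d + 1 ∉ J := fun h1 => hd ⟨fun _ => h1, fun _ => (h.step d h1).1⟩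
  have h2 : d ∈ J := by
    by_contra h2
    exact hd ⟨fun h' => absurd h' h2, fun h' => absurd h' h1⟩
  rw [← h.rel d h2, (h.out d h1).1, zero_mul]

namespace Chain

variable {t : ℂ[X]}

/-- The support is a nonempty interval, and no edge in it is disconnected. -/
structure IsString (D : Chain t) : Prop where
  nonempty : D.J.Nonempty
  ordConnected : D.J.OrdConnected
  edge_ne_zero : ∀ n, n ∈ D.J → n + 1 ∈ D.J → D.p n ≠ 0 ∨ D.q n ≠ 0

end Chain

section GlueChain

variable {t : ℂ[X]} {i : ℤ} {J K : Set ℕ} {p q p' q' : ℕ → ℂ}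
  (hr : HalfChain (fun d : ℕ => t.eval (((i + d : ℤ) : ℂ) + 1 / 2)) J p q)
  (hl : HalfChain (fun d : ℕ => t.eval (((i - 1 - d : ℤ) : ℂ) + 1 / 2)) K p' q')

/-- The support of a glued chain. -/
def glueSet (i : ℤ) (J K : Set ℕ) : Set ℤ :=
  {n | glue i (fun d => d ∈ J) (fun d => d + 1 ∈ K) n}

lemma mem_glueSet_right {d : ℕ} : i + (d : ℤ) ∈ glueSet i J K ↔ d ∈ J :=
  iff_of_eq (glue_right i (fun d => d ∈ J) (fun d => d + 1 ∈ K) d)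

lemma mem_glueSet_right_succ {d : ℕ} : i + (d : ℤ) + 1 ∈ glueSet i J K ↔ d + 1 ∈ J :=
  iff_of_eq (glue_right_succ i (fun d => d ∈ J) (fun d => d + 1 ∈ K) d)

lemma mem_glueSet_left {d : ℕ} : i - 1 - (d : ℤ) ∈ glueSet i J K ↔ d + 1 ∈ K :=
  iff_of_eq (glue_left i (fun d => d ∈ J) (fun d => d + 1 ∈ K) d)

lemma mem_glueSet_left_succ (hJ : 0 ∈ J) (hK : 0 ∈ K) {d : ℕ} :
    i - 1 - (d : ℤ) + 1 ∈ glueSet i J K ↔ d ∈ K :=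
  iff_of_eq (glue_left_succ i (fun d => d ∈ J) (fun d => d ∈ K) (by simp [hJ, hK]) d)

/-- Structure constants glued from two halves. -/
def glueChain : Chain t where
  J := glueSet i J K
  -- On the left half `P` is `X⁻`, so its constants `p'` become values of `q`, and `q'` become
  -- values of `p`.
  p := glue i p q'
  q := glue i q p'
  rel := glue_cases i
    (fun d h1 h2 => by rw [glue_right, glue_right]; exact hr.rel d (mem_glueSet_right.1 h1))
    (fun d h1 h2 => by
      rw [glue_left, glue_left, mul_comm]
      exact hl.rel d ((mem_glueSet_left_succ hr.zero_mem hl.zero_mem).1 h2))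
  edge := glue_cases i
    (fun d h => by
      rw [mem_glueSet_right, mem_glueSet_right_succ] at h
      exact hr.scalar_eq_zero h)
    (fun d h => by
      rw [mem_glueSet_left, mem_glueSet_left_succ hr.zero_mem hl.zero_mem, iff_comm] at h
      exact hl.scalar_eq_zero h)

lemma glueChain_isString : (glueChain hr hl).IsString where
  nonempty := ⟨i + (0 : ℕ), mem_glueSet_right.2 hr.zero_mem⟩
  ordConnected := by
    refine ⟨fun a ha b hb m hm => ?_⟩
    change a ∈ glueSet i J K at ha
    change b ∈ glueSet i J K at hb
    change m ∈ glueSet i J K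
    by_cases h : i ≤ m
    · obtain ⟨d, rfl⟩ : ∃ d : ℕ, m = i + d := ⟨(m - i).toNat, by omega⟩
      obtain ⟨e, rfl⟩ : ∃ d : ℕ, b = i + d := ⟨(b - i).toNat, by have := hm.2; omega⟩
      rw [mem_glueSet_right] at hb ⊢
      exact hr.mem_of_le hb (by have := hm.2; omega)
    · obtain ⟨d, rfl⟩ : ∃ d : ℕ, m = i - 1 - d := ⟨(i - 1 - m).toNat, by omega⟩
      obtain ⟨e, rfl⟩ : ∃ d : ℕ, a = i - 1 - d := ⟨(i - 1 - a).toNat, by have := hm.1; omega⟩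
      rw [mem_glueSet_left] at ha ⊢
      exact hl.mem_of_le ha (by have := hm.1; omega)
  edge_ne_zero := glue_cases i
    (fun d h1 h2 => by
      change glue i p q' _ ≠ 0 ∨ glue i q p' _ ≠ 0
      rw [glue_right, glue_right]
      exact (hr.step d (mem_glueSet_right_succ.1 h2)).2)
    (fun d h1 h2 => by
      change glue i p q' _ ≠ 0 ∨ glue i q p' _ ≠ 0
      rw [glue_left, glue_left]
      exact (hl.step d (mem_glueSet_left.1 h1)).2.symm)

variable {M : WMod t} {x y : ℕ → M} {F G : ℕ → M →ₗ[ℂ] ℂ}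
  (hx : HalfPath (toLin M.opP) (toLin M.opM) (fun d => weightSpace M ((i + d : ℤ) : ℂ)) J p q x)
  (hy : HalfPath (toLin M.opM) (toLin M.opP) (fun d => weightSpace M ((i - d : ℤ) : ℂ)) K p' q' y)
  (hxy : x 0 = y 0)
  (hF : HalfCopath (toLin M.opP) (toLin M.opM) (fun d => weightSpace M ((i + d : ℤ) : ℂ)) J p q F)
  (hG : HalfCopath (toLin M.opM) (toLin M.opP) (fun d => weightSpace M ((i - d : ℤ) : ℂ)) K p' q' G)
  (hFG : F 0 = G 0)

/-- The homomorphism that is given by two halves of a path. -/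
def glueFrom : (glueChain hr hl).lin →ₗ[A t] M :=
  (glueChain hr hl).homFrom (glue i x fun d => y (d + 1))
    (glue_cases i (fun d => by rw [glue_right]; exact hx.mem d)
      (fun d => by
        rw [glue_left]
        have h := hy.mem (d + 1)
        have e : i - ((d + 1 : ℕ) : ℤ) = i - 1 - d := by push_cast; ring
        rwa [e] at h))
    (glue_cases i
      (fun d h => by rw [glue_right]; exact hx.out d fun h' => h (mem_glueSet_right.2 h'))
      (fun d h => by rw [glue_left]; exact hy.out _ fun h' => h (mem_glueSet_left.2 h')))
    (glue_cases i
      (fun d _ => by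
        change _ = glue i p q' _ • _
        rw [glue_right, glue_right, glue_right_succ]
        exact hx.P_eq d)
      (fun d _ => by
        change _ = glue i p q' _ • _
        rw [glue_left, glue_left, glue_left_succ i x y hxy]
        exact hy.Q_eq d))
    (glue_cases i
      (fun d _ => by
        change _ = glue i q p' _ • _
        rw [glue_right, glue_right, glue_right_succ]
        exact hx.Q_eq d)
      (fun d _ => by
        change _ = glue i q p' _ • _
        rw [glue_left, glue_left, glue_left_succ i x y hxy]
        exact hy.P_eq d))

/-- The homomorphism that is given by two halves of a sequence of functionals. -/
def glueTo : M →ₗ[A t] (glueChain hr hl).lin :=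
  (glueChain hr hl).homTo (glue i F fun d => G (d + 1))
    (glue_cases i
      (fun d h => by rw [glue_right]; exact hF.out d fun h' => h (mem_glueSet_right.2 h'))
      (fun d h => by
        rw [glue_left]
        have h := hG.out _ fun h' => h (mem_glueSet_left.2 h')
        have e : i - ((d + 1 : ℕ) : ℤ) = i - 1 - d := by push_cast; ring
        rwa [e] at h))
    (glue_cases i
      (fun d _ m hm => by
        change _ = glue i p q' _ * _
        rw [glue_right, glue_right, glue_right_succ]
        exact hF.P_eq d m hm)
      (fun d _ m hm => by
        change _ = glue i p q' _ * _
        rw [glue_left, glue_left, glue_left_succ i F G hFG]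
        have e : i - 1 - (d : ℤ) = i - ((d + 1 : ℕ) : ℤ) := by push_cast; ring
        rw [e] at hm
        exact hG.Q_eq d m hm))
    (glue_cases i
      (fun d _ m hm => by
        change _ = glue i q p' _ * _
        rw [glue_right, glue_right, glue_right_succ]
        rw [add_assoc] at hm
        exact hF.Q_eq d m hm)
      (fun d _ m hm => by
        change _ = glue i q p' _ * _
        rw [glue_left, glue_left, glue_left_succ i F G hFG]
        have e : i - 1 - (d : ℤ) + 1 = i - (d : ℤ) := by ring
        rw [e] at hm
        exact hG.P_eq d m hm))

end GlueChain

/-! ### Strings as direct summands -/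

namespace Chain

variable {t : ℂ[X]}

/-- An endomorphism of a string module is a scalar. -/
lemma IsString.endo {D : Chain t} (hD : D.IsString) (f : D.lin →ₗ[A t] D.lin) {i : ℤ}
    (hi : i ∈ D.J) (v : D.lin) : f v = D.coef i (f (D.vec i)) • v := by
  have hv : ∀ n, f (D.vec n) = D.coef n (f (D.vec n)) • D.vec n := fun n =>
    D.eq_smul_vec (WMod.hom_mem_weightSpace f (D.vec_mem n))
  -- The endomorphism is diagonal because weight spaces are lines. Across each inner edge one of
  -- `X⁺`, `X⁻` is nonzero, and commuting with it forces neighbouring eigenvalues to agree.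
  have hstep : ∀ n, n ∈ D.J → n + 1 ∈ D.J →
      D.coef n (f (D.vec n)) = D.coef (n + 1) (f (D.vec (n + 1))) := fun n h1 h2 => by
    rcases hD.edge_ne_zero n h1 h2 with h | h
    · have := WMod.hom_opP f (D.vec n)
      rw [D.opP_vec h1, WMod.hom_smul, hv n, WMod.opP_smul, D.opP_vec h1, hv (n + 1), smul_smul,
        smul_smul] at this
      have := congrArg (D.coef (n + 1)) this
      rw [map_smul, map_smul, D.coef_vec_self h2, smul_eq_mul, smul_eq_mul, mul_one, mul_one,
        mul_comm] at this
      exact (mul_right_cancel₀ h this).symm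
    · have := WMod.hom_opM f (D.vec (n + 1))
      rw [D.opM_vec h2, WMod.hom_smul, hv n, hv (n + 1), WMod.opM_smul, D.opM_vec h2, smul_smul,
        smul_smul] at this
      have := congrArg (D.coef n) this
      rw [map_smul, map_smul, D.coef_vec_self h1, smul_eq_mul, smul_eq_mul, mul_one, mul_one,
        mul_comm] at this
      exact mul_right_cancel₀ h this
  have hup : ∀ a ∈ D.J, ∀ d : ℕ, a + d ∈ D.J →
      D.coef (a + d) (f (D.vec (a + d))) = D.coef a (f (D.vec a)) := fun a ha d => by
    induction d with
    | zero => intro _; rw [Nat.cast_zero, add_zero]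
    | succ d ih =>
      intro hd
      have h1 : a + d ∈ D.J := hD.ordConnected.out ha hd ⟨by omega, by push_cast; omega⟩
      rw [Nat.cast_succ, ← add_assoc] at hd ⊢
      rw [← hstep _ h1 hd, ih h1]
  have hall : ∀ n ∈ D.J, D.coef n (f (D.vec n)) = D.coef i (f (D.vec i)) := fun n hn => by
    rcases le_total i n with h | h
    · obtain ⟨d, rfl⟩ : ∃ d : ℕ, n = i + d := ⟨(n - i).toNat, by omega⟩
      exact hup i hi d hn
    · obtain ⟨d, rfl⟩ : ∃ d : ℕ, i = n + d := ⟨(i - n).toNat, by omega⟩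
      exact (hup n hn d hi).symm
  have : f.restrictScalars ℂ = D.coef i (f (D.vec i)) • LinearMap.id :=
    D.hom_ext fun n hn => by
      rw [LinearMap.restrictScalars_apply, LinearMap.smul_apply, LinearMap.id_apply, hv n,
        hall n hn]
  exact LinearMap.congr_fun this v

end Chain

/-- Every nonzero object has a string module as a direct summand. -/
theorem WMod.exists_string_summand {t : ℂ[X]} (ht : t ≠ 0) (M : WMod t) [Nontrivial M] :
    ∃ D : Chain t, D.IsString ∧ ∃ (g : D.lin →ₗ[A t] M) (f : M →ₗ[A t] D.lin),
      f ∘ₗ g = LinearMap.id := by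
  obtain ⟨i, v, hv, hv0⟩ := M.exists_weight_ne_zero
  obtain ⟨B, hB⟩ := exists_root_bound ht
  -- The left half is chosen with the whole weight space as `W` and with `W₀ = ⊥`. As `U` lies in
  -- that weight space, this forces `U = ⊥`, so every functional extends to the left.
  obtain ⟨K, p', q', hl, U, hU, hWU, ⟨y, hy, hy0, hyY⟩, hG⟩ :=
    exists_half_string (B + i.natAbs + 1) (M.ladder_left i) (fun d hd => hB _ (by omega))
      (W₀ := ⊥) (W := weightSpace M (i : ℂ)) (by simp)
      (fun h => hv0 ((Submodule.mem_bot ℂ).1 (h hv)))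
  -- The vectors that extend along the left half just found. Looking for the right half inside this
  -- subspace yields a vector that extends on both sides.
  let W : Submodule ℂ M :=
    { carrier := {y | y ∈ weightSpace M (i : ℂ) ∧
        ∃ Y, HalfPath (toLin M.opM) (toLin M.opP) (fun d => weightSpace M ((i - d : ℤ) : ℂ))
          K p' q' Y ∧ Y 0 = y}
      zero_mem' := ⟨zero_mem _, 0, ⟨fun _ => zero_mem _, fun _ _ => rfl,
        fun _ => (map_zero _).trans (smul_zero _).symm,
        fun _ => (map_zero _).trans (smul_zero _).symm⟩, rfl⟩
      add_mem' := by
        rintro _ _ ⟨ha, Y, hY, rfl⟩ ⟨hb, Z, hZ, rfl⟩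
        refine ⟨add_mem ha hb, Y + Z, ⟨fun d => add_mem (hY.mem d) (hZ.mem d), fun d hd => ?_,
          fun d => ?_, fun d => ?_⟩, rfl⟩
        · rw [Pi.add_apply, hY.out d hd, hZ.out d hd, add_zero]
        · rw [Pi.add_apply, Pi.add_apply, map_add, hY.P_eq, hZ.P_eq, smul_add]
        · rw [Pi.add_apply, Pi.add_apply, map_add, hY.Q_eq, hZ.Q_eq, smul_add]
      smul_mem' := by
        rintro c _ ⟨ha, Y, hY, rfl⟩
        refine ⟨Submodule.smul_mem _ c ha, c • Y, ⟨fun d => Submodule.smul_mem _ c (hY.mem d),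
          fun d hd => ?_, fun d => ?_, fun d => ?_⟩, rfl⟩
        · rw [Pi.smul_apply, hY.out d hd, smul_zero]
        · rw [Pi.smul_apply, Pi.smul_apply, map_smul, hY.P_eq, smul_comm]
        · rw [Pi.smul_apply, Pi.smul_apply, map_smul, hY.Q_eq, smul_comm] }
  obtain ⟨J, p, q, hr, U', hU', hWU', ⟨x, ⟨hx, Y, hY, hY0⟩, hx0, X, hX, hX0⟩, hF⟩ :=
    exists_half_string (B + i.natAbs + 1) (M.ladder_right i) (fun d hd => hB _ (by omega))
      (W₀ := ⊥) (W := W) (fun x hx => by simpa using hx.1)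
      (fun h => hy0 (h ⟨hy, hyY⟩))
  have hxU : x ∉ U' := fun h => hx0 (hWU' ⟨⟨hx, Y, hY, hY0⟩, h⟩)
  -- A functional that is nonzero at `x` and vanishes on `U'` extends to the right by the choice of
  -- `U'`, and to the left without any condition.
  obtain ⟨f, hfx, hfU⟩ := Submodule.exists_le_ker_of_notMem hxU
  obtain ⟨F, hF, hF0⟩ := hF f fun u hu => hfU hu
  obtain ⟨G, hG, hG0⟩ := hG f fun u hu => by
    have : u = 0 := (Submodule.mem_bot ℂ).1 (hWU ⟨by simpa using hU hu, hu⟩)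
    rw [this, map_zero]
  let D := glueChain hr hl
  have hD : D.IsString := glueChain_isString hr hl
  let g : D.lin →ₗ[A t] M := glueFrom hr hl hX hY (hX0.trans hY0.symm)
  let h : M →ₗ[A t] D.lin := glueTo hr hl hF hG (hF0.trans hG0.symm)
  have hi : i ∈ D.J := by
    have := (mem_glueSet_right (i := i) (K := K)).2 hr.zero_mem
    rwa [Nat.cast_zero, add_zero] at this
  have hg : g (D.vec i) = x := by
    refine (D.homFrom_vec i).trans ?_
    have := glue_right i X (fun d => Y (d + 1)) 0
    rw [Nat.cast_zero, add_zero] at this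
    rw [this, hX0]
  have hh : h x = f x • D.vec i := by
    refine (D.homTo_of_mem hx).trans ?_
    have := glue_right i F (fun d => G (d + 1)) 0
    rw [Nat.cast_zero, add_zero] at this
    rw [this, hF0]
  -- The composite is an endomorphism of a string, hence a scalar, and its value at the vertex `i`
  -- is `f x`, which is nonzero.
  refine ⟨D, hD, g, (f x)⁻¹ • h, LinearMap.ext fun v => ?_⟩
  have := hD.endo (h ∘ₗ g) hi v
  rw [LinearMap.comp_apply, LinearMap.comp_apply, hg, hh, map_smul, D.coef_vec_self hi,
    smul_eq_mul, mul_one] at this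
  rw [LinearMap.comp_apply, LinearMap.smul_apply, this, smul_smul, inv_mul_cancel₀ hfx, one_smul]
  rfl

/-! ### Complements of summands, and generation by strings -/

namespace WMod

variable {t : ℂ[X]} {M N : WMod t}

/-- The image of an idempotent endomorphism. -/
def ofIdempotent (K : Submodule (A t) M) (e : M →ₗ[A t] M) (he : ∀ v, e v ∈ K)
    (heK : ∀ v ∈ K, e v = v) : WMod t :=
  letI : Module ℂ[X] K := Module.compHom K (A.ofPoly t).toRingHom
  have hsmul : ∀ (r : ℂ[X]) (v : K), ((r • v : K) : M) = r • (v : M) := fun r v =>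
    M.ofPoly_smul r v
  haveI : IsScalarTower ℂ ℂ[X] K := ⟨fun c r v => Subtype.ext (by
    rw [hsmul, smul_assoc, ← hsmul]; rfl)⟩
  have hmem : ∀ (l : ℂ) (v : K), v ∈ weightSpace K l ↔ (v : M) ∈ weightSpace M l :=
    fun l v => by
      rw [mem_weightSpace, mem_weightSpace, ← hsmul]
      exact Subtype.ext_iff
  { carrier := K
    ofPoly_smul := fun _ _ => rfl
    isInternal := isInternal_of_iSup (by
      -- The idempotent preserves weights, so applying it to a decomposition into weight vectors of
      -- `M` gives one inside the submodule.
      have key : ∀ v : M, (⟨e v, he v⟩ : K) ∈ ⨆ l, weightSpace K l := fun v => by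
        induction v using M.weight_induction with
        | h l m hm =>
          exact Submodule.mem_iSup_of_mem l ((hmem l _).2 (hom_mem_weightSpace e hm))
        | ha a b h1 h2 =>
          have : (⟨e (a + b), he _⟩ : K) = ⟨e a, he a⟩ + ⟨e b, he b⟩ := Subtype.ext (map_add e a b)
          rw [this]
          exact add_mem h1 h2
      refine eq_top_iff.2 fun v _ => ?_
      have := key v
      have h : (⟨e v, he v⟩ : K) = v := Subtype.ext (heK v v.2)
      rwa [h] at this)
    finite := fun l => by
      have := M.finite l
      let f : weightSpace K l →ₗ[ℂ] weightSpace M l :=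
        { toFun v := ⟨v.1.1, (hmem l v.1).1 v.2⟩
          map_add' _ _ := rfl
          map_smul' _ _ := rfl }
      exact FiniteDimensional.of_injective f fun v w h =>
        Subtype.ext (Subtype.ext (congrArg (fun x : weightSpace M l => (x : M)) h))
    support := fun l h => M.support l fun h0 => h ((Submodule.eq_bot_iff _).2 fun v hv =>
      Subtype.ext ((Submodule.mem_bot ℂ).1 (h0 ▸ (hmem l v).1 hv))) }

section Summand

variable {g : N →ₗ[A t] M} {f : M →ₗ[A t] N} (hfg : f ∘ₗ g = LinearMap.id)

lemma summand_apply {g : N →ₗ[A t] M} {f : M →ₗ[A t] N} (hfg : f ∘ₗ g = LinearMap.id) (v : N) :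
    f (g v) = v := LinearMap.congr_fun hfg v

/-- The complement of a direct summand. -/
def complement : WMod t :=
  ofIdempotent (LinearMap.ker f) (LinearMap.id - g ∘ₗ f)
    (fun v => by
      rw [LinearMap.mem_ker, LinearMap.sub_apply, LinearMap.id_apply, LinearMap.comp_apply, map_sub,
        summand_apply hfg, sub_self])
    (fun v hv => by
      rw [LinearMap.sub_apply, LinearMap.id_apply, LinearMap.comp_apply, LinearMap.mem_ker.1 hv,
        map_zero, sub_zero])

/-- The inclusion of the complement of a direct summand. -/
def complementIncl : complement hfg →ₗ[A t] M := (LinearMap.ker f).subtype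

lemma complementIncl_injective : Function.Injective (complementIncl hfg) :=
  Subtype.val_injective

lemma apply_complementIncl (v : complement hfg) : f (complementIncl hfg v) = 0 :=
  LinearMap.mem_ker.1 (Subtype.prop (p := fun v => v ∈ LinearMap.ker f) v)

/-- The decomposition into a direct summand and its complement. -/
def complementIso : M ≃ₗ[A t] N × complement hfg :=
  .symm <| LinearEquiv.ofBijective (g.coprod (complementIncl hfg)) (by
    constructor
    · rw [← LinearMap.ker_eq_bot, LinearMap.ker_eq_bot']
      rintro ⟨a, b⟩ h
      rw [LinearMap.coprod_apply] at h
      have h1 := congrArg f h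
      rw [map_add, summand_apply hfg, apply_complementIncl, add_zero, map_zero] at h1
      have h1 : a = 0 := h1
      subst h1
      rw [map_zero, zero_add] at h
      have h2 : b = 0 := complementIncl_injective hfg (h.trans (map_zero _).symm)
      rw [h2]; rfl
    · intro v
      have hv : v - g (f v) ∈ LinearMap.ker f := by
        rw [LinearMap.mem_ker, map_sub, summand_apply hfg, sub_self]
      refine ⟨(f v, (⟨v - g (f v), hv⟩ : LinearMap.ker f)), ?_⟩
      rw [LinearMap.coprod_apply]
      exact add_sub_cancel _ _)

end Summand

/-- The dimension of the part of `M` with weights between `-B` and `B`. -/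
def size (B : ℕ) (M : WMod t) : ℕ :=
  ∑ n ∈ Finset.Icc (-(B : ℤ)) B, Module.finrank ℂ (weightSpace M (n : ℂ))

/-- Beyond the roots, `X⁺` and `X⁻` are injective on weight spaces, since a composite is a nonzero
scalar. A nonzero weight vector can therefore be moved towards weight 0 until it enters the window.
In consequence every nonzero object has positive `size B`. -/
lemma exists_weight_le (M : WMod t) [Nontrivial M] {B : ℕ}
    (hB : ∀ n : ℤ, B ≤ n.natAbs → t.eval ((n : ℂ) + 1 / 2) ≠ 0) :
    ∃ n ∈ Finset.Icc (-(B : ℤ)) B, ∃ v ∈ weightSpace M (n : ℂ), v ≠ 0 := by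
  have key : ∀ k : ℕ, ∀ n : ℤ, n.natAbs ≤ B + k → ∀ v ∈ weightSpace M (n : ℂ), v ≠ 0 →
      ∃ n ∈ Finset.Icc (-(B : ℤ)) B, ∃ v ∈ weightSpace M (n : ℂ), v ≠ 0 := by
    intro k
    induction k with
    | zero => exact fun n hn v hv h0 => ⟨n, Finset.mem_Icc.2 (by omega), v, hv, h0⟩
    | succ k ih =>
      intro n hn v hv h0
      by_cases h : n.natAbs ≤ B + k
      · exact ih n h v hv h0
      rcases le_or_gt 0 n with hn0 | hn0
      · obtain ⟨n, rfl⟩ : ∃ m, n = m + 1 := ⟨n - 1, by ring⟩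
        refine ih n (by omega) _ (M.opM_mem_int hv) fun h1 => ?_
        have h2 := M.opP_opM_of_mem hv
        rw [h1, map_zero] at h2
        exact h0 ((smul_eq_zero.1 h2.symm).resolve_left (hB n (by omega)))
      · refine ih (n + 1) (by omega) _ (M.opP_mem_int hv) fun h1 => ?_
        have h2 := M.opM_opP_of_mem hv
        rw [h1, map_zero] at h2
        exact h0 ((smul_eq_zero.1 h2.symm).resolve_left (hB n (by omega)))
  obtain ⟨n, v, hv, h0⟩ := M.exists_weight_ne_zero
  exact key n.natAbs n (by omega) v hv h0

/-- The complement embeds in `M`, and in a weight of the window where `N` is nonzero it misses the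
image of `N`, because `f` kills the complement and inverts `g` on that image. -/
lemma size_complement_lt {g : N →ₗ[A t] M} {f : M →ₗ[A t] N} (hfg : f ∘ₗ g = LinearMap.id)
    [Nontrivial N] {B : ℕ} (hB : ∀ n : ℤ, B ≤ n.natAbs → t.eval ((n : ℂ) + 1 / 2) ≠ 0) :
    (complement hfg).size B < M.size B := by
  have hle : ∀ l : ℂ, (weightSpace (complement hfg) l).map
      ((complementIncl hfg).restrictScalars ℂ) ≤ weightSpace M l := by
    rintro l _ ⟨v, hv, rfl⟩
    exact hom_mem_weightSpace (complementIncl hfg) hv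
  have hrank : ∀ l : ℂ, Module.finrank ℂ (weightSpace (complement hfg) l) = Module.finrank ℂ
      ((weightSpace (complement hfg) l).map ((complementIncl hfg).restrictScalars ℂ)) := fun l =>
    (Submodule.equivMapOfInjective ((complementIncl hfg).restrictScalars ℂ)
      (complementIncl_injective hfg) _).finrank_eq
  obtain ⟨n, hn, v, hv, h0⟩ := N.exists_weight_le hB
  refine Finset.sum_lt_sum (fun m _ => ?_) ⟨n, hn, ?_⟩
  · have := M.finite m
    rw [hrank]
    exact Submodule.finrank_mono (hle m)
  · have := M.finite n
    rw [hrank]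
    refine Submodule.finrank_lt_finrank_of_lt (lt_of_le_of_ne (hle n) fun h => h0 ?_)
    have hgv : g v ∈ weightSpace M (n : ℂ) := hom_mem_weightSpace g hv
    rw [← h] at hgv
    obtain ⟨w, -, hw⟩ := hgv
    rw [← summand_apply hfg v, ← hw]
    exact apply_complementIncl hfg w

end WMod

lemma Chain.IsString.nontrivial {t : ℂ[X]} {D : Chain t} (hD : D.IsString) : Nontrivial D.lin := by
  obtain ⟨n, hn⟩ := hD.nonempty
  exact ⟨⟨D.vec n, 0, D.vec_ne_zero hn⟩⟩

/-- The classes of the string modules generate the split Grothendieck group. -/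
theorem K0split.mk_mem_closure {t : ℂ[X]} (ht : t ≠ 0) (M : WMod t) :
    K0split.mk M ∈ AddSubgroup.closure
      {x : K0split t | ∃ D : Chain t, D.IsString ∧ K0split.mk D.lin = x} := by
  obtain ⟨B, hB⟩ := exists_root_bound ht
  induction h : M.size B using Nat.strong_induction_on generalizing M with
  | h k ih =>
    rcases subsingleton_or_nontrivial M with hM | hM
    -- For the zero object `M ≅ M ⊕ M`, so its class is zero.
    · have e : M ≃ₗ[A t] M × M := LinearEquiv.ofSubsingleton M (M × M)
      have := K0split.mk_eq_add e
      rw [left_eq_add.1 this]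
      exact zero_mem _
    · obtain ⟨D, hD, g, f, hfg⟩ := M.exists_string_summand ht
      have := hD.nontrivial
      rw [K0split.mk_eq_add (WMod.complementIso hfg)]
      exact add_mem (AddSubgroup.subset_closure ⟨D, hD, rfl⟩)
        (ih _ (h ▸ WMod.size_complement_lt hfg hB) _ rfl)

/-- Indecomposable objects are string modules. -/
theorem WMod.Indecomposable.exists_string {t : ℂ[X]} (ht : t ≠ 0) {M : WMod t}
    (hM : M.Indecomposable) : ∃ D : Chain t, D.IsString ∧ Nonempty (M ≃ₗ[A t] D.lin) := by
  have := hM.1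
  obtain ⟨D, hD, g, f, hfg⟩ := M.exists_string_summand ht
  have hsurj : Function.Surjective f := fun v => ⟨g v, WMod.summand_apply hfg v⟩
  have hc : IsCompl (LinearMap.range g) (LinearMap.ker f) := by
    constructor
    · rw [Submodule.disjoint_def]
      rintro _ ⟨v, rfl⟩ hv
      rw [LinearMap.mem_ker, WMod.summand_apply hfg] at hv
      rw [hv, map_zero]
    · rw [codisjoint_iff, eq_top_iff]
      intro v _
      refine Submodule.mem_sup.2 ⟨g (f v), ⟨f v, rfl⟩, v - g (f v), ?_, add_sub_cancel _ _⟩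
      rw [LinearMap.mem_ker, map_sub, WMod.summand_apply hfg, sub_self]
  refine ⟨D, hD, ⟨LinearEquiv.ofBijective f ⟨?_, hsurj⟩⟩⟩
  rcases hM.2 _ _ hc with h | h
  · obtain ⟨n, hn⟩ := hD.nonempty
    have h1 : g (D.vec n) = 0 := by
      have : g (D.vec n) ∈ LinearMap.range g := ⟨D.vec n, rfl⟩
      rwa [h, Submodule.mem_bot] at this
    have h2 := WMod.summand_apply hfg (D.vec n)
    rw [h1, map_zero] at h2
    exact absurd h2.symm (D.vec_ne_zero hn)
  · exact LinearMap.ker_eq_bot.1 h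

/-- String modules are indecomposable. -/
theorem Chain.IsString.indecomposable {t : ℂ[X]} {D : Chain t} (hD : D.IsString) :
    D.lin.Indecomposable := by
  refine ⟨hD.nontrivial, fun P Q h => ?_⟩
  obtain ⟨i, hi⟩ := hD.nonempty
  -- The projection to `P` along `Q` is a scalar `c`. It is the identity on `P` and zero on `Q`, so
  -- `P = ⊥` if `c = 0` and `Q = ⊥` otherwise.
  have he := hD.endo (P.subtype ∘ₗ P.projectionOnto Q h) hi
  generalize D.coef i _ = c at he
  by_cases hc : c = 0
  · refine Or.inl ((Submodule.eq_bot_iff _).2 fun v hv => ?_)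
    have := he v
    have h' := Submodule.projectionOnto_apply_left h ⟨v, hv⟩
    rw [LinearMap.comp_apply, h', hc,
      zero_smul] at this
    exact this
  · refine Or.inr ((Submodule.eq_bot_iff _).2 fun v hv => ?_)
    have := he v
    have h' := Submodule.projectionOnto_apply_right h ⟨v, hv⟩
    rw [LinearMap.comp_apply, h', map_zero] at this
    exact (smul_eq_zero.1 this.symm).resolve_left hc

/-! ### Multiplicities of string modules -/

lemma finrank_range_prodMap {V W V' W' : Type*} [AddCommGroup V] [AddCommGroup W] [AddCommGroup V']
    [AddCommGroup W'] [Module ℂ V] [Module ℂ W] [Module ℂ V'] [Module ℂ W'] (f : V →ₗ[ℂ] V')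
    (g : W →ₗ[ℂ] W') [FiniteDimensional ℂ (LinearMap.range f)]
    [FiniteDimensional ℂ (LinearMap.range g)] :
    Module.finrank ℂ (LinearMap.range (f.prodMap g)) =
      Module.finrank ℂ (LinearMap.range f) + Module.finrank ℂ (LinearMap.range g) := by
  have h : LinearMap.range (f.prodMap g) =
      LinearMap.range ((LinearMap.range f).subtype.prodMap (LinearMap.range g).subtype) := by
    rw [LinearMap.range_prodMap, LinearMap.range_prodMap, Submodule.range_subtype,
      Submodule.range_subtype]
  rw [h, LinearMap.finrank_range_of_inj, Module.finrank_prod]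
  exact Prod.map_injective.2 ⟨Subtype.val_injective, Subtype.val_injective⟩

namespace Chain

variable {t : ℂ[X]} (D : Chain t) (i : ℤ)

/-- The pairing of `Hom(lin D, M)` and `Hom(M, lin D)` at the vertex `i`. -/
def pairing (M : WMod t) : (D.lin →ₗ[A t] M) →ₗ[ℂ] Module.Dual ℂ (M →ₗ[A t] D.lin) :=
  LinearMap.mk₂ ℂ (fun g f => D.coef i (f (g (D.vec i))))
    (fun g g' f => by rw [LinearMap.add_apply, map_add, map_add])
    (fun c g f => by rw [LinearMap.smul_apply, WMod.hom_smul, map_smul])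
    (fun g f f' => by rw [LinearMap.add_apply, map_add])
    (fun c g f => by rw [LinearMap.smul_apply, map_smul])

lemma pairing_apply {M : WMod t} (g : D.lin →ₗ[A t] M) (f : M →ₗ[A t] D.lin) :
    D.pairing i M g f = D.coef i (f (g (D.vec i))) := rfl

/-- The Hom spaces may be infinite-dimensional, but the pairing depends on `g` only through
`g(v_i)`, a vector of the finite-dimensional weight space of weight `i`. -/
instance (M : WMod t) : FiniteDimensional ℂ (LinearMap.range (D.pairing i M)) := by
  have := M.finite i
  let ev : weightSpace M (i : ℂ) →ₗ[ℂ] Module.Dual ℂ (M →ₗ[A t] D.lin) :=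
    LinearMap.mk₂ ℂ (fun m f => D.coef i (f m.1))
      (fun g g' f => by rw [Submodule.coe_add, map_add, map_add])
      (fun c g f => by rw [Submodule.coe_smul, WMod.hom_smul, map_smul])
      (fun g f f' => by rw [LinearMap.add_apply, map_add])
      (fun c g f => by rw [LinearMap.smul_apply, map_smul])
  refine Submodule.finiteDimensional_of_le (S₂ := LinearMap.range ev) ?_
  rintro _ ⟨g, rfl⟩
  exact ⟨⟨g (D.vec i), WMod.hom_mem_weightSpace g (D.vec_mem i)⟩, rfl⟩

/-- The multiplicity of `lin D` as a direct summand of `M`. -/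
def mult (M : WMod t) : ℕ := Module.finrank ℂ (LinearMap.range (D.pairing i M))

/-- Under the identifications of both Hom spaces with those of the two summands, the pairing for `P`
becomes block diagonal. Precomposing with the surjection `Φ` and postcomposing with the injection
`Ψ` does not change the rank. -/
lemma mult_eq_add {M N P : WMod t} (e : P ≃ₗ[A t] M × N) :
    D.mult i P = D.mult i M + D.mult i N := by
  let Φ : (D.lin →ₗ[A t] M) × (D.lin →ₗ[A t] N) →ₗ[ℂ] (D.lin →ₗ[A t] P) :=
    { toFun g := e.symm.toLinearMap ∘ₗ g.1.prod g.2
      map_add' g g' := by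
        ext v
        exact map_add e.symm (g.1 v, g.2 v) (g'.1 v, g'.2 v)
      map_smul' c g := by
        ext v
        exact e.symm.toLinearMap.map_smul_of_tower c (g.1 v, g.2 v) }
  let Ψ : Module.Dual ℂ (P →ₗ[A t] D.lin) →ₗ[ℂ]
      Module.Dual ℂ (M →ₗ[A t] D.lin) × Module.Dual ℂ (N →ₗ[A t] D.lin) :=
    { toFun ξ :=
        ({ toFun f := ξ (f ∘ₗ LinearMap.fst _ _ _ ∘ₗ e.toLinearMap)
           map_add' f f' := by rw [LinearMap.add_comp, map_add]
           map_smul' c f := by rw [LinearMap.smul_comp, map_smul]; rfl },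
         { toFun f := ξ (f ∘ₗ LinearMap.snd _ _ _ ∘ₗ e.toLinearMap)
           map_add' f f' := by rw [LinearMap.add_comp, map_add]
           map_smul' c f := by rw [LinearMap.smul_comp, map_smul]; rfl })
      map_add' _ _ := rfl
      map_smul' _ _ := rfl }
  have hΦ : Function.Surjective Φ := fun g =>
    ⟨(LinearMap.fst _ _ _ ∘ₗ e.toLinearMap ∘ₗ g, LinearMap.snd _ _ _ ∘ₗ e.toLinearMap ∘ₗ g), by
      ext v
      exact e.symm_apply_apply (g v)⟩
  have hΨ : Function.Injective Ψ := by
    rw [← LinearMap.ker_eq_bot, LinearMap.ker_eq_bot']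
    intro ξ hξ
    ext f
    have h1 := LinearMap.congr_fun (congrArg Prod.fst hξ)
      (f ∘ₗ e.symm.toLinearMap ∘ₗ LinearMap.inl _ _ _)
    have h2 := LinearMap.congr_fun (congrArg Prod.snd hξ)
      (f ∘ₗ e.symm.toLinearMap ∘ₗ LinearMap.inr _ _ _)
    have h3 : f = (f ∘ₗ e.symm.toLinearMap ∘ₗ LinearMap.inl _ _ _) ∘ₗ
        LinearMap.fst _ _ _ ∘ₗ e.toLinearMap + (f ∘ₗ e.symm.toLinearMap ∘ₗ LinearMap.inr _ _ _) ∘ₗ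
        LinearMap.snd _ _ _ ∘ₗ e.toLinearMap := by
      ext v
      simp only [LinearMap.add_apply, LinearMap.comp_apply, LinearMap.fst_apply,
        LinearMap.snd_apply, LinearMap.inl_apply, LinearMap.inr_apply, LinearEquiv.coe_coe]
      rw [← map_add, ← map_add, Prod.mk_add_mk, add_zero, zero_add, Prod.mk.eta,
        e.symm_apply_apply]
    have h4 := congrArg ξ h3
    rw [map_add] at h4
    rw [h4]
    exact (congrArg₂ (· + ·) h1 h2).trans (add_zero _)
  have hcomp : Ψ ∘ₗ D.pairing i P ∘ₗ Φ = (D.pairing i M).prodMap (D.pairing i N) := by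
    refine LinearMap.ext fun g => Prod.ext (LinearMap.ext fun f => ?_) (LinearMap.ext fun f => ?_)
    · change D.coef i (f (e (e.symm (g.1 _, g.2 _))).1) = D.coef i (f (g.1 _))
      rw [e.apply_symm_apply]
    · change D.coef i (f (e (e.symm (g.1 _, g.2 _))).2) = D.coef i (f (g.2 _))
      rw [e.apply_symm_apply]
  rw [mult, mult, mult, ← finrank_range_prodMap, ← hcomp, LinearMap.range_comp,
    LinearMap.range_comp_of_range_eq_top _ (LinearMap.range_eq_top.2 hΦ)]
  exact (Submodule.equivMapOfInjective Ψ hΨ _).finrank_eq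

variable {D i}

/-- Every endomorphism is a multiple of the identity, and the identity pairs with itself to 1, so
the range is a line. -/
lemma IsString.mult_self (hD : D.IsString) (hi : i ∈ D.J) : D.mult i D.lin = 1 := by
  have hid : D.pairing i D.lin LinearMap.id LinearMap.id = 1 := D.coef_vec_self hi
  have h : LinearMap.range (D.pairing i D.lin) = ℂ ∙ D.pairing i D.lin LinearMap.id := by
    refine le_antisymm ?_ ((Submodule.span_singleton_le_iff_mem _ _).2 ⟨_, rfl⟩)
    rintro _ ⟨g, rfl⟩
    refine Submodule.mem_span_singleton.2 ⟨D.coef i (g (D.vec i)), ?_⟩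
    rw [← map_smul]
    congr 1
    ext v
    exact (hD.endo g hi v).symm
  rw [mult, h, finrank_span_singleton]
  intro h0
  rw [h0] at hid
  exact zero_ne_one hid

/-- If the pairing were nonzero at `g`, `f`, then `f ∘ g` would be a nonzero scalar. The composite
`g ∘ f` is a scalar too, necessarily the same one, so `g` would be an isomorphism. -/
lemma IsString.mult_eq_zero (hD : D.IsString) (hi : i ∈ D.J) {D' : Chain t} (hD' : D'.IsString)
    (h : IsEmpty (D.lin ≃ₗ[A t] D'.lin)) : D.mult i D'.lin = 0 := by
  have h0 : D.pairing i D'.lin = 0 := by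
    ext g f
    rw [LinearMap.zero_apply, LinearMap.zero_apply]
    by_contra hc
    obtain ⟨j, hj⟩ := hD'.nonempty
    have h1 := hD.endo (f ∘ₗ g) hi
    have h2 := hD'.endo (g ∘ₗ f) hj
    rw [LinearMap.comp_apply, ← pairing_apply] at h1
    generalize D.pairing i D'.lin g f = c at hc h1
    generalize D'.coef j _ = c' at h2
    simp only [LinearMap.comp_apply] at h1 h2
    have h3 : c' = c := by
      have h3 := h1 (f (g (D.vec i)))
      rw [h2, WMod.hom_smul, h1, smul_smul, smul_smul] at h3
      have h4 := congrArg (D.coef i) h3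
      rw [map_smul, map_smul, D.coef_vec_self hi, smul_eq_mul, smul_eq_mul, mul_one, mul_one] at h4
      exact mul_right_cancel₀ hc h4
    subst h3
    refine h.false (LinearEquiv.ofLinearMap g (c'⁻¹ • f) ?_ ?_)
    · ext v
      rw [LinearMap.comp_apply, LinearMap.smul_apply, WMod.hom_smul, h2, smul_smul,
        inv_mul_cancel₀ hc, one_smul]; rfl
    · ext v
      rw [LinearMap.comp_apply, LinearMap.smul_apply, h1, smul_smul,
        inv_mul_cancel₀ hc, one_smul]; rfl
  rw [mult, h0, LinearMap.range_zero, finrank_bot]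

end Chain

/-- The multiplicity of `lin D`, as a function on the split Grothendieck group. -/
def K0split.multHom {t : ℂ[X]} (D : Chain t) (i : ℤ) : K0split t →+ ℂ :=
  K0split.lift (fun M => (D.mult i M : ℂ)) fun _ _ _ e => by rw [D.mult_eq_add i e, Nat.cast_add]

lemma K0split.multHom_mk {t : ℂ[X]} (D : Chain t) (i : ℤ) (M : WMod t) :
    K0split.multHom D i (K0split.mk M) = D.mult i M := K0split.lift_mk _ _ _

namespace SplitAlg

variable {Γ : Submonoid ℂ[X]}

open Classical in
/-- The multiplicity of a string module, as a functional on the algebra. -/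
def multL (t : Γ) (D : Chain (t : ℂ[X])) (i : ℤ) : SplitAlg Γ →ₗ[ℂ] ℂ :=
  lift (Pi.single t (LinearMap.liftBaseChange ℂ (K0split.multHom D i).toIntLinearMap))

lemma multL_cls (t : Γ) (D : Chain (t : ℂ[X])) (i : ℤ) (M : WMod (t : ℂ[X])) :
    multL t D i (cls t M) = D.mult i M := by
  rw [multL, cls, lift_of, Pi.single_eq_same, LinearMap.liftBaseChange_tmul, one_smul]
  exact K0split.multHom_mk D i M

lemma multL_cls_of_ne {t t' : Γ} (h : t' ≠ t) (D : Chain (t : ℂ[X])) (i : ℤ)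
    (M : WMod (t' : ℂ[X])) : multL t D i (cls t' M) = 0 := by
  rw [multL, cls, lift_of, Pi.single_eq_of_ne h, LinearMap.zero_apply]

end SplitAlg

/-! ### Normal forms in the presented algebra -/

/-- The four kinds of generators. -/
inductive Kind | xp | xm | yp | ym

/-- The generator of a given kind. -/
def Kind.gen {Z : Set ℝ} : Kind → Z → SplitGen Z
  | .xp, k => .xp k
  | .xm, k => .xm k
  | .yp, k => .yp k
  | .ym, k => .ym k

lemma SplitGen.exists_kind {Z : Set ℝ} (g : SplitGen Z) : ∃ (κ : Kind) (k : Z), κ.gen k = g :=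
  match g with
  | .xp k => ⟨.xp, k, rfl⟩
  | .xm k => ⟨.xm, k, rfl⟩
  | .yp k => ⟨.yp, k, rfl⟩
  | .ym k => ⟨.ym, k, rfl⟩

/-- The factor `a` survives each replacement and can be used again for the next one. In this way one
new `x_k^±` rewrites all the letters on its side of a word. -/
lemma Multiset.mul_prod_map_congr {R ι : Type*} [CommMonoid R] {m : Multiset ι} {f g : ι → R}
    {a : R}
    (h : ∀ i ∈ m, a * f i = a * g i) : a * (m.map f).prod = a * (m.map g).prod := by
  induction m using Multiset.induction_on with
  | empty => rfl
  | cons i m ih =>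
    rw [Multiset.map_cons, Multiset.map_cons, Multiset.prod_cons, Multiset.prod_cons, ← mul_assoc,
      h i (Multiset.mem_cons_self i m), mul_right_comm,
      ih fun j hj => h j (Multiset.mem_cons_of_mem hj)]
    exact (mul_right_comm _ _ _).trans (mul_assoc _ _ _)

variable {Z : Set ℝ}

/-- The image of a generator in the presented algebra. -/
def pgen (κ : Kind) (k : Z) : Presented Z :=
  Ideal.Quotient.mk (relIdeal Z) (MvPolynomial.X (κ.gen k))

lemma mk_eq_of_rel {f g : MvPolynomial (SplitGen Z) ℂ} (h : SplitRel (f - g)) :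
    Ideal.Quotient.mk (relIdeal Z) f = Ideal.Quotient.mk (relIdeal Z) g :=
  Ideal.Quotient.eq.2 (Ideal.subset_span h)

/-- In the presence of `x_k⁺`, the letters at `j ≤ k` other than `x_j⁻` become indistinguishable. -/
lemma pgen_xp_mul {κ : Kind} (hκ : κ ≠ .xm) {j k : Z} (h : j ≤ k) :
    pgen .xp k * pgen κ j = pgen .xp k * pgen .xp j := by
  rw [mul_comm, mul_comm (pgen .xp k)]
  match κ with
  | .xp => rfl
  | .yp => exact (map_mul _ _ _).symm.trans ((mk_eq_of_rel (.yp_xp j k h)).trans (map_mul _ _ _))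
  | .ym => exact (map_mul _ _ _).symm.trans ((mk_eq_of_rel (.ym_xp j k h)).trans (map_mul _ _ _))

lemma pgen_xm_mul {κ : Kind} (hκ : κ ≠ .xp) {j k : Z} (h : j ≤ k) :
    pgen .xm j * pgen κ k = pgen .xm j * pgen .xm k := by
  match κ with
  | .xm => rfl
  | .yp => exact (map_mul _ _ _).symm.trans ((mk_eq_of_rel (.xm_yp j k h)).trans (map_mul _ _ _))
  | .ym => exact (map_mul _ _ _).symm.trans ((mk_eq_of_rel (.xm_ym j k h)).trans (map_mul _ _ _))

lemma pgen_xm_mul_xp {j k : Z} (h : j ≤ k) : pgen .xm j * pgen .xp k = 0 :=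
  (map_mul _ _ _).symm.trans (Ideal.Quotient.eq_zero_iff_mem.2 (Ideal.subset_span (.xm_xp j k h)))

lemma pgen_yp_mul_ym (k : Z) : pgen .yp k * pgen .ym k =
    pgen .xp k * pgen .xp k + pgen .xm k * pgen .xm k := by
  rw [← pow_two, ← pow_two]
  refine (map_mul _ _ _).symm.trans ((mk_eq_of_rel (.yp_ym k)).trans ?_)
  rw [map_add, map_pow, map_pow]
  rfl

/-- The condition on a word in the generators to be in normal form. -/
structure Admissible (m : Multiset Z) (s : Z → Kind) : Prop where
  up : ∀ j ∈ m, s j = .xp → ∀ i ∈ m, i ≤ j → s i = .xp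
  down : ∀ j ∈ m, s j = .xm → ∀ i ∈ m, j ≤ i → s i = .xm

/-- The product of the generators of kind `s_k` for `k ∈ m`. -/
def normal (m : Multiset Z) (s : Z → Kind) : Presented Z := (m.map fun k => pgen (s k) k).prod

/-- The span of the normal words. -/
def normalSpan (Z : Set ℝ) : Submodule ℂ (Presented Z) :=
  Submodule.span ℂ {x | ∃ m s, Admissible m s ∧ normal m s = x}

lemma normal_mem {m : Multiset Z} {s : Z → Kind} (h : Admissible m s) :
    normal m s ∈ normalSpan Z := Submodule.subset_span ⟨m, s, h, rfl⟩

lemma mul_mem_normalSpan_of {a : Presented Z}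
    (h : ∀ m s, Admissible m s → a * normal m s ∈ normalSpan Z) {x : Presented Z}
    (hx : x ∈ normalSpan Z) : a * x ∈ normalSpan Z := by
  induction hx using Submodule.span_induction with
  | mem x hx =>
    obtain ⟨m, s, hs, rfl⟩ := hx
    exact h m s hs
  | zero => rw [mul_zero]; exact zero_mem _
  | add x y _ _ hx hy => rw [mul_add]; exact add_mem hx hy
  | smul c x _ hx => rw [mul_smul_comm]; exact Submodule.smul_mem _ c hx

lemma exists_normal_eq_mul {m : Multiset Z} (s : Z → Kind) {j : Z} (hj : j ∈ m) :
    ∃ m', m = j ::ₘ m' ∧ normal m s = pgen (s j) j * normal m' s := by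
  obtain ⟨m', rfl⟩ := Multiset.exists_cons_of_mem hj
  exact ⟨m', rfl, by rw [normal, Multiset.map_cons, Multiset.prod_cons]; rfl⟩

/-- Either the word has an `x_j⁻` with `j ≤ k` and the product is zero, or `x_k⁺` turns all letters
at `j ≤ k` into `x⁺`, which leaves a normal word. -/
lemma xp_mul_normal (k : Z) (m : Multiset Z) (s : Z → Kind) (hs : Admissible m s) :
    pgen .xp k * normal m s ∈ normalSpan Z := by
  classical
  by_cases h : ∃ j ∈ m, j ≤ k ∧ s j = .xm
  · obtain ⟨j, hj, hjk, hsj⟩ := h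
    obtain ⟨m', -, hm'⟩ := exists_normal_eq_mul s hj
    rw [hm', hsj, ← mul_assoc, mul_comm (pgen .xp k), pgen_xm_mul_xp hjk, zero_mul]
    exact zero_mem _
  push Not at h
  let s' : Z → Kind := fun j => if j ≤ k then .xp else s j
  have h1 : pgen .xp k * normal m s = normal (k ::ₘ m) s' := by
    rw [normal, normal, Multiset.map_cons, Multiset.prod_cons]
    simp only [s', le_refl, if_true]
    refine Multiset.mul_prod_map_congr fun j hj => ?_
    split_ifs with hjk
    · exact pgen_xp_mul (h j hj hjk) hjk
    · rfl
  rw [h1]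
  refine normal_mem ⟨fun j hj hsj i hi hij => ?_, fun j hj hsj i hi hij => ?_⟩
  · by_cases hik : i ≤ k
    · exact if_pos hik
    · have hjk : ¬ j ≤ k := fun hjk => hik (hij.trans hjk)
      rcases Multiset.mem_cons.1 hi with rfl | hi
      · exact absurd le_rfl hik
      rcases Multiset.mem_cons.1 hj with rfl | hj
      · exact absurd le_rfl hjk
      simp only [s', if_neg hik]
      simp only [s', if_neg hjk] at hsj
      exact hs.up j hj hsj i hi hij
  · by_cases hjk : j ≤ k
    · simp only [s', if_pos hjk] at hsj
      exact absurd hsj (by simp)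
    · have hik : ¬ i ≤ k := fun hik => hjk (hij.trans hik)
      rcases Multiset.mem_cons.1 hi with rfl | hi
      · exact absurd le_rfl hik
      rcases Multiset.mem_cons.1 hj with rfl | hj
      · exact absurd le_rfl hjk
      simp only [s', if_neg hik]
      simp only [s', if_neg hjk] at hsj
      exact hs.down j hj hsj i hi hij

/-- The mirror image of `xp_mul_normal`: letters at `j ≥ k` turn into `x⁻`. -/
lemma xm_mul_normal (k : Z) (m : Multiset Z) (s : Z → Kind) (hs : Admissible m s) :
    pgen .xm k * normal m s ∈ normalSpan Z := by
  classical
  by_cases h : ∃ j ∈ m, k ≤ j ∧ s j = .xp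
  · obtain ⟨j, hj, hjk, hsj⟩ := h
    obtain ⟨m', -, hm'⟩ := exists_normal_eq_mul s hj
    rw [hm', hsj, ← mul_assoc, pgen_xm_mul_xp hjk, zero_mul]
    exact zero_mem _
  push Not at h
  let s' : Z → Kind := fun j => if k ≤ j then .xm else s j
  have h1 : pgen .xm k * normal m s = normal (k ::ₘ m) s' := by
    rw [normal, normal, Multiset.map_cons, Multiset.prod_cons]
    simp only [s', le_refl, if_true]
    refine Multiset.mul_prod_map_congr fun j hj => ?_
    split_ifs with hjk
    · exact pgen_xm_mul (h j hj hjk) hjk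
    · rfl
  rw [h1]
  refine normal_mem ⟨fun j hj hsj i hi hij => ?_, fun j hj hsj i hi hij => ?_⟩
  · by_cases hjk : k ≤ j
    · simp only [s', if_pos hjk] at hsj
      exact absurd hsj (by simp)
    · have hik : ¬ k ≤ i := fun hik => hjk (hik.trans hij)
      rcases Multiset.mem_cons.1 hi with rfl | hi
      · exact absurd le_rfl hik
      rcases Multiset.mem_cons.1 hj with rfl | hj
      · exact absurd le_rfl hjk
      simp only [s', if_neg hik]
      simp only [s', if_neg hjk] at hsj
      exact hs.up j hj hsj i hi hij
  · by_cases hik : k ≤ i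
    · exact if_pos hik
    · have hjk : ¬ k ≤ j := fun hjk => hik (hjk.trans hij)
      rcases Multiset.mem_cons.1 hi with rfl | hi
      · exact absurd le_rfl hik
      rcases Multiset.mem_cons.1 hj with rfl | hj
      · exact absurd le_rfl hjk
      simp only [s', if_neg hik]
      simp only [s', if_neg hjk] at hsj
      exact hs.down j hj hsj i hi hij

/-- An `x_j⁺` with `j ≥ k` or an `x_j⁻` with `j ≤ k` turns the new letter into `x_k^±`, which
reduces to the two preceding lemmas. Otherwise the letter is simply added, unless the opposite `y_k`
is present; then `y_k⁺ y_k⁻` is expanded. -/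
lemma y_mul_normal {κ : Kind} (hp : κ ≠ .xp) (hm : κ ≠ .xm) (k : Z) (m : Multiset Z)
    (s : Z → Kind) (hs : Admissible m s) : pgen κ k * normal m s ∈ normalSpan Z := by
  classical
  by_cases h1 : ∃ j ∈ m, k ≤ j ∧ s j = .xp
  · obtain ⟨j, hj, hjk, hsj⟩ := h1
    obtain ⟨m', -, hm'⟩ := exists_normal_eq_mul s hj
    rw [hm', hsj, ← mul_assoc, mul_comm (pgen κ k), pgen_xp_mul hm hjk, mul_comm (pgen .xp j),
      mul_assoc]
    have := xp_mul_normal k m s hs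
    rwa [hm', hsj] at this
  by_cases h2 : ∃ j ∈ m, j ≤ k ∧ s j = .xm
  · obtain ⟨j, hj, hjk, hsj⟩ := h2
    obtain ⟨m', -, hm'⟩ := exists_normal_eq_mul s hj
    rw [hm', hsj, ← mul_assoc, mul_comm (pgen κ k), pgen_xm_mul hp hjk, mul_comm (pgen .xm j),
      mul_assoc]
    have := xm_mul_normal k m s hs
    rwa [hm', hsj] at this
  push Not at h1 h2
  by_cases hk : k ∈ m
  · by_cases hsk : s k = κ
    · have : pgen κ k * normal m s = normal (k ::ₘ m) s := by
        rw [normal, normal, Multiset.map_cons, Multiset.prod_cons, hsk]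
      rw [this]
      have hmem : ∀ i ∈ k ::ₘ m, i ∈ m := fun i hi =>
        (Multiset.mem_cons.1 hi).elim (fun h => h ▸ hk) id
      exact normal_mem ⟨fun j hj hsj i hi => hs.up j (hmem j hj) hsj i (hmem i hi),
        fun j hj hsj i hi => hs.down j (hmem j hj) hsj i (hmem i hi)⟩
    · obtain ⟨m', rfl, hm'⟩ := exists_normal_eq_mul s hk
      have hs' : Admissible m' s :=
        ⟨fun j hj hsj i hi => hs.up j (Multiset.mem_cons_of_mem hj) hsj i
            (Multiset.mem_cons_of_mem hi),
          fun j hj hsj i hi => hs.down j (Multiset.mem_cons_of_mem hj) hsj i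
            (Multiset.mem_cons_of_mem hi)⟩
      -- The cases already treated exclude `x_k^±` in the word, so the letter at `k` that differs
      -- from `κ` is the opposite `y_k`.
      have hprod : pgen κ k * pgen (s k) k =
          pgen .xp k * pgen .xp k + pgen .xm k * pgen .xm k := by
        have h3 := h1 k hk le_rfl
        have h4 := h2 k hk le_rfl
        generalize s k = κ' at *
        cases κ <;> cases κ' <;> simp_all [pgen_yp_mul_ym, mul_comm (pgen Kind.ym k)]
      rw [hm', ← mul_assoc, hprod, add_mul, mul_assoc, mul_assoc]
      exact add_mem
        (mul_mem_normalSpan_of (xp_mul_normal k) (xp_mul_normal k m' s hs'))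
        (mul_mem_normalSpan_of (xm_mul_normal k) (xm_mul_normal k m' s hs'))
  · have hne : ∀ j ∈ m, j ≠ k := fun j hj h => hk (h ▸ hj)
    have : pgen κ k * normal m s = normal (k ::ₘ m) (Function.update s k κ) := by
      rw [normal, normal, Multiset.map_cons, Multiset.prod_cons, Function.update_self]
      congr 1
      refine congrArg Multiset.prod (Multiset.map_congr rfl fun j hj => ?_)
      rw [Function.update_of_ne (hne j hj)]
    rw [this]
    refine normal_mem ⟨fun j hj hsj i hi hij => ?_, fun j hj hsj i hi hij => ?_⟩
    · rcases Multiset.mem_cons.1 hj with rfl | hj'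
      · rw [Function.update_self] at hsj
        exact absurd hsj hp
      rw [Function.update_of_ne (hne j hj')] at hsj
      rcases Multiset.mem_cons.1 hi with rfl | hi
      · exact absurd hsj (h1 j hj' hij)
      rw [Function.update_of_ne (hne i hi)]
      exact hs.up j hj' hsj i hi hij
    · rcases Multiset.mem_cons.1 hj with rfl | hj'
      · rw [Function.update_self] at hsj
        exact absurd hsj hm
      rw [Function.update_of_ne (hne j hj')] at hsj
      rcases Multiset.mem_cons.1 hi with rfl | hi
      · exact absurd hsj (h2 j hj' hij)
      rw [Function.update_of_ne (hne i hi)]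
      exact hs.down j hj' hsj i hi hij

/-- The normal words span the presented algebra. -/
theorem normalSpan_eq_top : normalSpan Z = ⊤ := by
  refine eq_top_iff.2 fun x hx => ?_
  clear hx
  obtain ⟨x, rfl⟩ := Ideal.Quotient.mk_surjective x
  induction x using MvPolynomial.induction_on with
  | C a =>
    have h : Ideal.Quotient.mk (relIdeal Z) (MvPolynomial.C a) =
        a • normal 0 (fun _ => .xp) := by
      rw [normal, Multiset.map_zero, Multiset.prod_zero]
      exact Algebra.algebraMap_eq_smul_one (A := Presented Z) a
    rw [h]
    exact Submodule.smul_mem _ a (normal_mem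
      ⟨fun _ h => absurd h (Multiset.notMem_zero _), fun _ h => absurd h (Multiset.notMem_zero _)⟩)
  | add p q hp hq => rw [map_add]; exact add_mem hp hq
  | mul_X p g hp =>
    obtain ⟨κ, k, rfl⟩ := g.exists_kind
    rw [map_mul, mul_comm]
    refine mul_mem_normalSpan_of (a := pgen κ k) ?_ hp
    match κ with
    | .xp => exact xp_mul_normal k
    | .xm => exact xm_mul_normal k
    | .yp => exact y_mul_normal (by simp) (by simp) k
    | .ym => exact y_mul_normal (by simp) (by simp) k

/-! ### The modules attached to words -/

namespace Chain

variable {t t' : ℂ[X]}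

lemma mem_of_iso {D D' : Chain t} (e : D.lin ≃ₗ[A t] D'.lin) {n : ℤ} (hn : n ∈ D.J) :
    n ∈ D'.J := by
  have h1 : e.toLinearMap (D.vec n) ∈ weightSpace D'.lin (n : ℂ) :=
    WMod.hom_mem_weightSpace _ (D.vec_mem n)
  obtain ⟨m, hm, h⟩ := D'.weight_int h1 fun h => D.vec_ne_zero hn (e.map_eq_zero_iff.1 h)
  rwa [Int.cast_injective h]

lemma p_eq_zero_of_iso {D D' : Chain t} (e : D.lin ≃ₗ[A t] D'.lin) {n : ℤ} (hn : n ∈ D.J)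
    (hn' : n + 1 ∈ D.J) (h : D.p n = 0) : D'.p n = 0 := by
  have h1 : e.toLinearMap (D.vec n) = _ :=
    D'.eq_smul_vec (WMod.hom_mem_weightSpace _ (D.vec_mem n))
  have h2 := WMod.hom_opP e.toLinearMap (D.vec n)
  rw [D.opP_vec hn, h, zero_smul, map_zero, h1, WMod.opP_smul, D'.opP_vec (mem_of_iso e hn),
    smul_smul] at h2
  rcases mul_eq_zero.1 ((smul_eq_zero.1 h2.symm).resolve_right
    (D'.vec_ne_zero (mem_of_iso e hn'))) with h3 | h3
  · rw [h3, zero_smul] at h1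
    exact absurd (e.map_eq_zero_iff.1 h1) (D.vec_ne_zero hn)
  · exact h3

lemma q_eq_zero_of_iso {D D' : Chain t} (e : D.lin ≃ₗ[A t] D'.lin) {n : ℤ} (hn : n ∈ D.J)
    (hn' : n + 1 ∈ D.J) (h : D.q n = 0) : D'.q n = 0 := by
  have h1 : e.toLinearMap (D.vec (n + 1)) = _ :=
    D'.eq_smul_vec (WMod.hom_mem_weightSpace _ (D.vec_mem (n + 1)))
  have h2 := WMod.hom_opM e.toLinearMap (D.vec (n + 1))
  rw [D.opM_vec hn', h, zero_smul, map_zero, h1, WMod.opM_smul, D'.opM_vec (mem_of_iso e hn'),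
    smul_smul] at h2
  rcases mul_eq_zero.1 ((smul_eq_zero.1 h2.symm).resolve_right
    (D'.vec_ne_zero (mem_of_iso e hn))) with h3 | h3
  · rw [h3, zero_smul] at h1
    exact absurd (e.map_eq_zero_iff.1 h1) (D.vec_ne_zero hn')
  · exact h3

/-- An isomorphism maps weight lines to weight lines and commutes with `X^±`, so it respects
supports and zero patterns. This is the converse of `Similar.iso`. -/
lemma similar_of_iso {D D' : Chain t} (e : D.lin ≃ₗ[A t] D'.lin) : D.Similar D' where
  J_eq := Set.Subset.antisymm (fun _ => mem_of_iso e) (fun _ => mem_of_iso e.symm)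
  p_iff _ h1 h2 := ⟨p_eq_zero_of_iso e h1 h2,
    p_eq_zero_of_iso e.symm (mem_of_iso e h1) (mem_of_iso e h2)⟩
  q_iff _ h1 h2 := ⟨q_eq_zero_of_iso e h1 h2,
    q_eq_zero_of_iso e.symm (mem_of_iso e h1) (mem_of_iso e h2)⟩

open Classical in
/-- The way in which a string passes the edge from `e` to `e + 1`. -/
def state (D : Chain t) (e : ℤ) : Kind :=
  if e ∈ D.J ∧ e + 1 ∈ D.J then (if D.p e = 0 then .ym else .yp)
  else if ∃ n ∈ D.J, e < n then .xp else .xm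

lemma Similar.state_eq {D : Chain t} {D' : Chain t'} (h : D.Similar D') (e : ℤ) :
    D.state e = D'.state e := by
  rw [state, state, ← h.J_eq]
  by_cases he : e ∈ D.J ∧ e + 1 ∈ D.J
  · rw [if_pos he, if_pos he]
    simp only [h.p_iff e he.1 he.2]
  · rw [if_neg he, if_neg he]

end Chain

namespace Kind

/-- The support of the module of a given kind for the root `e + 1/2`. -/
def J : Kind → ℤ → Set ℤ
  | xp, e => {n | e < n}
  | xm, e => {n | n ≤ e}
  | yp, _ => Set.univ
  | ym, _ => Set.univ

/-- The coefficients of `X⁺`. -/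
def p : Kind → ℤ → ℤ → ℂ
  | ym, e, n => n - e
  | _, _, _ => 1

/-- The coefficients of `X⁻`. -/
def q : Kind → ℤ → ℤ → ℂ
  | ym, _, _ => 1
  | _, e, n => n - e

lemma p_mul_q (κ : Kind) (e n : ℤ) : κ.p e n * κ.q e n = n - e := by
  cases κ <;> simp [p, q]

lemma p_eq_zero_iff {κ : Kind} {e n : ℤ} : κ.p e n = 0 ↔ κ = ym ∧ n = e := by
  cases κ <;> simp [p, sub_eq_zero]

lemma q_eq_zero_iff {κ : Kind} {e n : ℤ} : κ.q e n = 0 ↔ κ ≠ ym ∧ n = e := by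
  cases κ <;> simp [q, sub_eq_zero]

lemma edge (κ : Kind) {e n : ℤ} (h : ¬(n ∈ κ.J e ↔ n + 1 ∈ κ.J e)) : n = e := by
  cases κ <;> simp [J] at h <;> omega

lemma ordConnected (κ : Kind) (e : ℤ) : (κ.J e).OrdConnected := by
  cases κ
  · exact Set.ordConnected_Ioi
  · exact Set.ordConnected_Iic
  · exact Set.ordConnected_univ
  · exact Set.ordConnected_univ

end Kind

section Word

variable {Z : Set ℝ}

/-- The integer `k - 1/2`. -/
def idx (k : Z) : ℤ := ⌊(k : ℝ)⌋

lemma eq_idx (hZ : ∀ k ∈ Z, ∃ n : ℤ, k = n + 1 / 2) (k : Z) : (k : ℝ) = idx k + 1 / 2 := by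
  obtain ⟨n, hn⟩ := hZ k k.2
  have : idx k = n := by
    rw [idx, Int.floor_eq_iff, hn]
    constructor <;> linarith
  rw [this, hn]

lemma idx_le_idx {j k : Z} (h : j ≤ k) : idx j ≤ idx k := Int.floor_mono h

lemma idx_lt_idx (hZ : ∀ k ∈ Z, ∃ n : ℤ, k = n + 1 / 2) {j k : Z} (h : j < k) :
    idx j < idx k := by
  have h' : (j : ℝ) < k := h
  rw [eq_idx hZ j, eq_idx hZ k] at h'
  exact_mod_cast (add_lt_add_iff_right _).1 h'

lemma idx_injective (hZ : ∀ k ∈ Z, ∃ n : ℤ, k = n + 1 / 2) {j k : Z} (h : idx j = idx k) :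
    j = k := by
  rcases lt_trichotomy j k with h' | h' | h'
  · exact absurd h (idx_lt_idx hZ h').ne
  · exact h'
  · exact absurd h (idx_lt_idx hZ h').ne'

lemma eval_linear (hZ : ∀ k ∈ Z, ∃ n : ℤ, k = n + 1 / 2) (k : Z) (n : ℤ) :
    (linear k : ℂ[X]).eval ((n : ℂ) + 1 / 2) = n - idx k := by
  change (X - C ((k : ℝ) : ℂ)).eval _ = _
  rw [eval_sub, eval_X, eval_C, eq_idx hZ k]
  push_cast
  ring

/-- The structure constants of the module for a generator. -/
def genChain (hZ : ∀ k ∈ Z, ∃ n : ℤ, k = n + 1 / 2) (κ : Kind) (k : Z) :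
    Chain (linear k : ℂ[X]) where
  J := κ.J (idx k)
  p := κ.p (idx k)
  q := κ.q (idx k)
  rel n _ _ := by rw [eval_linear hZ, κ.p_mul_q]
  edge n h := by rw [eval_linear hZ, κ.edge h, sub_self]

/-- The product of the elements `z - k`. -/
def linearProd (m : Multiset Z) : polyMonoid Z := (m.map linear).prod

lemma eval_linearProd (hZ : ∀ k ∈ Z, ∃ n : ℤ, k = n + 1 / 2) (m : Multiset Z) (n : ℤ) :
    (linearProd m : ℂ[X]).eval ((n : ℂ) + 1 / 2) = (m.map fun k => (n : ℂ) - idx k).prod := by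
  rw [linearProd, Submonoid.coe_multiset_prod, eval_multiset_prod, Multiset.map_map,
    Multiset.map_map]
  exact congrArg Multiset.prod (Multiset.map_congr rfl fun k _ => eval_linear hZ k n)

lemma eval_linearProd_eq_zero_iff (hZ : ∀ k ∈ Z, ∃ n : ℤ, k = n + 1 / 2) {m : Multiset Z} {n : ℤ} :
    (linearProd m : ℂ[X]).eval ((n : ℂ) + 1 / 2) = 0 ↔ ∃ k ∈ m, idx k = n := by
  rw [eval_linearProd hZ, Multiset.prod_eq_zero_iff, Multiset.mem_map]
  exact exists_congr fun k => and_congr_right fun _ => by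
    rw [sub_eq_zero, Int.cast_inj, eq_comm]

/-- The structure constants of the module for a word. -/
def wordChain (hZ : ∀ k ∈ Z, ∃ n : ℤ, k = n + 1 / 2) (m : Multiset Z) (s : Z → Kind) :
    Chain (linearProd m : ℂ[X]) where
  J := {n | ∀ k ∈ m, n ∈ (s k).J (idx k)}
  p n := (m.map fun k => (s k).p (idx k) n).prod
  q n := (m.map fun k => (s k).q (idx k) n).prod
  rel n _ _ := by
    rw [eval_linearProd hZ, ← Multiset.prod_map_mul]
    exact congrArg Multiset.prod (Multiset.map_congr rfl fun k _ => Kind.p_mul_q _ _ _)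
  edge n h := by
    rw [eval_linearProd_eq_zero_iff hZ]
    by_contra! hc
    refine h (forall₂_congr fun k hk => ?_)
    by_contra h'
    exact hc k hk (Kind.edge _ h').symm

variable (hZ : ∀ k ∈ Z, ∃ n : ℤ, k = n + 1 / 2) {m : Multiset Z} {s : Z → Kind}

lemma wordChain_p_eq_zero_iff {n : ℤ} :
    (wordChain hZ m s).p n = 0 ↔ ∃ k ∈ m, s k = .ym ∧ idx k = n := by
  change (m.map fun k => (s k).p (idx k) n).prod = 0 ↔ _
  rw [Multiset.prod_eq_zero_iff, Multiset.mem_map]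
  exact exists_congr fun k => and_congr_right fun _ => by
    rw [Kind.p_eq_zero_iff, eq_comm (a := n)]

lemma wordChain_q_eq_zero_iff {n : ℤ} :
    (wordChain hZ m s).q n = 0 ↔ ∃ k ∈ m, s k ≠ .ym ∧ idx k = n := by
  change (m.map fun k => (s k).q (idx k) n).prod = 0 ↔ _
  rw [Multiset.prod_eq_zero_iff, Multiset.mem_map]
  exact exists_congr fun k => and_congr_right fun _ => by
    rw [Kind.q_eq_zero_iff, eq_comm (a := n)]

/-- If `a` is the largest root with letter `x⁺`, the first integer above `a` lies above every root
with letter `x⁺` and, by normality, below every root with letter `x⁻`. Without any `x⁺`, an integer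
far to the left works. -/
lemma Admissible.nonempty (hs : Admissible m s) : (wordChain hZ m s).J.Nonempty := by
  classical
  by_cases h : ∃ k ∈ m, s k = .xp
  · obtain ⟨a, ha, hmax⟩ := (m.toFinset.filter fun k => s k = .xp).exists_max_image id
      (by obtain ⟨k, hk, hsk⟩ := h
          exact ⟨k, Finset.mem_filter.2 ⟨Multiset.mem_toFinset.2 hk, hsk⟩⟩)
    rw [Finset.mem_filter, Multiset.mem_toFinset] at ha
    refine ⟨idx a + 1, fun k hk => ?_⟩
    cases hsk : s k with
    | xp =>
      have := idx_le_idx (hmax k (Finset.mem_filter.2 ⟨Multiset.mem_toFinset.2 hk, hsk⟩))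
      exact Int.lt_add_one_of_le this
    | xm =>
      refine Int.add_one_le_of_lt (idx_lt_idx hZ (lt_of_not_ge fun hka => ?_))
      have := hs.down k hk hsk a ha.1 hka
      rw [ha.2] at this
      exact absurd this (by simp)
    | yp => trivial
    | ym => trivial
  · push Not at h
    obtain ⟨B, hB⟩ := (m.toFinset.image idx).bddBelow
    refine ⟨B, fun k hk => ?_⟩
    cases hsk : s k with
    | xp => exact absurd hsk (h k hk)
    | xm => exact hB (by simpa using ⟨k, k.2, hk, rfl⟩)
    | yp => trivial
    | ym => trivial

/-- Normal words give string modules. -/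
lemma Admissible.isString (hs : Admissible m s) : (wordChain hZ m s).IsString where
  nonempty := hs.nonempty hZ
  ordConnected := ⟨fun _ ha _ hb _ hn k hk =>
    ((s k).ordConnected (idx k)).out (ha k hk) (hb k hk) hn⟩
  edge_ne_zero n _ _ := by
    by_contra! h
    obtain ⟨k, -, hsk, hkn⟩ := (wordChain_p_eq_zero_iff hZ).1 h.1
    obtain ⟨j, -, hsj, hjn⟩ := (wordChain_q_eq_zero_iff hZ).1 h.2
    rw [idx_injective hZ (hjn.trans hkn.symm)] at hsj
    exact hsj hsk

/-- In a normal word, roots with letter `x⁺` are strictly below a root with letter `y^±`, and those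
with letter `x⁻` are strictly above it. The edge at such a root is thus inside the support, where it
is visible to `Chain.state`. -/
lemma Admissible.mem_of_y (hs : Admissible m s) {k : Z} (hk : k ∈ m) (h1 : s k ≠ .xp)
    (h2 : s k ≠ .xm) : idx k ∈ (wordChain hZ m s).J ∧ idx k + 1 ∈ (wordChain hZ m s).J := by
  refine ⟨fun j hj => ?_, fun j hj => ?_⟩ <;> cases hsj : s j with
  | yp => trivial
  | ym => trivial
  | xp =>
    have : idx j < idx k := idx_lt_idx hZ (lt_of_not_ge fun h => h1 (hs.up j hj hsj k hk h))
    first | exact this | exact this.trans (Int.lt_succ _)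
  | xm =>
    have : idx k < idx j := idx_lt_idx hZ (lt_of_not_ge fun h => h2 (hs.down j hj hsj k hk h))
    first | exact this | exact this.le

/-- A normal word can be recovered from its module. -/
lemma Admissible.state_eq (hs : Admissible m s) {k : Z} (hk : k ∈ m) :
    (wordChain hZ m s).state (idx k) = s k := by
  have hp : (wordChain hZ m s).p (idx k) = 0 ↔ s k = .ym := by
    rw [wordChain_p_eq_zero_iff]
    constructor
    · rintro ⟨j, -, hsj, hjk⟩
      rwa [idx_injective hZ hjk] at hsj
    · exact fun h => ⟨k, hk, h, rfl⟩
  cases hsk : s k with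
  | xp =>
    have h : ∀ n ∈ (wordChain hZ m s).J, idx k < n := fun n hn => by
      have := hn k hk
      rwa [hsk] at this
    obtain ⟨n, hn⟩ := hs.nonempty hZ
    rw [Chain.state, if_neg fun h' => lt_irrefl _ (h _ h'.1), if_pos ⟨n, hn, h n hn⟩]
  | xm =>
    have h : ∀ n ∈ (wordChain hZ m s).J, n ≤ idx k := fun n hn => by
      have := hn k hk
      rwa [hsk] at this
    rw [Chain.state, if_neg fun h' => absurd (h _ h'.2) (by omega),
      if_neg fun ⟨n, hn, hkn⟩ => absurd (h n hn) (by omega)]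
  | yp =>
    rw [Chain.state, if_pos (hs.mem_of_y hZ hk (by simp [hsk]) (by simp [hsk])),
      if_neg (by rw [hp, hsk]; simp)]
  | ym =>
    rw [Chain.state, if_pos (hs.mem_of_y hZ hk (by simp [hsk]) (by simp [hsk])),
      if_pos (hp.2 hsk)]

end Word

/-- A predicate on the integers changes somewhere between two values. -/
lemma exists_int_step {C : ℤ → Prop} {a : ℤ} (ha : ¬ C a) : ∀ d : ℕ, C (a + d) →
    ∃ n, a ≤ n ∧ n < a + d ∧ ¬ C n ∧ C (n + 1) := by
  intro d
  induction d with
  | zero => intro h; exact absurd (by simpa using h) ha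
  | succ d ih =>
    intro h
    by_cases hd : C (a + d)
    · obtain ⟨n, h1, h2, h3⟩ := ih hd
      exact ⟨n, h1, by push_cast; omega, h3⟩
    · exact ⟨a + d, by omega, by push_cast; omega, hd, by rwa [add_assoc]⟩

/-- Every string module is the module of a word. -/
theorem Chain.IsString.similar_wordChain {Z : Set ℝ} (hZ : ∀ k ∈ Z, ∃ n : ℤ, k = n + 1 / 2)
    {m : Multiset Z} {D : Chain (linearProd m : ℂ[X])} (hD : D.IsString) :
    D.Similar (wordChain hZ m fun k => D.state (idx k)) := by
  have hJ : D.J = (wordChain hZ m fun k => D.state (idx k)).J := by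
    refine Set.Subset.antisymm (fun n hn k hk => ?_) (fun n hn => ?_)
    · change n ∈ (D.state (idx k)).J (idx k)
      rw [Chain.state]
      split_ifs with h1 h2 h3
      · trivial
      · trivial
      -- Here `J` has a point above the edge. A point below it as well would put both ends of the
      -- edge into the interval `J`.
      · obtain ⟨n', hn', hlt⟩ := h3
        change idx k < n
        by_contra hle
        exact h1 ⟨hD.ordConnected.out hn hn' ⟨by omega, by omega⟩,
          hD.ordConnected.out hn hn' ⟨by omega, by omega⟩⟩
      · change n ≤ idx k
        by_contra hle
        exact h3 ⟨n, hn, by omega⟩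
    -- On the way between `n` and a point of `J`, the boundary of `J` is crossed at an edge, which
    -- is the edge of a root. The letter read off at this root is an `x^±` that confines the word's
    -- support to the side of `J`, contrary to the choice of `n`.
    · by_contra hnJ
      obtain ⟨a, ha⟩ := hD.nonempty
      rcases lt_trichotomy n a with h | rfl | h
      · obtain ⟨d, rfl⟩ : ∃ d : ℕ, a = n + d := ⟨(a - n).toNat, by omega⟩
        obtain ⟨e, h1, h2, h3, h4⟩ := exists_int_step (C := (· ∈ D.J)) hnJ d ha
        obtain ⟨k, hk, rfl⟩ := (eval_linearProd_eq_zero_iff hZ).1 (D.edge e fun h => h3 (h.2 h4))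
        have := hn k hk
        simp only [Chain.state, if_neg (fun h' => h3 h'.1 : ¬(idx k ∈ D.J ∧ idx k + 1 ∈ D.J)),
          if_pos (⟨_, ha, h2⟩ : ∃ n ∈ D.J, idx k < n)] at this
        exact absurd (show idx k < n from this) (by omega)
      · exact hnJ ha
      · obtain ⟨d, rfl⟩ : ∃ d : ℕ, n = a + d := ⟨(n - a).toNat, by omega⟩
        obtain ⟨e, h1, h2, h3, h4⟩ := exists_int_step (C := (· ∉ D.J)) (not_not.2 ha) d hnJ
        rw [not_not] at h3
        obtain ⟨k, hk, rfl⟩ := (eval_linearProd_eq_zero_iff hZ).1 (D.edge e fun h => h4 (h.1 h3))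
        have := hn k hk
        have h5 : ¬ ∃ n ∈ D.J, idx k < n := fun ⟨n', hn', hlt⟩ =>
          h4 (hD.ordConnected.out h3 hn' ⟨by omega, by omega⟩)
        simp only [Chain.state, if_neg (fun h' => h4 h'.2 : ¬(idx k ∈ D.J ∧ idx k + 1 ∈ D.J)),
          if_neg h5] at this
        exact absurd (show a + d ≤ idx k from this) (by omega)
  refine ⟨hJ, fun n h1 h2 => ?_, fun n h1 h2 => ?_⟩
  · rw [wordChain_p_eq_zero_iff]
    constructor
    · intro h
      obtain ⟨k, hk, rfl⟩ := (eval_linearProd_eq_zero_iff hZ).1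
        ((D.rel n h1 h2).symm.trans (by rw [h, zero_mul]))
      exact ⟨k, hk, by rw [Chain.state, if_pos ⟨h1, h2⟩, if_pos h], rfl⟩
    · rintro ⟨k, hk, hs, rfl⟩
      rw [Chain.state, if_pos ⟨h1, h2⟩] at hs
      by_contra h
      rw [if_neg h] at hs
      exact absurd hs (by simp)
  · rw [wordChain_q_eq_zero_iff]
    constructor
    · intro h
      obtain ⟨k, hk, rfl⟩ := (eval_linearProd_eq_zero_iff hZ).1
        ((D.rel n h1 h2).symm.trans (by rw [h, mul_zero]))
      refine ⟨k, hk, ?_, rfl⟩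
      rw [Chain.state, if_pos ⟨h1, h2⟩,
        if_neg ((hD.edge_ne_zero _ h1 h2).resolve_right (not_not.2 h))]
      simp
    · rintro ⟨k, hk, hs, rfl⟩
      rw [Chain.state, if_pos ⟨h1, h2⟩] at hs
      have hp : D.p (idx k) ≠ 0 := fun h => hs (if_pos h)
      have := D.rel _ h1 h2
      rw [(eval_linearProd_eq_zero_iff hZ).2 ⟨k, hk, rfl⟩] at this
      exact (mul_eq_zero.1 this).resolve_left hp

/-- The elements of the monoid are the products of elements `z - k`. -/
lemma exists_linearProd {Z : Set ℝ} (t : polyMonoid Z) : ∃ m : Multiset Z, linearProd m = t := by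
  classical
  have hroots : ∀ c ∈ (t : ℂ[X]).roots, ∃ k : Z, ((k : ℝ) : ℂ) = c := fun c hc => by
    obtain ⟨k, hk, h⟩ := t.2.2 c (isRoot_of_mem_roots hc)
    exact ⟨⟨k, hk⟩, h⟩
  obtain ⟨m, hm⟩ : ∃ m : Multiset Z, m.map (fun k : Z => ((k : ℝ) : ℂ)) = (t : ℂ[X]).roots := by
    generalize (t : ℂ[X]).roots = r at hroots
    induction r using Multiset.induction_on with
    | empty => exact ⟨0, rfl⟩
    | cons c r ih =>
      obtain ⟨m, rfl⟩ := ih fun c hc => hroots c (Multiset.mem_cons_of_mem hc)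
      obtain ⟨k, rfl⟩ := hroots c (Multiset.mem_cons_self _ _)
      exact ⟨k ::ₘ m, Multiset.map_cons _ _ _⟩
  refine ⟨m, Subtype.ext ?_⟩
  rw [linearProd, Submonoid.coe_multiset_prod, Multiset.map_map,
    (IsAlgClosed.splits (t : ℂ[X])).eq_prod_roots_of_monic t.2.1, ← hm, Multiset.map_map]
  rfl

/-! ### Classes of modules with given structure constants -/

namespace SplitAlg

variable {Γ : Submonoid ℂ[X]}

lemma cls_eq_of_iso {t : Γ} {M N : WMod (t : ℂ[X])} (e : M ≃ₗ[A (t : ℂ[X])] N) :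
    cls t M = cls t N := by
  rw [cls, cls, K0split.mk_eq_of_iso e]

lemma cls_eq_add {t : Γ} {M N P : WMod (t : ℂ[X])} (e : P ≃ₗ[A (t : ℂ[X])] M × N) :
    cls t P = cls t M + cls t N := by
  rw [cls, cls, cls, K0split.mk_eq_add e, TensorProduct.tmul_add, map_add]

lemma cls_lin_congr {t t' : Γ} (h : t = t') {D : Chain (t : ℂ[X])} {D' : Chain (t' : ℂ[X])}
    (hs : D.Similar D') : cls t D.lin = cls t' D'.lin := by
  subst h
  exact cls_eq_of_iso hs.iso.some

lemma cls_lin_mul (t t' : Γ) (D : Chain (t : ℂ[X])) (D' : Chain (t' : ℂ[X])) :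
    cls t D.lin * cls t' D'.lin = cls (t * t') (D.mul D' : Chain (t * t' : ℂ[X])).lin := by
  rw [cls_mul_cls]
  exact cls_eq_of_iso (t := t * t') (Chain.mul_iso D D').some.symm

/-- A zero object is isomorphic to its own double. -/
lemma cls_lin_eq_zero {t : Γ} {D : Chain (t : ℂ[X])} (h : D.J = ∅) : cls t D.lin = 0 := by
  have hs : Subsingleton D.lin := ⟨fun (v w : LineOn D.J) => LineOn.ext fun n =>
    have hn : n ∉ D.J := h ▸ Set.notMem_empty n
    (LineOn.coef_of_notMem hn v).trans (LineOn.coef_of_notMem hn w).symm⟩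
  have e : D.lin ≃ₗ[A (t : ℂ[X])] D.lin × D.lin := LinearEquiv.ofSubsingleton _ _
  exact left_eq_add.1 (cls_eq_add e)

end SplitAlg

open SplitAlg

/-! ### The isomorphism with the presented algebra -/

section Phi

variable {Z : Set ℝ} (hZ : ∀ k ∈ Z, ∃ n : ℤ, k = n + 1 / 2)

/-- The class of the module of a generator. -/
def genCls (κ : Kind) (k : Z) : SplitAlg (polyMonoid Z) := cls (linear k) (genChain hZ κ k).lin

/-- The empty word imposes no condition on the support and has all structure constants 1, like the
unit object. The two are built on different carriers, so an explicit isomorphism `v_n ↦ v_n` is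
needed. -/
lemma unit_eq_cls : (1 : SplitAlg (polyMonoid Z)) =
    cls (linearProd 0) (wordChain hZ 0 fun _ => .xp).lin := by
  let D := wordChain hZ 0 fun _ => .xp
  have hJ : ∀ n, n ∈ D.J := fun n k hk => absurd hk (Multiset.notMem_zero k)
  have h1 : ((linearProd (0 : Multiset Z) : polyMonoid Z) : ℂ[X]) = 1 := rfl
  let f : D.lin →ₗ[A (linearProd (0 : Multiset Z) : ℂ[X])] unitObj h1 :=
    D.homFrom (M := unitObj h1) (fun n => (Line.single n 1 : Line)) (fun n => Line.single_mem n 1)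
      (fun n hn => absurd (hJ n) hn)
      (fun n _ => (unitObj_opP h1 _).trans ((Line.shiftBy_single _ _ _).trans
        (one_smul ℂ (Line.single (n + 1) 1)).symm))
      (fun n _ => (unitObj_opM h1 _).trans ((Line.shiftBy_single _ _ _).trans
        ((congrArg (fun m => Line.single m (1 : ℂ)) (add_neg_cancel_right n 1)).trans
          (one_smul ℂ (Line.single n 1)).symm)))
  let T : (unitObj h1 : WMod _) →ₗ[ℂ] D.lin :=
    (Finsupp.lsum ℂ fun n : ℤ => LinearMap.toSpanSingleton ℂ D.lin (D.vec n) : Line →ₗ[ℂ] D.lin)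
  have hT : ∀ (n : ℤ) (a : ℂ), T (Line.single n a : Line) = a • D.vec n := fun n a =>
    Finsupp.lsum_single _ _ _ _
  have hf : ∀ n, f (D.vec n) = (Line.single n 1 : Line) := D.homFrom_vec
  have hTf : T.comp (f.restrictScalars ℂ) = LinearMap.id := D.hom_ext fun n _ => by
    rw [LinearMap.comp_apply, LinearMap.restrictScalars_apply, hf, hT, one_smul]; rfl
  have hfT : ((f.restrictScalars ℂ).comp T).toAddMonoidHom =
      AddMonoidHom.id (unitObj h1 : WMod _) := Line.hom_ext fun n a => by
    change f (T (Line.single n a : Line)) = (Line.single n a : Line)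
    rw [hT, WMod.hom_smul, hf]
    refine ((Line.single n).map_smul a 1).symm.trans ?_
    rw [smul_eq_mul, mul_one]
  refine (cls_eq_of_iso (t := 1) (LinearEquiv.ofBijective f ⟨?_, ?_⟩)).symm
  · exact Function.LeftInverse.injective (g := T) fun v => LinearMap.congr_fun hTf v
  · exact Function.RightInverse.surjective (g := T) fun v => DFunLike.congr_fun hfT v

/-- By `cls_lin_mul`, multiplying classes of chains intersects supports and multiplies constants,
which is how `wordChain` is put together from its letters. -/
lemma prod_genCls (m : Multiset Z) (s : Z → Kind) :
    (m.map fun k => genCls hZ (s k) k).prod = cls (linearProd m) (wordChain hZ m s).lin := by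
  induction m using Multiset.induction_on with
  | empty =>
    rw [Multiset.map_zero, Multiset.prod_zero, unit_eq_cls hZ]
    exact cls_lin_congr rfl ⟨Set.ext fun n => by simp [wordChain], fun _ _ _ => Iff.rfl,
      fun _ _ _ => Iff.rfl⟩
  | cons k m ih =>
    rw [Multiset.map_cons, Multiset.prod_cons, ih, genCls, cls_lin_mul]
    refine cls_lin_congr ?_ ⟨?_, fun n _ _ => ?_, fun n _ _ => ?_⟩
    · rw [linearProd, linearProd, Multiset.map_cons, Multiset.prod_cons]
    · ext n
      simp only [wordChain, Chain.mul, genChain, Multiset.forall_mem_cons, Set.mem_inter_iff,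
        Set.mem_ofPred_eq]
    · simp only [wordChain, Chain.mul, genChain, Multiset.map_cons, Multiset.prod_cons]
    · simp only [wordChain, Chain.mul, genChain, Multiset.map_cons, Multiset.prod_cons]

/-- Factors with roots outside of the common support may be changed. -/
lemma genCls_mul_congr {κ κ' ι : Kind} {j k : Z}
    (hJ : κ.J (idx j) ∩ ι.J (idx k) = κ'.J (idx j) ∩ ι.J (idx k))
    (hj : ¬(idx j ∈ κ.J (idx j) ∩ ι.J (idx k) ∧ idx j + 1 ∈ κ.J (idx j) ∩ ι.J (idx k))) :
    genCls hZ κ j * genCls hZ ι k = genCls hZ κ' j * genCls hZ ι k := by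
  rw [genCls, genCls, genCls, cls_lin_mul, cls_lin_mul]
  refine cls_lin_congr rfl ⟨hJ, fun n h1 h2 => ?_, fun n h1 h2 => ?_⟩
  · have hn : n ≠ idx j := by rintro rfl; exact hj ⟨h1, h2⟩
    have h3 : ∀ κ : Kind, κ.p (idx j) n ≠ 0 := fun κ h => hn (Kind.p_eq_zero_iff.1 h).2
    exact (mul_eq_zero_iff_left (h3 κ)).trans (mul_eq_zero_iff_left (h3 κ')).symm
  · have hn : n ≠ idx j := by rintro rfl; exact hj ⟨h1, h2⟩
    have h3 : ∀ κ : Kind, κ.q (idx j) n ≠ 0 := fun κ h => hn (Kind.q_eq_zero_iff.1 h).2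
    exact (mul_eq_zero_iff_left (h3 κ)).trans (mul_eq_zero_iff_left (h3 κ')).symm

/-- In the product, `X⁺` vanishes at the root because of `y_k⁻` and `X⁻` because of `y_k⁺`. The line
is cut there, and away from the root all constants are nonzero, so the halves have the zero patterns
of `(x_k⁺)²` and `(x_k⁻)²`. -/
lemma genCls_yp_mul_ym (k : Z) : genCls hZ .yp k * genCls hZ .ym k =
    genCls hZ .xp k * genCls hZ .xp k + genCls hZ .xm k * genCls hZ .xm k := by
  simp only [genCls, cls_lin_mul]
  let D : Chain ((linear k : ℂ[X]) * (linear k : ℂ[X])) :=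
    (genChain hZ .yp k).mul (genChain hZ .ym k)
  let S : Set ℤ := {n | idx k < n}
  have hpq : ∀ n : ℤ, n = idx k → D.p n = 0 ∧ D.q n = 0 := by
    rintro n rfl
    exact ⟨mul_eq_zero_of_right _ (Kind.p_eq_zero_iff.2 ⟨rfl, rfl⟩),
      mul_eq_zero_of_left (Kind.q_eq_zero_iff.2 ⟨by simp, rfl⟩) _⟩
  have hS : ∀ n, n ∈ D.J → n + 1 ∈ D.J → ¬(n ∈ S ↔ n + 1 ∈ S) → D.p n = 0 ∧ D.q n = 0 :=
    fun n _ _ h => hpq n (Kind.edge .xp h)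
  have hS' : ∀ n, n ∈ D.J → n + 1 ∈ D.J → ¬(n ∈ Sᶜ ↔ n + 1 ∈ Sᶜ) → D.p n = 0 ∧ D.q n = 0 :=
    fun n _ _ h => hpq n (Kind.edge .xp fun h' => h (not_congr h'))
  refine (cls_eq_add (t := linear k * linear k) (D.splitIso S hS hS')).trans ?_
  have hn : ∀ {κ : Kind} {n : ℤ}, n ≠ idx k → κ.p (idx k) n ≠ 0 ∧ κ.q (idx k) n ≠ 0 :=
    fun h => ⟨fun h' => h (Kind.p_eq_zero_iff.1 h').2, fun h' => h (Kind.q_eq_zero_iff.1 h').2⟩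
  have hm : ∀ {a b c d : ℂ}, a ≠ 0 → b ≠ 0 → c ≠ 0 → d ≠ 0 → (a * b = 0 ↔ c * d = 0) :=
    fun ha hb hc hd => iff_of_false (mul_ne_zero ha hb) (mul_ne_zero hc hd)
  congr 1
  · refine cls_lin_congr (t := linear k * linear k) rfl ⟨?_, fun n h1 _ => ?_, fun n h1 _ => ?_⟩
    · ext n
      simp [Chain.restrict, D, S, Chain.mul, genChain, Kind.J]
    · have h : n ≠ idx k := (show idx k < n from h1.2).ne'
      exact hm (hn (κ := .yp) h).1 (hn (κ := .ym) h).1 (hn (κ := .xp) h).1 (hn (κ := .xp) h).1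
    · have h : n ≠ idx k := (show idx k < n from h1.2).ne'
      exact hm (hn (κ := .yp) h).2 (hn (κ := .ym) h).2 (hn (κ := .xp) h).2 (hn (κ := .xp) h).2
  · refine cls_lin_congr (t := linear k * linear k) rfl ⟨?_, fun n _ h2 => ?_, fun n _ h2 => ?_⟩
    · ext n
      simp [Chain.restrict, D, S, Chain.mul, genChain, Kind.J]
    · have h : n ≠ idx k := fun h => h2.2 (show idx k < n + 1 by omega)
      exact hm (hn (κ := .yp) h).1 (hn (κ := .ym) h).1 (hn (κ := .xm) h).1 (hn (κ := .xm) h).1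
    · have h : n ≠ idx k := fun h => h2.2 (show idx k < n + 1 by omega)
      exact hm (hn (κ := .yp) h).2 (hn (κ := .ym) h).2 (hn (κ := .xm) h).2 (hn (κ := .xm) h).2

/-- The class of the module of a generator. -/
def genCls' : SplitGen Z → SplitAlg (polyMonoid Z)
  | .xp k => genCls hZ .xp k
  | .xm k => genCls hZ .xm k
  | .yp k => genCls hZ .yp k
  | .ym k => genCls hZ .ym k

/-- For the first four relations, the factor `x^±` that is kept confines the common support to one
side of the root of the exchanged factor, so `genCls_mul_congr` applies. For `x_j⁻ x_k⁺` the
supports are disjoint. -/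
lemma aeval_rel {f : MvPolynomial (SplitGen Z) ℂ} (hf : SplitRel f) :
    MvPolynomial.aeval (genCls' hZ) f = 0 := by
  cases hf with
  | yp_xp j k h =>
    simp only [map_sub, map_mul, MvPolynomial.aeval_X, sub_eq_zero, genCls']
    have := idx_le_idx h
    refine genCls_mul_congr hZ ?_ ?_
    · ext n; simp [Kind.J]; omega
    · simp [Kind.J]; omega
  | ym_xp j k h =>
    simp only [map_sub, map_mul, MvPolynomial.aeval_X, sub_eq_zero, genCls']
    have := idx_le_idx h
    refine genCls_mul_congr hZ ?_ ?_
    · ext n; simp [Kind.J]; omega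
    · simp [Kind.J]; omega
  | xm_yp j k h =>
    simp only [map_sub, map_mul, MvPolynomial.aeval_X, sub_eq_zero, genCls']
    have := idx_le_idx h
    rw [mul_comm, mul_comm (genCls hZ .xm j)]
    refine genCls_mul_congr hZ ?_ ?_
    · ext n; simp [Kind.J]; omega
    · simp [Kind.J]; omega
  | xm_ym j k h =>
    simp only [map_sub, map_mul, MvPolynomial.aeval_X, sub_eq_zero, genCls']
    have := idx_le_idx h
    rw [mul_comm, mul_comm (genCls hZ .xm j)]
    refine genCls_mul_congr hZ ?_ ?_
    · ext n; simp [Kind.J]; omega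
    · simp [Kind.J]; omega
  | xm_xp j k h =>
    simp only [map_mul, MvPolynomial.aeval_X, genCls', genCls, cls_lin_mul]
    have := idx_le_idx h
    refine cls_lin_eq_zero (t := linear j * linear k) (Set.eq_empty_of_forall_notMem ?_)
    rintro n ⟨h1, h2⟩
    change n ≤ idx j at h1
    change idx k < n at h2
    omega
  | yp_ym k =>
    simp only [map_sub, map_mul, map_add, MvPolynomial.aeval_X, sub_eq_zero, genCls', pow_two]
    exact genCls_yp_mul_ym hZ k

/-- The homomorphism from the presented algebra. -/
def phi : Presented Z →ₐ[ℂ] SplitAlg (polyMonoid Z) :=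
  Ideal.Quotient.liftₐ (relIdeal Z) (MvPolynomial.aeval (genCls' hZ)) fun f hf => by
    have : relIdeal Z ≤ RingHom.ker (MvPolynomial.aeval (genCls' hZ)).toRingHom :=
      Ideal.span_le.2 fun f hf => aeval_rel hZ hf
    exact this hf

lemma phi_pgen (κ : Kind) (k : Z) : phi hZ (pgen κ k) = genCls hZ κ k := by
  refine (Ideal.Quotient.liftₐ_apply _ _ _ _).trans ?_
  refine (Ideal.Quotient.lift_mk _ _ _).trans ((MvPolynomial.aeval_X _ _).trans ?_)
  cases κ <;> rfl

lemma phi_normal (m : Multiset Z) (s : Z → Kind) :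
    phi hZ (normal m s) = cls (linearProd m) (wordChain hZ m s).lin := by
  rw [normal, map_multiset_prod, Multiset.map_map, ← prod_genCls]
  exact congrArg Multiset.prod (Multiset.map_congr rfl fun k _ => phi_pgen hZ _ _)

lemma linearProd_injective : Function.Injective (linearProd : Multiset Z → polyMonoid Z) := by
  intro m m' h
  have key : ∀ m : Multiset Z, (linearProd m : ℂ[X]).roots =
      m.map (fun k : Z => ((k : ℝ) : ℂ)) :=
    fun m => by
      rw [linearProd, Submonoid.coe_multiset_prod, Multiset.map_map,
        ← Polynomial.roots_multiset_prod_X_sub_C (m.map (fun k : Z => ((k : ℝ) : ℂ))),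
        Multiset.map_map]
      rfl
  have h1 := (key m).symm.trans ((congrArg (fun t : polyMonoid Z => (t : ℂ[X]).roots) h).trans
    (key m'))
  exact Multiset.map_injective (fun a b h => Subtype.ext (Complex.ofReal_injective h)) h1

/-- Distinct normal words go to nonisomorphic strings or to different degrees, so the multiplicity
functional of one string extracts the coefficient of its word from a vanishing combination. -/
theorem phi_injective : Function.Injective (phi hZ) := by
  rw [injective_iff_map_eq_zero]
  intro x hx
  have hmem : x ∈ normalSpan Z := normalSpan_eq_top (Z := Z) ▸ Submodule.mem_top
  rw [normalSpan, Finsupp.mem_span_iff_linearCombination] at hmem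
  obtain ⟨c, rfl⟩ := hmem
  suffices hc : c = 0 by rw [hc, map_zero]
  -- The coefficients are indexed by elements of the presented algebra. Kinds that differ only off
  -- `m` give the same element, so `s` has to be recovered only on `m`.
  ext ⟨y, m, s, hs, hy⟩
  subst hy
  obtain ⟨i, hi⟩ := hs.nonempty hZ
  have h0 := congrArg (multL (linearProd m) (wordChain hZ m s) i) hx
  rw [map_zero, Finsupp.linearCombination_apply, Finsupp.sum, map_sum, map_sum,
    Finset.sum_eq_single ⟨normal m s, m, s, hs, rfl⟩] at h0
  · rw [map_smul, map_smul, phi_normal, multL_cls, (hs.isString hZ).mult_self hi,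
      Nat.cast_one, smul_eq_mul, mul_one] at h0
    exact h0
  · rintro ⟨_, m', s', hs', rfl⟩ - hne
    rw [map_smul, map_smul, phi_normal]
    by_cases hm : m' = m
    · subst hm
      rw [multL_cls, (hs.isString hZ).mult_eq_zero hi (hs'.isString hZ), Nat.cast_zero, smul_zero]
      refine ⟨fun e => hne (Subtype.ext ?_)⟩
      change normal m' s' = normal m' s
      refine congrArg Multiset.prod (Multiset.map_congr rfl fun k hk => ?_)
      rw [← hs.state_eq hZ hk, ← hs'.state_eq hZ hk, (Chain.similar_of_iso e).state_eq]
    · rw [multL_cls_of_ne fun h => hm (linearProd_injective h), smul_zero]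
  · intro hn
    rw [Finsupp.notMem_support_iff.1 hn, zero_smul, map_zero, map_zero]

/-- In each degree the classes of strings generate, and each of them is the image of the word formed
by the states of the string at the roots. It does not matter here whether that word is normal. -/
theorem phi_surjective : Function.Surjective (phi hZ) := by
  let R : Submodule ℂ (SplitAlg (polyMonoid Z)) := LinearMap.range (phi hZ).toLinearMap
  have hR : ∀ (t : polyMonoid Z) (M : WMod (t : ℂ[X])), cls t M ∈ R := fun t M => by
    let F : K0split (t : ℂ[X]) →+ SplitAlg (polyMonoid Z) :=
      { toFun x := SplitAlg.of t (1 ⊗ₜ x)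
        map_zero' := by rw [TensorProduct.tmul_zero, map_zero]
        map_add' x y := by rw [TensorProduct.tmul_add, map_add] }
    have hle : AddSubgroup.closure {x : K0split (t : ℂ[X]) | ∃ D : Chain (t : ℂ[X]),
        D.IsString ∧ K0split.mk D.lin = x} ≤ R.toAddSubgroup.comap F := by
      rw [AddSubgroup.closure_le]
      rintro _ ⟨D, hD, rfl⟩
      obtain ⟨m, rfl⟩ := exists_linearProd t
      refine ⟨normal m fun k => D.state (idx k), ?_⟩
      exact (phi_normal hZ _ _).trans (cls_lin_congr rfl (hD.similar_wordChain hZ)).symm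
    exact hle (K0split.mk_mem_closure t.2.1.ne_zero M)
  have h0 : R.mkQ = 0 := SplitAlg.hom_ext fun t M => by
    rw [LinearMap.zero_apply, Submodule.mkQ_apply, Submodule.Quotient.mk_eq_zero]
    exact hR t M
  intro x
  have : x ∈ R := by
    rw [← Submodule.Quotient.mk_eq_zero, ← Submodule.mkQ_apply, h0, LinearMap.zero_apply]
  exact this

end Phi

/-! ### Simple and non-simple string modules -/

namespace Chain

variable {t : ℂ[X]} (D : Chain t)

lemma weightSpace_ne_bot_iff {l : ℂ} :
    weightSpace D.lin l ≠ ⊥ ↔ ∃ n : ℤ, l = n ∧ n ∈ D.J := by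
  constructor
  · intro h
    obtain ⟨v, hv, h0⟩ := Submodule.exists_mem_ne_zero_of_ne_bot h
    obtain ⟨n, hn, rfl⟩ := D.weight_int hv h0
    exact ⟨n, rfl, hn⟩
  · rintro ⟨n, rfl, hn⟩ h
    have := D.vec_mem n
    rw [h, Submodule.mem_bot] at this
    exact D.vec_ne_zero hn this

lemma opP_ne_zero_iff {n : ℤ} {v : D.lin} (hv : v ∈ weightSpace D.lin (n : ℂ)) (h0 : v ≠ 0) :
    D.lin.opP v ≠ 0 ↔ n ∈ D.J ∧ n + 1 ∈ D.J ∧ D.p n ≠ 0 := by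
  have hn : n ∈ D.J := by
    obtain ⟨m, hm, h⟩ := D.weight_int hv h0
    rwa [Int.cast_injective h]
  rw [D.eq_smul_vec hv] at h0 ⊢
  rw [WMod.opP_smul, D.opP_vec hn, smul_ne_zero_iff, smul_ne_zero_iff]
  constructor
  · exact fun h => ⟨hn, by_contra fun h' => h.2.2 (D.vec_of_notMem h'), h.2.1⟩
  · exact fun h => ⟨(smul_ne_zero_iff.1 h0).1, h.2.2, D.vec_ne_zero h.2.1⟩

lemma opM_ne_zero_iff {n : ℤ} {v : D.lin} (hv : v ∈ weightSpace D.lin ((n + 1 : ℤ) : ℂ))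
    (h0 : v ≠ 0) : D.lin.opM v ≠ 0 ↔ n ∈ D.J ∧ n + 1 ∈ D.J ∧ D.q n ≠ 0 := by
  have hn : n + 1 ∈ D.J := by
    obtain ⟨m, hm, h⟩ := D.weight_int hv h0
    rwa [Int.cast_injective h]
  rw [D.eq_smul_vec hv] at h0 ⊢
  rw [WMod.opM_smul, D.opM_vec hn, smul_ne_zero_iff, smul_ne_zero_iff]
  constructor
  · exact fun h => ⟨by_contra fun h' => h.2.2 (D.vec_of_notMem h'), hn, h.2.1⟩
  · exact fun h => ⟨(smul_ne_zero_iff.1 h0).1, h.2.2, D.vec_ne_zero h.1⟩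

variable {D}

/-- Submodules are spanned by basis vectors. -/
lemma vec_mem_of_coef_ne_zero {N : Submodule (A t) D.lin} {v : D.lin} (hv : v ∈ N) {n : ℤ}
    (h : D.coef n v ≠ 0) : D.vec n ∈ N := by
  -- An interpolation polynomial: it vanishes at all other weights that occur in `v`, so `r • v` is
  -- a nonzero multiple of `v_n`.
  let r : ℂ[X] := ∏ m ∈ (LineOn.supp (v : LineOn D.J)).erase n, (X - C (m : ℂ))
  have hr : ∀ m : ℤ, r.eval (m : ℂ) = ∏ i ∈ (LineOn.supp (v : LineOn D.J)).erase n, ((m : ℂ) - i) :=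
    fun m => by simp only [r, eval_prod, eval_sub, eval_X, eval_C]
  have hrn : r.eval (n : ℂ) ≠ 0 := by
    rw [hr]
    refine Finset.prod_ne_zero_iff.2 fun i hi => sub_ne_zero.2 fun (h : (n : ℂ) = (i : ℂ)) => ?_
    exact (Finset.mem_erase.1 hi).1 (Int.cast_injective (α := ℂ) h).symm
  have h1 : r • v = (r.eval (n : ℂ) * D.coef n v) • D.vec n := by
    refine LineOn.ext (J := D.J) fun m => ?_
    refine (LineOn.coef_smul r (v : LineOn D.J) m).trans (Eq.trans ?_
      ((LineOn.coef m).map_smul (r.eval (n : ℂ) * D.coef n v) (LineOn.vec n : LineOn D.J)).symm)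
    by_cases hm : m = n
    · subst hm
      have hJ : m ∈ D.J := by_contra fun h' => h (LineOn.coef_of_notMem h' (v : LineOn D.J))
      rw [LineOn.coef_vec_self hJ, smul_eq_mul, mul_one]
      rfl
    · rw [LineOn.coef_vec_ne hm, smul_zero]
      by_cases h0 : LineOn.coef m (v : LineOn D.J) = 0
      · exact mul_eq_zero_of_right _ h0
      · exact mul_eq_zero_of_left ((hr m).trans (Finset.prod_eq_zero
          (Finset.mem_erase.2 ⟨hm, LineOn.mem_supp.2 h0⟩) (sub_self _))) _
  have h2 : r • v ∈ N := by
    rw [← D.lin.ofPoly_smul]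
    exact N.smul_mem _ hv
  rw [h1] at h2
  have h3 := N.smul_of_tower_mem (r.eval (n : ℂ) * D.coef n v)⁻¹ h2
  rwa [smul_smul, inv_mul_cancel₀ (mul_ne_zero hrn h), one_smul] at h3

/-- With all inner constants nonzero, `X⁺` and `X⁻` carry a basis vector to every other one along
the interval. -/
lemma vec_mem_of_vec_mem (hJ : D.J.OrdConnected)
    (h : ∀ n, n ∈ D.J → n + 1 ∈ D.J → D.p n ≠ 0 ∧ D.q n ≠ 0) {N : Submodule (A t) D.lin} {i : ℤ}
    (hi : i ∈ D.J) (hv : D.vec i ∈ N) (n : ℤ) : D.vec n ∈ N := by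
  by_cases hn : n ∈ D.J
  swap
  · rw [D.vec_of_notMem hn]; exact zero_mem _
  have up : ∀ d : ℕ, i + d ∈ D.J → D.vec (i + d) ∈ N := by
    intro d
    induction d with
    | zero => intro _; simpa using hv
    | succ d ih =>
      intro hd
      rw [Nat.cast_succ, ← add_assoc] at hd ⊢
      have hd' : i + d ∈ D.J := hJ.out hi hd ⟨by omega, by omega⟩
      have h1 : D.lin.opP (D.vec (i + d)) ∈ N := N.smul_mem (A.Xp t) (ih hd')
      rw [D.opP_vec hd'] at h1
      have h2 := N.smul_of_tower_mem (D.p (i + d))⁻¹ h1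
      rwa [smul_smul, inv_mul_cancel₀ (h _ hd' hd).1, one_smul] at h2
  have down : ∀ d : ℕ, i - d ∈ D.J → D.vec (i - d) ∈ N := by
    intro d
    induction d with
    | zero => intro _; simpa using hv
    | succ d ih =>
      intro hd
      have he : i - d = i - (d + 1 : ℕ) + 1 := by push_cast; ring
      generalize i - (d + 1 : ℕ) = j at hd he ⊢
      rw [he] at ih
      have hd' : j + 1 ∈ D.J := hJ.out hd hi ⟨by omega, by omega⟩
      have h1 : D.lin.opM (D.vec (j + 1)) ∈ N := N.smul_mem (A.Xm t) (ih hd')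
      rw [D.opM_vec hd'] at h1
      have h2 := N.smul_of_tower_mem (D.q j)⁻¹ h1
      rwa [smul_smul, inv_mul_cancel₀ (h _ hd hd').2, one_smul] at h2
  rcases le_total i n with hle | hle
  · obtain ⟨d, rfl⟩ : ∃ d : ℕ, n = i + d := ⟨(n - i).toNat, by omega⟩
    exact up d hn
  · obtain ⟨d, rfl⟩ : ∃ d : ℕ, n = i - d := ⟨(i - n).toNat, by omega⟩
    exact down d hn

/-- A string module is simple if `X^±` do not vanish inside of the string. -/
theorem IsString.isSimpleModule (hD : D.IsString)
    (h : ∀ n, n ∈ D.J → n + 1 ∈ D.J → D.p n ≠ 0 ∧ D.q n ≠ 0) : IsSimpleModule (A t) D.lin := by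
  have := hD.nontrivial
  have hs : IsSimpleOrder (Submodule (A t) D.lin) :=
    { eq_bot_or_eq_top N := by
        by_cases hN : N = ⊥
        · exact Or.inl hN
        refine Or.inr (eq_top_iff.2 fun w _ => ?_)
        obtain ⟨v, hv, h0⟩ := Submodule.exists_mem_ne_zero_of_ne_bot hN
        obtain ⟨i, hi⟩ : ∃ i, D.coef i v ≠ 0 := by
          by_contra! h'
          exact h0 (LineOn.ext (J := D.J) fun n => (h' n).trans (map_zero _).symm)
        have hw : w = ∑ n ∈ LineOn.supp (w : LineOn D.J), D.coef n w • D.vec n :=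
          LineOn.eq_sum w le_rfl
        rw [hw]
        refine sum_mem fun n _ => N.smul_of_tower_mem _ (vec_mem_of_vec_mem hD.ordConnected h
          (by_contra fun h' => hi (LineOn.coef_of_notMem h' (v : LineOn D.J)))
          (vec_mem_of_coef_ne_zero hv hi) n) }
  exact (isSimpleModule_iff _ _).2 hs

variable (D) in
/-- The submodule that is spanned by the `v_n` with `n ∈ S`. -/
def subOn (S : Set ℤ) (hp : ∀ n, n ∈ S → n + 1 ∉ S → D.p n = 0)
    (hq : ∀ n, n ∉ S → n + 1 ∈ S → D.q n = 0) : Submodule (A t) D.lin where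
  carrier := {v | ∀ n, n ∉ S → D.coef n v = 0}
  add_mem' hv hw n hn := by rw [map_add, hv n hn, hw n hn, add_zero]
  zero_mem' n _ := map_zero _
  smul_mem' a v hv := by
    induction a using A.induction generalizing v with
    | hc c =>
      intro n hn
      rw [algebraMap_smul, map_smul, hv n hn, smul_zero]
    | hg g =>
      intro n hn
      match g with
      | .z =>
        have h : A.gen t Gen.z • v = (X : ℂ[X]) • v := by
          rw [← D.lin.ofPoly_smul, A.ofPoly, aeval_X]
        rw [h]
        refine (LineOn.coef_smul X (v : LineOn D.J) n).trans ?_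
        exact mul_eq_zero_of_right _ (hv n hn)
      | .xp =>
        refine (congrArg (D.coef n) (D.opP_apply v)).trans ?_
        refine (LineOn.coef_wshift _ _ _ _ _ _).trans ?_
        split_ifs
        · by_cases h : n - 1 ∈ S
          · exact mul_eq_zero_of_left (hp _ h (by rwa [sub_add_cancel])) _
          · exact mul_eq_zero_of_right _ (hv _ h)
        · rfl
      | .xm =>
        refine (congrArg (D.coef n) (D.opM_apply v)).trans ?_
        refine (LineOn.coef_wshift _ _ _ _ _ _).trans ?_
        split_ifs
        · rw [sub_neg_eq_add]
          by_cases h : n + 1 ∈ S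
          · exact mul_eq_zero_of_left (hq _ hn h) _
          · exact mul_eq_zero_of_right _ (hv _ h)
        · rfl
    | ha a b h1 h2 =>
      intro n hn
      rw [add_smul, map_add, h1 v hv n hn, h2 v hv n hn, add_zero]
    | hm a b h1 h2 =>
      rw [mul_smul]
      exact h1 _ (h2 v hv)

lemma not_isSimpleModule (S : Set ℤ) (hp : ∀ n, n ∈ S → n + 1 ∉ S → D.p n = 0)
    (hq : ∀ n, n ∉ S → n + 1 ∈ S → D.q n = 0) {i j : ℤ} (hi : i ∈ D.J) (hiS : i ∈ S)
    (hj : j ∈ D.J) (hjS : j ∉ S) : ¬ IsSimpleModule (A t) D.lin := by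
  intro h
  rcases eq_bot_or_eq_top (D.subOn S hp hq) with h1 | h1
  · have : D.vec i ∈ D.subOn S hp hq := fun n hn =>
      LineOn.coef_vec_ne fun h => hn (h ▸ hiS)
    rw [h1, Submodule.mem_bot] at this
    exact D.vec_ne_zero hi this
  · have : D.vec j ∈ D.subOn S hp hq := h1 ▸ Submodule.mem_top
    have h2 := this j hjS
    rw [D.coef_vec_self hj] at h2
    exact one_ne_zero h2

end Chain

lemma WMod.indecomposable_of_isSimpleModule {t : ℂ[X]} {M : WMod t} (h : IsSimpleModule (A t) M) :
    M.Indecomposable :=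
  ⟨IsSimpleModule.nontrivial (A t) M, fun P Q hPQ => (eq_bot_or_eq_top P).imp_right fun hP => by
    have := hPQ.inf_eq_bot
    rwa [hP, top_inf_eq] at this⟩

/-! ### The modules over `A(z - k)` -/

section Linear

variable {Z : Set ℝ} (hZ : ∀ k ∈ Z, ∃ n : ℤ, k = n + 1 / 2)

lemma genChain_isString (κ : Kind) (k : Z) : (genChain hZ κ k).IsString where
  nonempty := by
    cases κ
    · exact ⟨idx k + 1, Int.lt_succ _⟩
    · exact ⟨idx k, le_refl (idx k)⟩
    · exact ⟨0, trivial⟩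
    · exact ⟨0, trivial⟩
  ordConnected := κ.ordConnected _
  edge_ne_zero n _ _ := by
    by_contra! h
    exact (Kind.q_eq_zero_iff.1 h.2).1 (Kind.p_eq_zero_iff.1 h.1).1

lemma genChain_p_eq_zero_iff {κ : Kind} {k : Z} {n : ℤ} :
    (genChain hZ κ k).p n = 0 ↔ κ = .ym ∧ n = idx k := Kind.p_eq_zero_iff

lemma genChain_q_eq_zero_iff {κ : Kind} {k : Z} {n : ℤ} :
    (genChain hZ κ k).q n = 0 ↔ κ ≠ .ym ∧ n = idx k := Kind.q_eq_zero_iff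

/-- The directed set of a generator. -/
def Kind.dirSet : Kind → ℝ → DirSet
  | .xp, k => .above k
  | .xm, k => .below k
  | .yp, k => .lineRight k
  | .ym, k => .lineLeft k

lemma lt_int_iff (hZ : ∀ k ∈ Z, ∃ n : ℤ, k = n + 1 / 2) (k : Z) (n : ℤ) :
    (k : ℝ) < n ↔ idx k < n := by
  rw [eq_idx hZ k]
  constructor <;> intro h
  · have : (idx k : ℝ) < n := by linarith
    exact_mod_cast this
  · have : ((idx k + 1 : ℤ) : ℝ) ≤ n := by exact_mod_cast h
    push_cast at this
    linarith

lemma int_lt_iff (hZ : ∀ k ∈ Z, ∃ n : ℤ, k = n + 1 / 2) (k : Z) (n : ℤ) :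
    (n : ℝ) < k ↔ n ≤ idx k := by
  have h1 := lt_int_iff hZ k n
  have h2 : (n : ℝ) ≠ k := by
    intro h
    have h3 := eq_idx hZ k
    rw [← h] at h3
    have h4 : (2 * n : ℤ) = 2 * idx k + 1 := by
      have : (2 * n : ℝ) = 2 * idx k + 1 := by linarith
      exact_mod_cast this
    omega
  rw [← not_lt, ← h1, not_lt]
  exact ⟨le_of_lt, fun h => lt_of_le_of_ne h h2⟩

lemma Kind.dirSet_ne_out_iff (hZ : ∀ k ∈ Z, ∃ n : ℤ, k = n + 1 / 2) (κ : Kind) (k : Z)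
    (n : ℤ) :
    κ.dirSet k n ≠ .out ↔ n ∈ κ.J (idx k) := by
  have h1 := lt_int_iff hZ k n
  have h2 := int_lt_iff hZ k n
  cases κ
  · simp [Kind.dirSet, DirSet.above, Kind.J, h1]
  · simp [Kind.dirSet, DirSet.below, Kind.J, h2]
  · by_cases h : (n : ℝ) = k <;> simp [Kind.dirSet, DirSet.lineRight, Kind.J, h]
  · by_cases h : (n : ℝ) = k <;> simp [Kind.dirSet, DirSet.lineLeft, Kind.J, h]

lemma genChain_isModuleOf (κ : Kind) (k : Z) :
    (genChain hZ κ k).lin.IsModuleOf (κ.dirSet k) where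
  indecomposable := (genChain_isString hZ κ k).indecomposable
  support l := (genChain hZ κ k).weightSpace_ne_bot_iff.trans <| exists_congr fun n =>
    and_congr_right fun _ => (Kind.dirSet_ne_out_iff hZ κ k n).symm
  right k' hk' v hv h0 := by
    obtain rfl : (k : ℝ) = k' := Complex.ofReal_injective (root_X_sub_C.1 hk')
    -- The weight `k - 1/2` is the lower end of the edge at the root; `k + 1/2` is the upper end.
    have he : (((k : ℝ) : ℂ) - 1 / 2) = (idx k : ℤ) := by rw [eq_idx hZ k]; push_cast; ring
    rw [he] at hv
    refine ((genChain hZ κ k).opP_ne_zero_iff hv h0).trans ?_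
    change idx k ∈ κ.J (idx k) ∧ idx k + 1 ∈ κ.J (idx k) ∧ κ.p (idx k) (idx k) ≠ 0 ↔ _
    cases κ <;> simp [Kind.J, Kind.p, Kind.dirSet, DirSet.above, DirSet.below, DirSet.lineRight,
      DirSet.lineLeft]
  left k' hk' v hv h0 := by
    obtain rfl : (k : ℝ) = k' := Complex.ofReal_injective (root_X_sub_C.1 hk')
    have he : (((k : ℝ) : ℂ) + 1 / 2) = ((idx k + 1 : ℤ) : ℂ) := by
      rw [eq_idx hZ k]; push_cast; ring
    rw [he] at hv
    refine ((genChain hZ κ k).opM_ne_zero_iff hv h0).trans ?_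
    change idx k ∈ κ.J (idx k) ∧ idx k + 1 ∈ κ.J (idx k) ∧ κ.q (idx k) (idx k) ≠ 0 ↔ _
    cases κ <;> simp [Kind.J, Kind.q, Kind.dirSet, DirSet.above, DirSet.below, DirSet.lineRight,
      DirSet.lineLeft]

lemma genChain_xp_isSimpleModule (k : Z) :
    IsSimpleModule (A (linear k : ℂ[X])) (genChain hZ .xp k).lin :=
  (genChain_isString hZ .xp k).isSimpleModule fun n h1 _ =>
    have h : n ≠ idx k := (show idx k < n from h1).ne'
    ⟨fun h' => h ((genChain_p_eq_zero_iff hZ).1 h').2,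
      fun h' => h ((genChain_q_eq_zero_iff hZ).1 h').2⟩

lemma genChain_xm_isSimpleModule (k : Z) :
    IsSimpleModule (A (linear k : ℂ[X])) (genChain hZ .xm k).lin :=
  (genChain_isString hZ .xm k).isSimpleModule fun n _ h2 =>
    have h : n ≠ idx k := (Int.lt_of_add_one_le (show n + 1 ≤ idx k from h2)).ne
    ⟨fun h' => h ((genChain_p_eq_zero_iff hZ).1 h').2,
      fun h' => h ((genChain_q_eq_zero_iff hZ).1 h').2⟩

/-- `X⁻` vanishes on the edge at the root, so the span of the `v_n` above it is a proper nonzero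
submodule. -/
lemma genChain_yp_not_isSimpleModule (k : Z) :
    ¬ IsSimpleModule (A (linear k : ℂ[X])) (genChain hZ .yp k).lin :=
  Chain.not_isSimpleModule (Set.Ioi (idx k))
    (fun n h1 h2 => absurd (Set.mem_Ioi.2 ((Set.mem_Ioi.1 h1).trans (Int.lt_succ n))) h2)
    (fun n h1 h2 => (genChain_q_eq_zero_iff hZ).2 ⟨by simp, by
      rw [Set.mem_Ioi] at h1 h2; omega⟩)
    (i := idx k + 1) (j := idx k) trivial (Int.lt_succ _) trivial
    Set.self_notMem_Ioi

/-- Here `X⁺` vanishes on that edge, and the part below it is the submodule. -/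
lemma genChain_ym_not_isSimpleModule (k : Z) :
    ¬ IsSimpleModule (A (linear k : ℂ[X])) (genChain hZ .ym k).lin :=
  Chain.not_isSimpleModule (Set.Iic (idx k))
    (fun n h1 h2 => (genChain_p_eq_zero_iff hZ).2 ⟨rfl, by
      rw [Set.mem_Iic] at h1 h2; omega⟩)
    (fun n h1 h2 => absurd (Set.mem_Iic.2 ((Int.lt_succ n).le.trans (Set.mem_Iic.1 h2))) h1)
    (i := idx k) (j := idx k + 1) trivial (Set.mem_Iic.2 le_rfl) trivial
    (fun h => absurd (Set.mem_Iic.1 h) (by omega))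

lemma genChain_xp_not_iso_xm (k : Z) :
    IsEmpty ((genChain hZ .xp k).lin ≃ₗ[A (linear k : ℂ[X])] (genChain hZ .xm k).lin) :=
  ⟨fun e => absurd (show idx k + 1 ≤ idx k from
    Chain.mem_of_iso e (n := idx k + 1) (Int.lt_succ (idx k))) (by omega)⟩

lemma genChain_yp_not_iso_ym (k : Z) :
    IsEmpty ((genChain hZ .yp k).lin ≃ₗ[A (linear k : ℂ[X])] (genChain hZ .ym k).lin) :=
  ⟨fun e => ((genChain_q_eq_zero_iff hZ).1 (Chain.q_eq_zero_of_iso e (n := idx k) trivial trivial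
    ((genChain_q_eq_zero_iff hZ).2 ⟨by simp, rfl⟩))).1 rfl⟩

/-- The modules of the generators are the indecomposable modules over `A(z - k)`. -/
theorem WMod.Indecomposable.exists_genChain {k : Z} {M : WMod (linear k : ℂ[X])}
    (hM : M.Indecomposable) :
    ∃ κ : Kind, Nonempty (M ≃ₗ[A (linear k : ℂ[X])] (genChain hZ κ k).lin) := by
  obtain ⟨D, hD, ⟨e⟩⟩ := hM.exists_string (linear k).2.1.ne_zero
  -- The type of `D` depends on the degree, so the equality of `linearProd {k}` and `linear k` is
  -- applied with the degree as a variable.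
  have key : ∀ t : polyMonoid Z, linearProd {k} = t → ∀ D : Chain (t : ℂ[X]), D.IsString →
      D.Similar (wordChain hZ {k} fun j => D.state (idx j)) := by
    rintro t rfl D hD
    exact hD.similar_wordChain hZ
  have h := key (linear k) (by rw [linearProd, Multiset.map_singleton, Multiset.prod_singleton])
    D hD
  have hs : D.Similar (genChain hZ (D.state (idx k)) k) :=
    { J_eq := h.J_eq.trans (Set.ext fun n => ⟨fun hn => hn k (Multiset.mem_singleton_self k),
        fun hn j hj => by rw [Multiset.mem_singleton.1 hj]; exact hn⟩)
      p_iff n h1 h2 := (h.p_iff n h1 h2).trans (by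
        simp only [wordChain, genChain, Multiset.map_singleton, Multiset.prod_singleton])
      q_iff n h1 h2 := (h.q_iff n h1 h2).trans (by
        simp only [wordChain, genChain, Multiset.map_singleton, Multiset.prod_singleton]) }
  obtain ⟨e'⟩ := hs.iso
  exact ⟨_, ⟨e.trans e'⟩⟩

end Linear

end SplitTGWA

end

open Polynomial SplitTGWA in
theorem mainTheorem6 (Z : Set ℝ) (hZ : ∀ k ∈ Z, ∃ n : ℤ, k = n + 1 / 2) :
    ∃ φ : Presented Z ≃ₐ[ℂ] SplitAlg (polyMonoid Z),
      ∀ k : Z, ∃ Mp Mm Np Nm : WMod (linear k : ℂ[X]),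
        -- the modules attached to `(k, ∞)`, `(-∞, k)`, `ℝ_k^+`, `ℝ_k^-`
        (Mp.IsModuleOf (DirSet.above k) ∧ Mm.IsModuleOf (DirSet.below k) ∧
          Np.IsModuleOf (DirSet.lineRight k) ∧ Nm.IsModuleOf (DirSet.lineLeft k)) ∧
        -- the images of the generators
        (φ (Ideal.Quotient.mk (relIdeal Z) (xp k)) = SplitAlg.cls (linear k) Mp ∧
          φ (Ideal.Quotient.mk (relIdeal Z) (xm k)) = SplitAlg.cls (linear k) Mm ∧
          φ (Ideal.Quotient.mk (relIdeal Z) (yp k)) = SplitAlg.cls (linear k) Np ∧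
          φ (Ideal.Quotient.mk (relIdeal Z) (ym k)) = SplitAlg.cls (linear k) Nm) ∧
        -- `Mp`, `Mm` are the two simple objects
        (IsSimpleModule (A (linear k : ℂ[X])) Mp ∧ IsSimpleModule (A (linear k : ℂ[X])) Mm ∧
          IsEmpty (Mp ≃ₗ[A (linear k : ℂ[X])] Mm) ∧
          ∀ M : WMod (linear k : ℂ[X]), IsSimpleModule (A (linear k : ℂ[X])) M →
            Nonempty (M ≃ₗ[A (linear k : ℂ[X])] Mp) ∨ Nonempty (M ≃ₗ[A (linear k : ℂ[X])] Mm)) ∧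
        -- `Np`, `Nm` are the two non-simple indecomposable objects
        (¬ IsSimpleModule (A (linear k : ℂ[X])) Np ∧ ¬ IsSimpleModule (A (linear k : ℂ[X])) Nm ∧
          IsEmpty (Np ≃ₗ[A (linear k : ℂ[X])] Nm) ∧
          ∀ M : WMod (linear k : ℂ[X]), M.Indecomposable →
            ¬ IsSimpleModule (A (linear k : ℂ[X])) M →
            Nonempty (M ≃ₗ[A (linear k : ℂ[X])] Np) ∨ Nonempty (M ≃ₗ[A (linear k : ℂ[X])] Nm)) := by
  refine ⟨AlgEquiv.ofBijective (phi hZ) ⟨phi_injective hZ, phi_surjective hZ⟩, fun k =>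
    ⟨(genChain hZ .xp k).lin, (genChain hZ .xm k).lin, (genChain hZ .yp k).lin,
      (genChain hZ .ym k).lin,
      ⟨genChain_isModuleOf hZ .xp k, genChain_isModuleOf hZ .xm k, genChain_isModuleOf hZ .yp k,
        genChain_isModuleOf hZ .ym k⟩,
      ⟨phi_pgen hZ .xp k, phi_pgen hZ .xm k, phi_pgen hZ .yp k, phi_pgen hZ .ym k⟩,
      ⟨genChain_xp_isSimpleModule hZ k, genChain_xm_isSimpleModule hZ k,
        genChain_xp_not_iso_xm hZ k, fun M hM => ?_⟩,
      ⟨genChain_yp_not_isSimpleModule hZ k, genChain_ym_not_isSimpleModule hZ k,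
        genChain_yp_not_iso_ym hZ k, fun M hM hs => ?_⟩⟩⟩
  -- A simple object is indecomposable, hence one of the four strings, and those of `y_k^±` are not
  -- simple.
  · obtain ⟨κ, ⟨e⟩⟩ := (WMod.indecomposable_of_isSimpleModule hM).exists_genChain hZ
    cases κ
    · exact Or.inl ⟨e⟩
    · exact Or.inr ⟨e⟩
    · exact absurd (IsSimpleModule.congr e.symm) (genChain_yp_not_isSimpleModule hZ k)
    · exact absurd (IsSimpleModule.congr e.symm) (genChain_ym_not_isSimpleModule hZ k)
  · obtain ⟨κ, ⟨e⟩⟩ := hM.exists_genChain hZ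
    cases κ
    · have := genChain_xp_isSimpleModule hZ k
      exact absurd (IsSimpleModule.congr e) hs
    · have := genChain_xm_isSimpleModule hZ k
      exact absurd (IsSimpleModule.congr e) hs
    · exact Or.inl ⟨e⟩
    · exact Or.inr ⟨e⟩
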